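/- **Setting.** A locally finite span $A\leftarrow Q\to B$ of sets is one whose source map has finite fibres; spans compose by fibre product, and 2-morphisms are fibrewise bijections. An augmented semi-simplicial object in the Burnside category, $X_\bullet$, is a strictly unital contravariant pseudo-functor from the category of finite ordinals $[n]=\{0,\dots,n\}$, $n\ge -1$, and order-preserving injections to this 2-category: it consists of sets $X_n$, locally finite spans $\partial^n_U\colon X_n\leftarrow\cdot\to X_{n-|U|}$ for $U\subseteq[n]$ (also written $\partial_U$ for the underlying set), and coherent fibrewise bijections $\mu_{V,W}\colon\partial^n_{V\sqcup W}\cong\partial^{n-|V|}_{\psi_V(W)}\circ\partial^n_V$, where $\psi_V(W)\subseteq [n-|V|]$ is $W$ renumbered after deleting $V$. A map $f\colon X_\bullet\to Y_\bullet$ is a strictly unital pseudo-natural transformation: locally finite spans $f_n\colon X_n\leftarrow\cdot\to Y_n$ with fibrewise bijections $f_{n-|U|}\circ\partial_U\cong\bar\partial_U\circ f_n$ compatible with identities and with the $\mu$'s. No freeness (injectivity of the source maps) and no compatibility with orders is required of $f$. An order on $X_\bullet$ is an arbitrary choice of a linear order on each set $\partial^n_U$. Let $C^n(X_\bullet;\mathbb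 F_2)=\mathbb F_2^{X_n}$ with coboundary $(d\alpha)(\sigma)=\sum_{u}\sum_{s\in\partial_{\{u\}},\,\mathrm{source}(s)=\sigma}\alpha(\mathrm{target}(s))$, and let $H^n(X_\bullet;\mathbb F_2)$ be its cohomology; $f$ induces $f^*$ by $(f^*\alpha)(\sigma)=\sum_{s\in f_n,\ \mathrm{source}(s)=\sigma}\alpha(\mathrm{target}(s))$. **Products.** For disjoint $A,B\subseteq U$, let $\lambda_A\colon\partial_U\to\partial_A$ and $\lambda_{A,B}\colon\partial_U\to\partial_{\psi_A(B)}$ be the projections of the decompositions $\partial_U\cong\partial_{\psi_A(U\smallsetminus A)}\circ\partial_A$ and $\partial_U\cong\partial_{\psi_{A\cup B}(U\smallsetminus(A\cup B))}\circ\partial_{\psi_A(B)}\circ\partial_A$. For $(s,t)\in\partial^n_U\times\partial^n_V$, a pair $(W^\shortparallel,W^\circ)$ of disjoint subsets of $U\cap V$ is good if $\lambda_{W^\shortparallel}(s)=\lambda_{W^\shortparallel}(t)$ and $\lambda_{W^\shortparallel,W^\circ}(s)\ne\lambda_{W^\shortparallel,W^\circ}(t)$; a good pair is positive if $\lambda_{W^\shortparallel,W^\circ}(s)<\lambda_{W^\shortparallel,W^\circ}(t)$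 when $n+|U|+|V|$ is even, and $>$ when it is odd. Let $\mathcal O_{s,t}(U\cap V)^+$ be the set of chains of $r=|U\cap V|$ positive pairs in which each pair is obtained from the preceding one by adding one new element to $W^\circ$ and deleting it from $W^\shortparallel$ if it is there (one empty chain if $r=0$). For a non-decreasing sequence $U$ in $\{0,\dots,n\}$ in which each number occurs at most twice, let $|U|$ be its length; the index of a number $u$ in $U$ is $u+j$ if $u$ is the $j$-th distinct number of $U$ ($j\ge1$). Let $U^-$ (resp. $U^+$) consist of the numbers occurring once with odd (resp. even) index together with all the numbers occurring twice. For an ordered $X_\bullet$, $k\in\mathbb Z$, $\alpha\in C^p$, $\beta\in C^q$ and $n=p+q-k$, define $\alpha\smile_k\beta\in C^{n}$ by $$(\alpha\smile_k\beta)(\sigma)=\sum_{\substack{|U|=n-k\\ n-|U^-|=p,\ n-|U^+|=q}}\ \sum_{\substack{s\in\partial^n_{U^-},\ t\in\partial^n_{U^+}\\ \mathrm{source}(s)=\mathrm{source}(t)=\sigma}}|\mathcal O_{s,t}(U^-\cap U^+)^+|\;\alpha(\mathrm{target}(s))\,\beta(\mathrm{target}(t)).$$ **Theorem.** For every ordered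 augmented semi-simplicial object $X_\bullet$ in the Burnside category, every $n\ge-1$ and $i\ge0$, the rule $\mathfrak{sq}^i([\alpha])=[\alpha\smile_{n-i}\alpha]$ is a well-defined operation $\mathfrak{sq}^i\colon H^n(X_\bullet;\mathbb F_2)\to H^{n+i}(X_\bullet;\mathbb F_2)$. For every map $f\colon X_\bullet\to Y_\bullet$ of augmented semi-simplicial objects in the Burnside category and any orders on $X_\bullet$ and $Y_\bullet$, $f^*\mathfrak{sq}^i=\mathfrak{sq}^if^*$. In particular, the operations $\mathfrak{sq}^i$ on $H^*(X_\bullet;\mathbb F_2)$ do not depend on the chosen order on $X_\bullet$. -/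

import Mathlib

universe u

noncomputable section

namespace Burnside

/-! ### The Burnside 2-category -/

/-- A locally finite span `A ← carrier → B`: a 1-morphism from `A` to `B`. -/
structure LFSpan (A B : Type u) where
  carrier : Type u
  src : carrier → A
  tgt : carrier → B
  finite_fiber : ∀ a, {s | src s = a}.Finite

namespace LFSpan

variable {A B C : Type u}

/-- The finite set `src⁻¹(a)`. -/
def fiber (P : LFSpan A B) (a : A) : Finset P.carrier := (P.finite_fiber a).toFinset

theorem mem_fiber (P : LFSpan A B) (a : A) (s : P.carrier) : s ∈ P.fiber a ↔ P.src s = a := by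
  simp [fiber]

/-- The composite span `A ← P ×_B Q → C`, "first `P`, then `Q`". -/
abbrev comp (P : LFSpan A B) (Q : LFSpan B C) : LFSpan A C where
  carrier := {p : P.carrier × Q.carrier // P.tgt p.1 = Q.src p.2}
  src p := P.src p.1.1
  tgt p := Q.tgt p.1.2
  finite_fiber a := by
    have h : {p : P.carrier × Q.carrier | P.src p.1 = a ∧ P.tgt p.1 = Q.src p.2}.Finite := by
      refine Set.Finite.subset ((P.finite_fiber a).biUnion fun s _ =>
        (Set.finite_singleton s).prod (Q.finite_fiber (P.tgt s))) ?_
      rintro ⟨s, t⟩ ⟨h1, h2⟩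
      simp only [Set.mem_iUnion]
      exact ⟨s, h1, rfl, h2.symm⟩
    refine Set.Finite.of_finite_image (f := Subtype.val) (h.subset ?_)
      Subtype.val_injective.injOn
    rintro _ ⟨p, hp, rfl⟩
    exact ⟨hp, p.2⟩

/-- A fibrewise bijection between spans: a 2-morphism. -/
structure FibrewiseBijection (P Q : LFSpan A B) extends P.carrier ≃ Q.carrier where
  src_eq : ∀ s, Q.src (toFun s) = P.src s
  tgt_eq : ∀ s, Q.tgt (toFun s) = P.tgt s

/-- The `𝔽₂`-dual of the linear map `𝔽₂⟨A⟩ → 𝔽₂⟨B⟩`, `a ↦ ∑_{src s = a} tgt s`, determined by a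
span; the dual of the free module on a set is the module of functions on it. -/
def pullback (P : LFSpan A B) : (B → ZMod 2) →ₗ[ZMod 2] (A → ZMod 2) where
  toFun α := fun a => ∑ s ∈ P.fiber a, α (P.tgt s)
  map_add' α β := by ext a; simp [Finset.sum_add_distrib]
  map_smul' c α := by ext a; simp [Finset.mul_sum]

theorem pullback_apply (P : LFSpan A B) (α : B → ZMod 2) (a : A) :
    P.pullback α a = ∑ s ∈ P.fiber a, α (P.tgt s) := rfl

theorem pullback_congr {P Q : LFSpan A B} (e : FibrewiseBijection P Q) :
    P.pullback = Q.pullback := by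
  ext α a
  simp only [pullback_apply]
  refine Finset.sum_equiv e.toEquiv (fun s => ?_) (fun s _ => ?_)
  · rw [mem_fiber, mem_fiber]; exact (e.src_eq s).symm ▸ Iff.rfl
  · exact congrArg _ (e.tgt_eq s).symm

theorem pullback_comp (P : LFSpan A B) (Q : LFSpan B C) (α : C → ZMod 2) :
    (P.comp Q).pullback α = P.pullback (Q.pullback α) := by
  funext a
  simp only [pullback_apply]
  rw [Finset.sum_sigma']
  refine Finset.sum_bij' (fun p _ => ⟨p.1.1, p.1.2⟩)
    (fun x hx => ⟨(x.1, x.2), ?_⟩) ?_ ?_ ?_ ?_ ?_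
  · simp only [Finset.mem_sigma, mem_fiber] at hx
    exact hx.2.symm
  · intro p hp
    rw [mem_fiber] at hp
    simp only [Finset.mem_sigma, mem_fiber]
    exact ⟨hp, p.2.symm⟩
  · intro x hx
    simp only [Finset.mem_sigma, mem_fiber] at hx
    exact (mem_fiber _ _ _).2 hx.1
  · intros; rfl
  · intros; rfl
  · intros; rfl

end LFSpan

open LFSpan

/-! ### Augmented semi-simplicial objects in the Burnside 2-category

The ordinal `[n]`, `n ≥ -1`, is `Fin (n + 1)`. Throughout, a natural number `m` used as an index
stands for the ordinal `[m - 1] = Fin m` with `m` elements: simplices, cochains and cohomology of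
degree `n ≥ -1` are indexed by `m = n + 1 ≥ 0`. -/

/-- The identity of the ordinal with `n` elements. -/
def idEmb (n : ℕ) : Fin n ↪o Fin n := RelEmbedding.refl (· ≤ ·)

/-- An augmented semi-simplicial object in the Burnside 2-category: a strictly unital contravariant
pseudo-functor on the category of finite ordinals and order-preserving injections. Strict unitality
is expressed through the canonical (unique) identification of an identity span `A = A = A` with
a span whose two legs agree and are bijective. -/
structure SemiSimplicialObject where
  /-- the set of `(n - 1)`-simplices -/
  obj : ℕ → Type u
  /-- the generalised face spans -/
  face : ∀ {m n : ℕ}, (Fin m ↪o Fin n) → LFSpan (obj n) (obj m)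
  /-- the structural 2-morphism of each decomposition `h = f ∘ g` -/
  mu : ∀ {k m n : ℕ} (f : Fin m ↪o Fin n) (g : Fin k ↪o Fin m) (h : Fin k ↪o Fin n),
    g.trans f = h → FibrewiseBijection (face h) ((face f).comp (face g))
  face_id_bijective : ∀ n, Function.Bijective (face (idEmb n)).src
  face_id_tgt : ∀ n s, (face (idEmb n)).tgt s = (face (idEmb n)).src s
  mu_id_left : ∀ {m n : ℕ} (f : Fin m ↪o Fin n) (e : f.trans (idEmb n) = f) (s : (face f).carrier),
    ((mu (idEmb n) f f e).toFun s).1.2 = s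
  mu_id_right : ∀ {m n : ℕ} (f : Fin m ↪o Fin n) (e : (idEmb m).trans f = f)
    (s : (face f).carrier), ((mu f (idEmb m) f e).toFun s).1.1 = s
  /-- the two ways of decomposing an element of a threefold composite agree -/
  mu_assoc : ∀ {m₃ m₂ m₁ n : ℕ} (f₁ : Fin m₁ ↪o Fin n) (f₂ : Fin m₂ ↪o Fin m₁)
    (f₃ : Fin m₃ ↪o Fin m₂) (f₁₂ : Fin m₂ ↪o Fin n) (f₂₃ : Fin m₃ ↪o Fin m₁)
    (f₁₂₃ : Fin m₃ ↪o Fin n) (e₁₂ : f₂.trans f₁ = f₁₂) (e₂₃ : f₃.trans f₂ = f₂₃)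
    (e : f₂₃.trans f₁ = f₁₂₃) (e' : f₃.trans f₁₂ = f₁₂₃) (s : (face f₁₂₃).carrier),
    let a := (mu f₁ f₂₃ f₁₂₃ e).toFun s
    let b := (mu f₂ f₃ f₂₃ e₂₃).toFun a.1.2
    let c := (mu f₁₂ f₃ f₁₂₃ e').toFun s
    let d := (mu f₁ f₂ f₁₂ e₁₂).toFun c.1.1
    a.1.1 = d.1.1 ∧ b.1.1 = d.1.2 ∧ b.1.2 = c.1.2

namespace SemiSimplicialObject

/-- A map `X → Y`: a strictly unital pseudo-natural transformation. -/
structure Map (X Y : SemiSimplicialObject.{u}) where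
  span : ∀ n, LFSpan (X.obj n) (Y.obj n)
  /-- the fibrewise bijection `f_m ∘ ∂_g → ∂_g ∘ f_n` -/
  square : ∀ {m n : ℕ} (g : Fin m ↪o Fin n),
    FibrewiseBijection ((X.face g).comp (span m)) ((span n).comp (Y.face g))
  square_id : ∀ n (p : ((X.face (idEmb n)).comp (span n)).carrier),
    ((square (idEmb n)).toFun p).1.1 = p.1.2
  square_comp : ∀ {k m n : ℕ} (f : Fin m ↪o Fin n) (g : Fin k ↪o Fin m) (h : Fin k ↪o Fin n)
    (e : g.trans f = h) (p : ((X.face h).comp (span k)).carrier),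
    let s := (X.mu f g h e).toFun p.1.1
    let s' : ((X.face g).comp (span k)).carrier :=
      ⟨(s.1.2, p.1.2), ((X.mu f g h e).tgt_eq p.1.1).trans p.2⟩
    let q := (square g).toFun s'
    let r := (square f).toFun ⟨(s.1.1, q.1.1), s.2.trans ((square g).src_eq s').symm⟩
    let w := (square h).toFun p
    let t := (Y.mu f g h e).toFun w.1.2
    w.1.1 = r.1.1 ∧ t.1.1 = r.1.2 ∧ t.1.2 = q.1.2

/-- An order on `X`: a linear order on (the underlying set of) each generalised face span. No
compatibility is required. -/
structure Ordering (X : SemiSimplicialObject.{u}) where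
  order : ∀ {m n : ℕ} (g : Fin m ↪o Fin n), LinearOrder (X.face g).carrier

/-! ### Cochains and cohomology with coefficients in `𝔽₂` -/

/-- Cochains with coefficients in `𝔽₂`. -/
abbrev Cochain (X : SemiSimplicialObject.{u}) (n : ℕ) : Type u := X.obj n → ZMod 2

/-- The coboundary, dual to the sum of the face maps. -/
def d (X : SemiSimplicialObject.{u}) (n : ℕ) : X.Cochain n →ₗ[ZMod 2] X.Cochain (n + 1) :=
  ∑ i : Fin (n + 1), (X.face (Fin.succAboveOrderEmb i)).pullback

/-- Cocycles. -/
def cocycles (X : SemiSimplicialObject.{u}) (n : ℕ) : Submodule (ZMod 2) (X.Cochain n) :=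
  LinearMap.ker (X.d n)

/-- Coboundaries; there are no cochains below the lowest degree, which has index `0`. -/
def coboundaries (X : SemiSimplicialObject.{u}) : ∀ n, Submodule (ZMod 2) (X.Cochain n)
  | 0 => ⊥
  | n + 1 => LinearMap.range (X.d n)

theorem pullback_face_trans (X : SemiSimplicialObject.{u}) {k m n : ℕ} (f : Fin m ↪o Fin n)
    (g : Fin k ↪o Fin m) (α : X.Cochain k) :
    (X.face f).pullback ((X.face g).pullback α) = (X.face (g.trans f)).pullback α := by
  rw [← pullback_comp, pullback_congr (X.mu f g _ rfl)]

/-- The cochains form a cochain complex. -/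
theorem d_d (X : SemiSimplicialObject.{u}) (n : ℕ) (α : X.Cochain n) :
    X.d (n + 1) (X.d n α) = 0 := by
  have h : X.d (n + 1) (X.d n α) = ∑ x : Fin (n + 2) × Fin (n + 1),
      (X.face ((Fin.succAboveOrderEmb x.2).trans (Fin.succAboveOrderEmb x.1))).pullback α := by
    simp only [d, LinearMap.sum_apply, map_sum, pullback_face_trans, Fintype.sum_prod_type]
    exact Finset.sum_comm
  rw [h]
  have key : ∀ x : Fin (n + 2) × Fin (n + 1),
      (Fin.succAboveOrderEmb (x.2.predAbove x.1)).trans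
        (Fin.succAboveOrderEmb (x.1.succAbove x.2)) =
      (Fin.succAboveOrderEmb x.2).trans (Fin.succAboveOrderEmb x.1) := by
    intro x
    ext k
    exact congrArg Fin.val (Fin.succAbove_succAbove_succAbove_predAbove x.1 x.2 k)
  refine Finset.sum_involution (fun x _ => (x.1.succAbove x.2, x.2.predAbove x.1))
    (fun x _ => ?_) (fun x _ _ hx => ?_) (fun _ _ => Finset.mem_univ _) (fun x _ => ?_)
  · rw [key]
    funext σ
    exact CharTwo.add_self_eq_zero _
  · exact Fin.succAbove_ne x.1 x.2 (congrArg Prod.fst hx)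
  · exact Prod.ext (Fin.succAbove_succAbove_predAbove x.1 x.2)
      (Fin.predAbove_predAbove_succAbove x.1 x.2)

theorem coboundaries_le_cocycles (X : SemiSimplicialObject.{u}) (n : ℕ) :
    X.coboundaries n ≤ X.cocycles n := by
  cases n with
  | zero => exact bot_le
  | succ n =>
    rintro _ ⟨α, rfl⟩
    exact X.d_d n α

/-- `H^{n-1}(X; 𝔽₂)`: cocycles modulo coboundaries. -/
abbrev Cohomology (X : SemiSimplicialObject.{u}) (n : ℕ) : Type u :=
  X.cocycles n ⧸ (X.coboundaries n).submoduleOf (X.cocycles n)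

/-- The cohomology class of a cocycle. -/
def cls (X : SemiSimplicialObject.{u}) {n : ℕ} (α : X.cocycles n) : X.Cohomology n :=
  Submodule.Quotient.mk α

namespace Map

variable {X Y : SemiSimplicialObject.{u}}

/-- The homomorphism `f^*` on cochains. -/
def cochainMap (f : Map X Y) (n : ℕ) : Y.Cochain n →ₗ[ZMod 2] X.Cochain n :=
  (f.span n).pullback

theorem d_cochainMap (f : Map X Y) (n : ℕ) (α : Y.Cochain n) :
    X.d n (f.cochainMap n α) = f.cochainMap (n + 1) (Y.d n α) := by
  simp only [d, cochainMap, LinearMap.sum_apply, map_sum]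
  refine Finset.sum_congr rfl fun i _ => ?_
  rw [← pullback_comp, ← pullback_comp, pullback_congr (f.square _)]

theorem cochainMap_mem_cocycles (f : Map X Y) (n : ℕ) {α : Y.Cochain n} (h : α ∈ Y.cocycles n) :
    f.cochainMap n α ∈ X.cocycles n := by
  have h' : Y.d n α = 0 := h
  show X.d n _ = 0
  rw [d_cochainMap, h', map_zero]

theorem cochainMap_mem_coboundaries (f : Map X Y) (n : ℕ) {α : Y.Cochain n}
    (h : α ∈ Y.coboundaries n) : f.cochainMap n α ∈ X.coboundaries n := by
  cases n with
  | zero =>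
    have h' : α = 0 := h
    rw [h', map_zero]
    exact Submodule.zero_mem _
  | succ n =>
    obtain ⟨β, rfl⟩ := h
    exact ⟨f.cochainMap n β, f.d_cochainMap n β⟩

/-- The homomorphism `f^*` on cohomology. -/
def cohomologyMap (f : Map X Y) (n : ℕ) : Y.Cohomology n →ₗ[ZMod 2] X.Cohomology n :=
  Submodule.mapQ _ _ ((f.cochainMap n).restrict fun _ h => f.cochainMap_mem_cocycles n h)
    fun _ h => f.cochainMap_mem_coboundaries n h

end Map

end SemiSimplicialObject

/-! ### Faces and their factorisations -/

/-- The elements missed by an order-preserving injection `g`; `g` is the generalised face map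
`∂_U` with `U = missing g`. -/
def missing {m n : ℕ} (g : Fin m ↪o Fin n) : Finset (Fin n) :=
  (Finset.univ.map g.toEmbedding)ᶜ

/-- The order-preserving injection that misses exactly `W`, where `p` is the number of elements
outside `W`. -/
def missEmb {n : ℕ} (W : Finset (Fin n)) {p : ℕ} (h : Wᶜ.card = p) : Fin p ↪o Fin n :=
  Wᶜ.orderEmbOfFin h

/-- The generalised face map `∂_W`. -/
abbrev faceMap {n : ℕ} (W : Finset (Fin n)) : Fin Wᶜ.card ↪o Fin n := missEmb W rfl

theorem missing_missEmb {n : ℕ} (W : Finset (Fin n)) {p : ℕ} (h : Wᶜ.card = p) :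
    missing (missEmb W h) = W := by
  simp [missing, missEmb, Finset.map_orderEmbOfFin_univ]

theorem apply_notMem {m n : ℕ} (g : Fin m ↪o Fin n) {W : Finset (Fin n)} (hW : W ⊆ missing g)
    (i : Fin m) : g i ∈ Wᶜ := by
  rw [Finset.mem_compl]
  intro h
  have := hW h
  simp [missing] at this

/-- If `g = ∂_U` and `W ⊆ U`, then `factor g W` is the map `∂_{ψ_W(U ∖ W)}` through which
`∂_U = ∂_W ∘ ∂_{ψ_W(U ∖ W)}` factors. -/
def factor {m n : ℕ} (g : Fin m ↪o Fin n) (W : Finset (Fin n)) (hW : W ⊆ missing g) :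
    Fin m ↪o Fin Wᶜ.card :=
  OrderEmbedding.ofStrictMono
    (fun i => (Wᶜ.orderIsoOfFin rfl).symm ⟨g i, apply_notMem g hW i⟩)
    (fun i j h => (OrderIso.strictMono _) (show g i < g j from g.strictMono h))

theorem factor_trans {m n : ℕ} (g : Fin m ↪o Fin n) (W : Finset (Fin n)) (hW : W ⊆ missing g) :
    (factor g W hW).trans (faceMap W) = g := by
  ext i
  have h : (Wᶜ.orderIsoOfFin rfl) ((Wᶜ.orderIsoOfFin rfl).symm ⟨g i, apply_notMem g hW i⟩) =
      ⟨g i, apply_notMem g hW i⟩ := OrderIso.apply_symm_apply _ _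
  exact congrArg Fin.val (congrArg Subtype.val h)

theorem factor_factor {m n : ℕ} (g : Fin m ↪o Fin n) (A B : Finset (Fin n))
    (h : A ∪ B ⊆ missing g) :
    (factor g (A ∪ B) h).trans (factor (faceMap (A ∪ B)) A
      (Finset.subset_union_left.trans (missing_missEmb (A ∪ B) rfl).ge)) =
      factor g A (Finset.subset_union_left.trans h) := by
  ext i
  have key : faceMap A ((factor (faceMap (A ∪ B)) A
      (Finset.subset_union_left.trans (missing_missEmb (A ∪ B) rfl).ge))
        (factor g (A ∪ B) h i)) =
      faceMap A (factor g A (Finset.subset_union_left.trans h) i) := by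
    have h1 := DFunLike.congr_fun (factor_trans g A (Finset.subset_union_left.trans h)) i
    have h2 := DFunLike.congr_fun (factor_trans g (A ∪ B) h) i
    have h3 := DFunLike.congr_fun (factor_trans (faceMap (A ∪ B)) A
      (Finset.subset_union_left.trans (missing_missEmb (A ∪ B) rfl).ge)) (factor g (A ∪ B) h i)
    simp only [RelEmbedding.coe_trans, Function.comp_apply] at h1 h2 h3
    rw [h1, h3, h2]
  exact congrArg Fin.val ((faceMap A).injective key)

/-! ### Good pairs and chains -/

namespace SemiSimplicialObject

variable {X : SemiSimplicialObject.{u}}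

/-- The projection `λ_W : ∂_U → ∂_W` for `W ⊆ U`. -/
def lam {m n : ℕ} {g : Fin m ↪o Fin n} (s : (X.face g).carrier) (W : Finset (Fin n))
    (hW : W ⊆ missing g) : (X.face (faceMap W)).carrier :=
  ((X.mu (faceMap W) (factor g W hW) g (factor_trans g W hW)).toFun s).1.1

/-- The projection `λ_{A,B} : ∂_U → ∂_{ψ_A(B)}` to the middle factor of
`∂_U ≅ ∂_{ψ_{A ∪ B}(U ∖ (A ∪ B))} ∘ ∂_{ψ_A(B)} ∘ ∂_A`, for disjoint `A, B ⊆ U`. -/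
def lamPair {m n : ℕ} {g : Fin m ↪o Fin n} (s : (X.face g).carrier) (A B : Finset (Fin n))
    (h : A ∪ B ⊆ missing g) :
    (X.face (factor (faceMap (A ∪ B)) A
      (Finset.subset_union_left.trans (missing_missEmb (A ∪ B) rfl).ge))).carrier :=
  ((X.mu _ (factor g (A ∪ B) h) _ (factor_factor g A B h)).toFun
    ((X.mu (faceMap A) (factor g A (Finset.subset_union_left.trans h)) g
      (factor_trans g A _)).toFun s).1.2).1.1

/-- `(W.1, W.2) = (W^∥, W^∘)` is an `(s,t)`-good pair, for `s ∈ ∂_U`, `t ∈ ∂_V`. -/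
structure IsGood {p q n : ℕ} {g : Fin p ↪o Fin n} {h : Fin q ↪o Fin n}
    (s : (X.face g).carrier) (t : (X.face h).carrier)
    (W : Finset (Fin n) × Finset (Fin n)) : Prop where
  disjoint : Disjoint W.1 W.2
  subset_left : W.1 ∪ W.2 ⊆ missing g
  subset_right : W.1 ∪ W.2 ⊆ missing h
  lam_eq : lam s W.1 (Finset.subset_union_left.trans subset_left) =
    lam t W.1 (Finset.subset_union_left.trans subset_right)
  lamPair_ne : lamPair s W.1 W.2 subset_left ≠ lamPair t W.1 W.2 subset_right

/-- A good pair is positive if `λ_{W^∥,W^∘}(s) < λ_{W^∥,W^∘}(t)` in case `(n - 1) + |U| + |V|` is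
even, and if `λ_{W^∥,W^∘}(s) > λ_{W^∥,W^∘}(t)` in case it is odd. Here `n - 1` is the degree of the
source of `s` and `t`, and the parity of `n - 1` is that of `n + 1`. -/
def IsPositive (o : X.Ordering) {p q n : ℕ} {g : Fin p ↪o Fin n} {h : Fin q ↪o Fin n}
    (s : (X.face g).carrier) (t : (X.face h).carrier)
    (W : Finset (Fin n) × Finset (Fin n)) : Prop :=
  ∃ H : IsGood s t W,
    (Even (n + 1 + (missing g).card + (missing h).card) ∧
      (o.order _).lt (lamPair s W.1 W.2 H.subset_left) (lamPair t W.1 W.2 H.subset_right)) ∨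
    (Odd (n + 1 + (missing g).card + (missing h).card) ∧
      (o.order _).lt (lamPair t W.1 W.2 H.subset_right) (lamPair s W.1 W.2 H.subset_left))

/-- `W ≺ W'`: the second entry of `W'` is obtained from that of `W` by adding an element, which is
removed from the first entry if it is there. -/
def Consecutive {n : ℕ} (W W' : Finset (Fin n) × Finset (Fin n)) : Prop :=
  ∃ x, x ∉ W.2 ∧ W'.2 = insert x W.2 ∧ W'.1 = W.1.erase x

/-- The set `𝒪_{s,t}(U ∩ V)⁺` of positive maximal chains `W₁ ≺ ⋯ ≺ W_r`, `r = |U ∩ V|`, of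
`(s,t)`-good pairs, for `s ∈ ∂_U`, `t ∈ ∂_V`. -/
def positiveChains (o : X.Ordering) {p q n : ℕ} {g : Fin p ↪o Fin n} {h : Fin q ↪o Fin n}
    (s : (X.face g).carrier) (t : (X.face h).carrier) :
    Set (Fin (missing g ∩ missing h).card → Finset (Fin n) × Finset (Fin n)) :=
  {W | (∀ i, IsPositive o s t (W i)) ∧
    ∀ i j : Fin (missing g ∩ missing h).card, (j : ℕ) = (i : ℕ) + 1 → Consecutive (W i) (W j)}

end SemiSimplicialObject

/-! ### Sequences with repetitions -/

/-- A non-decreasing sequence of elements of `{0, …, n - 1}` in which every number appears at most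
twice, given by the multiplicity of each number. -/
abbrev RepSeq (n : ℕ) : Type := Fin n → Fin 3

namespace RepSeq

variable {n : ℕ}

/-- The length of the sequence. -/
def length (U : RepSeq n) : ℕ := ∑ x, (U x : ℕ)

/-- `x + i`, where `x` is the `i`-th number (`i ≥ 1`) of the sequence obtained from `U` by removing
one instance of each repeated number. -/
def index (U : RepSeq n) (x : Fin n) : ℕ :=
  (x : ℕ) + (Finset.univ.filter fun y => U y ≠ 0 ∧ y ≤ x).card

/-- `U⁻`: the numbers with odd index, and the repeated numbers (which have both an odd and an even
index). -/
def minus (U : RepSeq n) : Finset (Fin n) :=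
  Finset.univ.filter fun x => U x = 2 ∨ (U x = 1 ∧ Odd (U.index x))

/-- `U⁺`: the numbers with even index, and the repeated numbers. -/
def plus (U : RepSeq n) : Finset (Fin n) :=
  Finset.univ.filter fun x => U x = 2 ∨ (U x = 1 ∧ Even (U.index x))

end RepSeq

/-! ### Cup-`k` products and Steenrod squares -/

namespace SemiSimplicialObject

variable {X : SemiSimplicialObject.{u}}

/-- The component in degree `r - 1` of the product `α ⌣_k β`, for `α` of degree `p - 1` and `β` of
degree `q - 1`. It is dual to
`∇_k(σ) = ∑_U (∂_{U⁻} ∧ ∂_{U⁺})(σ, σ)`, where `U` ranges over the sequences of length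
`(r - 1) - k`: each `(s, t) ∈ ∂_{U⁻} × ∂_{U⁺}` with source `(σ, σ)` contributes
`|𝒪_{s,t}(U⁻ ∩ U⁺)⁺| ⬝ tgt(s) ⊗ tgt(t)`, on which `α ⊗ β` vanishes unless `tgt(s)` has degree `p - 1`
and `tgt(t)` has degree `q - 1`. (It is zero unless `r - 1 = (p - 1) + (q - 1) - k`.) -/
def cup (o : X.Ordering) (k : ℤ) {p q : ℕ} (α : X.Cochain p) (β : X.Cochain q) (r : ℕ) :
    X.Cochain r := fun σ =>
  ∑ U : {U : RepSeq r // (U.length : ℤ) = ((r : ℤ) - 1) - k ∧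
      U.minusᶜ.card = p ∧ U.plusᶜ.card = q},
    ∑ s ∈ (X.face (missEmb U.1.minus U.2.2.1)).fiber σ,
      ∑ t ∈ (X.face (missEmb U.1.plus U.2.2.2)).fiber σ,
        ((positiveChains o s t).ncard : ZMod 2) *
          (α ((X.face (missEmb U.1.minus U.2.2.1)).tgt s) *
            β ((X.face (missEmb U.1.plus U.2.2.2)).tgt t))

/-- `S` is the operation `𝔰𝔮^i : H^{n-1}(X; 𝔽₂) → H^{n-1+i}(X; 𝔽₂)`, `[α] ↦ [α ⌣_{(n-1)-i} α]`; this
includes that `α ⌣_{(n-1)-i} α` is a cocycle for every cocycle `α`, and that its class depends only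
on the class of `α`. -/
def IsSteenrodSquare (o : X.Ordering) (n i : ℕ) (S : X.Cohomology n → X.Cohomology (n + i)) :
    Prop :=
  ∀ α : X.cocycles n,
    ∃ h : cup o ((n : ℤ) - 1 - i) (α : X.Cochain n) (α : X.Cochain n) (n + i) ∈ X.cocycles (n + i),
      S (X.cls α) = X.cls ⟨_, h⟩

end SemiSimplicialObject

end Burnside

end

/-! Everything rests on one cochain identity over 𝔽₂, `d_cup`: d(α ⌣_k β) = dα ⌣_k β + α ⌣_k dβ + α
⌣_{k-1} β + β ⌣_{k-1} α. It makes α ⌣_k α a cocycle when α is one. Its consequence `d_cup_self`, d(α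
⌣_k α + α ⌣_{k+1} dα) = dα ⌣_{k+1} dα, shows that the class of α ⌣_k α depends only on that of α.

The identity is checked coefficient by coefficient. For s over the face missing A and t over the
face missing B, `weight` is the indicator that (A, B) has the form (U⁻, U⁺), times the number of
positive chains modulo 2. The required identity `sum_weight` splits into two independent facts. (1)
Patterns. If a vertex of A ∩ B is deleted from one of the two sets, exactly one of the two deletions
keeps a valid pattern valid, and neither repairs an invalid one. For vertices in only one of the
sets, the deletions that give a valid pattern add up by telescoping to the patterns of (A, B) and
(B, A) (`sum_ind_alternating_erase`). (2) Chains. Goodness of a pair depends only on the family of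
sets on which s and t have equal projections, and this family is closed under subsets (`isGood_iff`,
`agree_mono`). Between two good pairs that are two steps apart there are exactly two good pairs.
Hence, modulo 2, a good pair has as many positive as negative chains below it (`chainsBelow_eq`),
which gives the recursion `sum_chainCount_erase`.

Naturality comes from the mapping cone of f, with the cone vertex placed last. The coherence squares
of f are exactly what its face spans need to be composed. The cone is ordered so that its products
restrict to those of Y and, for cochains vanishing on Y, to those of X with k lowered by one
(`yPart_cup`, `xPart_cup`). If z extends a cocycle α of Y by zero, then dz is f^*α placed on the
joins with the cone vertex. The restriction of `d_cup_self` for z to these joins says that f^*α ⌣_k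
f^*α and f^*(α ⌣_k α) are cohomologous. The orders on X and Y are arbitrary here, so the identity
map yields independence of the order. -/

noncomputable section

namespace Burnside

/-! ### Counting chains -/

open Classical in
/-- The indicator of a proposition with values in `𝔽₂`. -/
def ind (p : Prop) : ZMod 2 := if p then 1 else 0

theorem ind_true {p : Prop} (h : p) : ind p = 1 := if_pos h

theorem ind_false {p : Prop} (h : ¬ p) : ind p = 0 := if_neg h

theorem ind_congr {p q : Prop} (h : p ↔ q) : ind p = ind q := by rw [propext h]

theorem zmod_two_add_self (a : ZMod 2) : a + a = 0 := CharTwo.add_self_eq_zero a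

section ChainCount

variable {ι κ : Type*} [DecidableEq ι] [DecidableEq κ]

/-- The number of chains of `j` positive pairs ending at `(P, Q)`, where `Q` has `j` elements. -/
def chainCount (E : Finset ι → Prop) (pos : Finset ι → Finset ι → Prop) :
    ℕ → Finset ι → Finset ι → ZMod 2
  -- The base value plays the role of a pair below the first one. Of the two predecessors of a
  -- positive `(P, {x})`, the one with first entry `P` contributes one and the one with `insert x P`
  -- contributes zero, so each chain is counted exactly once.
  | 0, P, _ => ind (E P)
  | j + 1, P, Q => ind (pos P Q) * ∑ x ∈ Q, (chainCount E pos j P (Q.erase x) +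
      chainCount E pos j (insert x P) (Q.erase x))

/-- The number of chains of `j` positive pairs ending below `(P, Q)`. -/
def chainsBelow (E : Finset ι → Prop) (pos : Finset ι → Finset ι → Prop) (j : ℕ)
    (P Q : Finset ι) : ZMod 2 :=
  ∑ x ∈ Q, (chainCount E pos j P (Q.erase x) + chainCount E pos j (insert x P) (Q.erase x))

theorem chainCount_succ (E : Finset ι → Prop) (pos : Finset ι → Finset ι → Prop) (j : ℕ)
    (P Q : Finset ι) :
    chainCount E pos (j + 1) P Q = ind (pos P Q) * chainsBelow E pos j P Q := rfl

/-- Transport of counts to a larger vertex set, with a fixed `R` added to the first entries. It is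
used with `R = ∅` for projections and joins, and with `R = missing δ` for faces of faces. -/
theorem chainCount_map (φ : ι ↪ κ) (R : Finset κ) {E : Finset ι → Prop}
    {pos : Finset ι → Finset ι → Prop} {E' : Finset κ → Prop} {pos' : Finset κ → Finset κ → Prop}
    (D : Finset ι) (hE : ∀ P ⊆ D, (E P ↔ E' (P.map φ ∪ R)))
    (hpos : ∀ P Q, P ⊆ D → Q ⊆ D → (pos P Q ↔ pos' (P.map φ ∪ R) (Q.map φ))) (j : ℕ) :
    ∀ P Q, P ⊆ D → Q ⊆ D →
      chainCount E pos j P Q = chainCount E' pos' j (P.map φ ∪ R) (Q.map φ) := by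
  induction j with
  | zero => exact fun P Q hP _ => ind_congr (hE P hP)
  | succ j ih =>
    intro P Q hP hQ
    rw [chainCount, chainCount, ind_congr (hpos P Q hP hQ), Finset.sum_map]
    congr 1
    refine Finset.sum_congr rfl fun x hx => ?_
    rw [ih _ _ hP ((Finset.erase_subset _ _).trans hQ), ih _ _
      (Finset.insert_subset (hQ hx) hP) ((Finset.erase_subset _ _).trans hQ), Finset.map_erase,
      Finset.map_insert, Finset.insert_union]

/-! ### Cancellation of chains modulo two -/

variable {E : Finset ι → Prop} {pos neg : Finset ι → Finset ι → Prop} {D : Finset ι}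

theorem chainCount_eq_zero (hpos : ∀ P Q, pos P Q → E P ∧ ¬ E (P ∪ Q)) (j : ℕ) {P Q : Finset ι}
    (h : ¬ (E P ∧ ¬ E (P ∪ Q))) : chainCount E pos (j + 1) P Q = 0 := by
  rw [chainCount, ind_false fun h' => h (hpos P Q h'), zero_mul]

/-- The diamond property. Taking `x` and `y` out of `Q` in either order leads to four pairs with
second entry `R`, each reached through two intermediate pairs. The indicators record which
intermediate pairs are good. If a lower pair is good, both pairs above it are good, so it is counted
twice. -/
theorem chainCount_square (hE : ∀ P P', P ⊆ P' → E P' → E P)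
    (hpos : ∀ P Q, pos P Q → E P ∧ ¬ E (P ∪ Q)) (j : ℕ) {P Q : Finset ι}
    (hQ : Q.card = j + 2) (hP : E P) (hPQ : ¬ E (P ∪ Q)) {x y : ι} (hx : x ∈ Q) (hy : y ∈ Q)
    (hxy : x ≠ y) :
    (ind (¬ E (P ∪ Q.erase x)) * (chainCount E pos j P ((Q.erase x).erase y) +
        chainCount E pos j (insert y P) ((Q.erase x).erase y)) +
      ind (E (insert x P)) * (chainCount E pos j (insert x P) ((Q.erase x).erase y) +
        chainCount E pos j (insert y (insert x P)) ((Q.erase x).erase y))) +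
    (ind (¬ E (P ∪ Q.erase y)) * (chainCount E pos j P ((Q.erase y).erase x) +
        chainCount E pos j (insert x P) ((Q.erase y).erase x)) +
      ind (E (insert y P)) * (chainCount E pos j (insert y P) ((Q.erase y).erase x) +
        chainCount E pos j (insert x (insert y P)) ((Q.erase y).erase x))) = 0 := by
  have hy' : y ∈ Q.erase x := Finset.mem_erase.2 ⟨hxy.symm, hy⟩
  have hx' : x ∈ Q.erase y := Finset.mem_erase.2 ⟨hxy, hx⟩
  rw [Finset.erase_right_comm (a := y) (b := x), Finset.insert_comm x y P]
  set R := (Q.erase x).erase y with hR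
  have e1 : P ∪ Q.erase x = insert y P ∪ R := by
    rw [hR, Finset.insert_union, ← Finset.union_insert, Finset.insert_erase hy']
  have e2 : P ∪ Q.erase y = insert x P ∪ R := by
    rw [hR, Finset.erase_right_comm, Finset.insert_union, ← Finset.union_insert,
      Finset.insert_erase hx']
  have e3 : P ∪ Q = insert y (insert x P) ∪ R := by
    rw [Finset.insert_union, ← e2, ← Finset.union_insert, Finset.insert_erase hy]
  have s0 : E (P ∪ Q.erase x) → E (P ∪ R) := hE _ _ (by
    rw [e1]; exact Finset.union_subset_union_left (Finset.subset_insert _ _))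
  have s1 : E (P ∪ Q.erase y) → E (P ∪ R) := hE _ _ (by
    rw [e2]; exact Finset.union_subset_union_left (Finset.subset_insert _ _))
  have s2 : E (insert y (insert x P)) → E (insert x P) := hE _ _ (Finset.subset_insert _ _)
  have s3 : E (insert y (insert x P)) → E (insert y P) :=
    hE _ _ (Finset.insert_subset_insert _ (Finset.subset_insert _ _))
  -- For `j = 0` the counts are base values, which need not vanish when the pair is not good. But
  -- then `R` is empty and the truth values of `E` can be enumerated.
  cases j with
  | zero =>
    have hR0 : R = ∅ := by
      rw [← Finset.card_eq_zero, hR, Finset.card_erase_of_mem hy', Finset.card_erase_of_mem hx, hQ]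
    rw [hR0, Finset.union_empty] at e1 e2 e3
    rw [e3] at hPQ
    simp only [chainCount, e1, e2, ind_true hP, ind_false hPQ]
    by_cases h1 : E (insert x P) <;> by_cases h2 : E (insert y P) <;>
      simp [ind, h1, h2] <;> decide
  | succ j =>
    have a0 := chainCount_eq_zero (P := P) (Q := R) hpos j
    have ax := chainCount_eq_zero (P := insert x P) (Q := R) hpos j
    have ay := chainCount_eq_zero (P := insert y P) (Q := R) hpos j
    have axy := chainCount_eq_zero (P := insert y (insert x P)) (Q := R) hpos j
    rw [← e2] at ax
    rw [← e1] at ay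
    generalize chainCount E pos (j + 1) P R = c0 at *
    generalize chainCount E pos (j + 1) (insert x P) R = cx at *
    generalize chainCount E pos (j + 1) (insert y P) R = cy at *
    generalize chainCount E pos (j + 1) (insert y (insert x P)) R = cxy at *
    -- Each of the four lower counts either vanishes or has coefficient `1 + 1`.
    have b0 : (ind (¬ E (P ∪ Q.erase x)) + ind (¬ E (P ∪ Q.erase y))) * c0 = 0 := by
      by_cases h : E P ∧ ¬ E (P ∪ R)
      · rw [ind_true fun h' => h.2 (s0 h'), ind_true fun h' => h.2 (s1 h'), zmod_two_add_self,
          zero_mul]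
      · rw [a0 h, mul_zero]
    have bx : (ind (E (insert x P)) + ind (¬ E (P ∪ Q.erase y))) * cx = 0 := by
      by_cases h : E (insert x P) ∧ ¬ E (P ∪ Q.erase y)
      · rw [ind_true h.1, ind_true h.2, zmod_two_add_self, zero_mul]
      · rw [ax h, mul_zero]
    have b_y : (ind (¬ E (P ∪ Q.erase x)) + ind (E (insert y P))) * cy = 0 := by
      by_cases h : E (insert y P) ∧ ¬ E (P ∪ Q.erase x)
      · rw [ind_true h.1, ind_true h.2, zmod_two_add_self, zero_mul]
      · rw [ay h, mul_zero]
    have bxy : (ind (E (insert x P)) + ind (E (insert y P))) * cxy = 0 := by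
      by_cases h : E (insert y (insert x P))
      · rw [ind_true (s2 h), ind_true (s3 h), zmod_two_add_self, zero_mul]
      · rw [axy fun h' => h h'.1, mul_zero]
    linear_combination b0 + bx + b_y + bxy

theorem sum_erase_eq_zero (Q : Finset ι) (T : ι → ι → ZMod 2)
    (h : ∀ x ∈ Q, ∀ y ∈ Q, x ≠ y → T x y + T y x = 0) :
    ∑ x ∈ Q, ∑ y ∈ Q.erase x, T x y = 0 := by
  rw [Finset.sum_sigma']
  refine Finset.sum_involution (fun p _ => ⟨p.2, p.1⟩) ?_ ?_ ?_ ?_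
  · rintro ⟨x, y⟩ hp
    simp only [Finset.mem_sigma, Finset.mem_erase] at hp
    exact h x hp.1 y hp.2.2 (Ne.symm hp.2.1)
  · rintro ⟨x, y⟩ hp _ he
    simp only [Finset.mem_sigma, Finset.mem_erase] at hp
    exact hp.2.1 (congrArg Sigma.fst he)
  · rintro ⟨x, y⟩ hp
    simp only [Finset.mem_sigma, Finset.mem_erase] at hp ⊢
    exact ⟨hp.2.2, hp.2.1.symm, hp.1⟩
  · intros; rfl

/-- The sum of both sides counts, over good predecessors of either sign, the chains below them. By
induction these may all be taken negative, so the sum runs over two-step descents and cancels by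
`chainCount_square`. -/
theorem chainsBelow_eq (hE : ∀ P P', P ⊆ P' → E P' → E P)
    (hpos : ∀ P Q, pos P Q → E P ∧ ¬ E (P ∪ Q)) (hneg : ∀ P Q, neg P Q → E P ∧ ¬ E (P ∪ Q))
    (h : ∀ P Q, Disjoint P Q → P ∪ Q ⊆ D → E P → ¬ E (P ∪ Q) → (pos P Q ↔ ¬ neg P Q)) (j : ℕ) :
    ∀ P Q, Disjoint P Q → P ∪ Q ⊆ D → Q.card = j + 1 → E P → ¬ E (P ∪ Q) →
      chainsBelow E pos j P Q = chainsBelow E neg j P Q := by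
  induction j with
  | zero => intros; rfl
  | succ j ih =>
    intro P Q hd hD hQ hP hPQ
    -- A good pair has exactly one sign, and by induction both signs have the same number of chains
    -- below it.
    have key : ∀ P' Q', Disjoint P' Q' → P' ∪ Q' ⊆ D → Q'.card = j + 1 →
        chainCount E pos (j + 1) P' Q' + chainCount E neg (j + 1) P' Q' =
          ind (E P' ∧ ¬ E (P' ∪ Q')) * chainsBelow E neg j P' Q' := by
      intro P' Q' hd' hD' hQ'
      by_cases hg : E P' ∧ ¬ E (P' ∪ Q')
      · rw [chainCount_succ, chainCount_succ, ih P' Q' hd' hD' hQ' hg.1 hg.2, ← add_mul]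
        congr 1
        have := h P' Q' hd' hD' hg.1 hg.2
        by_cases hn : neg P' Q' <;> simp [ind, hg, this, hn]
      · rw [chainCount_eq_zero hpos j hg, chainCount_eq_zero hneg j hg, ind_false hg, zero_mul,
          add_zero]
    rw [← sub_eq_zero, CharTwo.sub_eq_add, chainsBelow, chainsBelow, ← Finset.sum_add_distrib]
    rw [← sum_erase_eq_zero Q _ fun x hx y hy hxy =>
      chainCount_square hE hneg j hQ hP hPQ hx hy hxy]
    refine Finset.sum_congr rfl fun x hx => ?_
    have hc : (Q.erase x).card = j + 1 := by rw [Finset.card_erase_of_mem hx, hQ]; rfl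
    have hu : insert x P ∪ Q.erase x = P ∪ Q := by
      rw [Finset.insert_union, ← Finset.union_insert, Finset.insert_erase hx]
    have k1 := key P (Q.erase x) (hd.mono_right (Finset.erase_subset _ _))
      ((Finset.union_subset_union_right (Finset.erase_subset _ _)).trans hD) hc
    have k2 := key (insert x P) (Q.erase x) (Finset.disjoint_insert_left.2
      ⟨Finset.notMem_erase _ _, hd.mono_right (Finset.erase_subset _ _)⟩) (hu.symm ▸ hD) hc
    have g1 : ind (E P ∧ ¬ E (P ∪ Q.erase x)) = ind (¬ E (P ∪ Q.erase x)) :=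
      ind_congr ⟨And.right, fun h => ⟨hP, h⟩⟩
    have g2 : ind (E (insert x P) ∧ ¬ E (insert x P ∪ Q.erase x)) = ind (E (insert x P)) :=
      ind_congr ⟨And.left, fun h => ⟨h, hu.symm ▸ hPQ⟩⟩
    rw [g1] at k1
    rw [g2] at k2
    rw [Finset.sum_add_distrib, ← Finset.mul_sum, ← Finset.mul_sum]
    unfold chainsBelow at k1 k2
    linear_combination k1 + k2

/-- The left side is the number of positive chains below `(∅, D)`. If this pair is good it has
exactly one of the two signs, so exactly one count on the right is the number of chains below it,
and `chainsBelow_eq` makes the choice immaterial. If it is not good, then `E D` holds and both sides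
vanish. -/
theorem sum_chainCount_erase (hE0 : E ∅) (hE : ∀ P P', P ⊆ P' → E P' → E P)
    (hpos : ∀ P Q, pos P Q → E P ∧ ¬ E (P ∪ Q)) (hneg : ∀ P Q, neg P Q → E P ∧ ¬ E (P ∪ Q))
    (h : ∀ P Q, Disjoint P Q → P ∪ Q ⊆ D → E P → ¬ E (P ∪ Q) → (pos P Q ↔ ¬ neg P Q)) :
    ∑ u ∈ D, (chainCount E pos (D.erase u).card ∅ (D.erase u) +
        chainCount E pos (D.erase u).card {u} (D.erase u)) =
      chainCount E pos D.card ∅ D + chainCount E neg D.card ∅ D := by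
  rcases hj : D.card with _ | j
  · rw [Finset.card_eq_zero.1 hj, Finset.sum_empty]
    exact (zmod_two_add_self _).symm
  have hc : ∀ u ∈ D, (D.erase u).card = j := fun u hu => by
    rw [Finset.card_erase_of_mem hu, hj]; rfl
  have hs : ∑ u ∈ D, (chainCount E pos (D.erase u).card ∅ (D.erase u) +
      chainCount E pos (D.erase u).card {u} (D.erase u)) = chainsBelow E pos j ∅ D :=
    Finset.sum_congr rfl fun u hu => by rw [hc u hu]; rfl
  rw [hs]
  by_cases hD : E D
  · rw [chainCount_eq_zero hpos, chainCount_eq_zero hneg, add_zero]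
    · refine Finset.sum_eq_zero fun u hu => ?_
      cases j with
      | zero =>
        have : {u} ⊆ D := Finset.singleton_subset_iff.2 hu
        exact (congrArg₂ (· + ·) (ind_true hE0) (ind_true (hE _ _ this hD))).trans
          (zmod_two_add_self 1)
      | succ j =>
        rw [chainCount_eq_zero hpos, chainCount_eq_zero hpos, add_zero]
        · exact fun h' => h'.2 (hE _ _ (by
            simp [Finset.insert_erase hu]) hD)
        · exact fun h' => h'.2 (hE _ _ (by simpa using Finset.erase_subset u D) hD)
    all_goals
      rw [Finset.empty_union]
      exact fun h' => h'.2 hD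
  · have hD' : ¬ E (∅ ∪ D) := by rwa [Finset.empty_union]
    have he : ∅ ∪ D ⊆ D := by rw [Finset.empty_union]
    rw [chainCount_succ, chainCount_succ,
      ← chainsBelow_eq hE hpos hneg h j ∅ D (Finset.disjoint_empty_left _) he hj hE0 hD', ← add_mul]
    have := h ∅ D (Finset.disjoint_empty_left _) he hE0 hD'
    by_cases hn : neg ∅ D <;> simp [ind, this, hn]

end ChainCount

/-! ### Pairs of sets coming from sequences with repetitions -/

section Alternating

variable {n : ℕ}

/-- The number of elements below `x` that are in neither of two sets. -/
def gapsBelow (A B : Finset (Fin n)) (x : Fin n) : ℕ :=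
  (Finset.univ.filter fun y => y < x ∧ y ∉ A ∧ y ∉ B).card

/-- The local condition at `x` for `(A, B)` to be of the form `(U⁻, U⁺)`. -/
def AlternatingAt (A B : Finset (Fin n)) (x : Fin n) : Prop :=
  (x ∈ A → x ∉ B → Even (gapsBelow A B x)) ∧ (x ∈ B → x ∉ A → ¬ Even (gapsBelow A B x))

/-- `(A, B)` is of the form `(U⁻, U⁺)`. -/
def Alternating (A B : Finset (Fin n)) : Prop := ∀ x, AlternatingAt A B x

theorem gapsBelow_comm (A B : Finset (Fin n)) (x : Fin n) : gapsBelow A B x = gapsBelow B A x := by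
  unfold gapsBelow
  congr 1
  ext y
  simp only [Finset.mem_filter]
  tauto

theorem gapsBelow_erase_of_mem {A B : Finset (Fin n)} {u : Fin n} (hu : u ∈ B) (x : Fin n) :
    gapsBelow (A.erase u) B x = gapsBelow A B x := by
  unfold gapsBelow
  congr 1
  ext y
  simp only [Finset.mem_filter, Finset.mem_erase]
  by_cases h : y = u
  · subst h; simp [hu]
  · simp [h]

theorem gapsBelow_erase_of_le {A B : Finset (Fin n)} {u x : Fin n} (hx : x ≤ u) :
    gapsBelow (A.erase u) B x = gapsBelow A B x := by
  unfold gapsBelow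
  congr 1
  ext y
  simp only [Finset.mem_filter, Finset.mem_erase]
  by_cases h : y = u
  · subst h; simp [hx.not_gt]
  · simp [h]

theorem gapsBelow_erase_of_lt {A B : Finset (Fin n)} {u x : Fin n} (hA : u ∈ A) (hB : u ∉ B)
    (hx : u < x) : gapsBelow (A.erase u) B x = gapsBelow A B x + 1 := by
  unfold gapsBelow
  rw [← Finset.card_insert_of_notMem (a := u) (by simp [hA])]
  congr 1
  ext y
  simp only [Finset.mem_filter, Finset.mem_erase, Finset.mem_insert]
  by_cases h : y = u
  · subst h; simp [hx, hB]
  · simp [h]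

/-- Deleting `u` from one set creates no gap, because `u` stays in the other. The only new condition
is at `u` itself: the parity of the gaps below it must be odd for one deletion and even for the
other. -/
theorem ind_alternating_erase_of_mem {A B : Finset (Fin n)} {u : Fin n} (hA : u ∈ A)
    (hB : u ∈ B) :
    ind (Alternating (A.erase u) B) + ind (Alternating A (B.erase u)) = ind (Alternating A B) := by
  have h1 : Alternating (A.erase u) B ↔ Alternating A B ∧ ¬ Even (gapsBelow A B u) := by
    constructor
    · refine fun h => ⟨fun x => ?_, ?_⟩
      · have := h x
        rw [AlternatingAt, gapsBelow_erase_of_mem hB] at this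
        by_cases hx : x = u
        · subst hx; exact ⟨fun _ h => absurd hB h, fun _ h => absurd hA h⟩
        · simpa [hx, AlternatingAt] using this
      · have := (h u).2 hB (Finset.notMem_erase _ _)
        rwa [gapsBelow_erase_of_mem hB] at this
    · rintro ⟨h, h'⟩ x
      rw [AlternatingAt, gapsBelow_erase_of_mem hB]
      by_cases hx : x = u
      · subst hx; exact ⟨fun h => absurd h (Finset.notMem_erase _ _), fun _ _ => h'⟩
      · simpa [hx, AlternatingAt] using h x
  have e : ∀ x, gapsBelow A (B.erase u) x = gapsBelow A B x := fun x => by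
    rw [gapsBelow_comm, gapsBelow_erase_of_mem hA, gapsBelow_comm]
  have h2 : Alternating A (B.erase u) ↔ Alternating A B ∧ Even (gapsBelow A B u) := by
    constructor
    · refine fun h => ⟨fun x => ?_, ?_⟩
      · have := h x
        rw [AlternatingAt, e] at this
        by_cases hx : x = u
        · subst hx; exact ⟨fun _ h => absurd hB h, fun _ h => absurd hA h⟩
        · simpa [hx, AlternatingAt] using this
      · have := (h u).1 hA (Finset.notMem_erase _ _)
        rwa [e] at this
    · rintro ⟨h, h'⟩ x
      rw [AlternatingAt, e]
      by_cases hx : x = u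
      · subst hx; exact ⟨fun _ _ => h', fun h => absurd h (Finset.notMem_erase _ _)⟩
      · simpa [hx, AlternatingAt] using h x
  rw [ind_congr h1, ind_congr h2]
  by_cases h : Alternating A B <;> by_cases h' : Even (gapsBelow A B u) <;> simp [ind, h, h']

/-- Deleting `u` creates one gap, which flips every parity above `u`. This is the same as exchanging
the roles of `A` and `B` there. -/
theorem alternating_erase_iff {A B : Finset (Fin n)} {u : Fin n} (hA : u ∈ A) (hB : u ∉ B) :
    Alternating (A.erase u) B ↔
      (∀ x, x < u → AlternatingAt A B x) ∧ ∀ x, u < x → AlternatingAt B A x := by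
  have hlt : ∀ x, x < u → (AlternatingAt (A.erase u) B x ↔ AlternatingAt A B x) := fun x hx => by
    rw [AlternatingAt, AlternatingAt, gapsBelow_erase_of_le hx.le]
    simp [hx.ne]
  have hgt : ∀ x, u < x → (AlternatingAt (A.erase u) B x ↔ AlternatingAt B A x) := fun x hx => by
    rw [AlternatingAt, AlternatingAt, gapsBelow_erase_of_lt hA hB hx, gapsBelow_comm B A,
      Nat.even_add_one]
    simp only [Finset.mem_erase, hx.ne', ne_eq, not_false_eq_true, true_and, not_not]
    tauto
  constructor
  · exact fun h => ⟨fun x hx => (hlt x hx).1 (h x), fun x hx => (hgt x hx).1 (h x)⟩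
  · intro h x
    rcases lt_trichotomy x u with hx | hx | hx
    · exact (hlt x hx).2 (h.1 x hx)
    · subst hx
      exact ⟨fun h => absurd h (Finset.notMem_erase _ _), fun h => absurd h hB⟩
    · exact (hgt x hx).2 (h.2 x hx)

theorem alternating_erase_iff' {A B : Finset (Fin n)} {u : Fin n} (hA : u ∉ A) (hB : u ∈ B) :
    Alternating A (B.erase u) ↔
      (∀ x, x < u → AlternatingAt A B x) ∧ ∀ x, u < x → AlternatingAt B A x := by
  have e : ∀ x, gapsBelow A (B.erase u) x = gapsBelow (B.erase u) A x := fun x =>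
    gapsBelow_comm _ _ _
  have hlt : ∀ x, x < u → (AlternatingAt A (B.erase u) x ↔ AlternatingAt A B x) := fun x hx => by
    rw [AlternatingAt, AlternatingAt, e, gapsBelow_erase_of_le hx.le, gapsBelow_comm B A]
    simp [hx.ne]
  have hgt : ∀ x, u < x → (AlternatingAt A (B.erase u) x ↔ AlternatingAt B A x) := fun x hx => by
    rw [AlternatingAt, AlternatingAt, e, gapsBelow_erase_of_lt hB hA hx, Nat.even_add_one]
    simp only [Finset.mem_erase, hx.ne', ne_eq, not_false_eq_true, true_and, not_not]
    tauto
  constructor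
  · exact fun h => ⟨fun x hx => (hlt x hx).1 (h x), fun x hx => (hgt x hx).1 (h x)⟩
  · intro h x
    rcases lt_trichotomy x u with hx | hx | hx
    · exact (hlt x hx).2 (h.1 x hx)
    · subst hx
      exact ⟨fun h => absurd h hA, fun h => absurd h (Finset.notMem_erase _ _)⟩
    · exact (hgt x hx).2 (h.2 x hx)

/-- Telescoping over the place where the pattern switches from `(A, B)` to `(B, A)`. The summand for
`u` is the difference of two adjacent switching positions: if `u` is in exactly one set, exactly one
of the two conditions at `u` holds; otherwise both hold and the difference is zero. -/
theorem sum_ind_alternating_erase (A B : Finset (Fin n)) :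
    ∑ u ∈ A \ B, ind (Alternating (A.erase u) B) + ∑ u ∈ B \ A, ind (Alternating A (B.erase u)) =
      ind (Alternating A B) + ind (Alternating B A) := by
  -- Position `i` of the switch: `(A, B)` is required strictly below `i`, and `(B, A)` from `i` on.
  let T : ℕ → Prop := fun i => ∀ x : Fin n,
    ((x : ℕ) < i → AlternatingAt A B x) ∧ (i ≤ (x : ℕ) → AlternatingAt B A x)
  have hn : T n ↔ Alternating A B :=
    ⟨fun h x => (h x).1 x.2, fun h x => ⟨fun _ => h x, fun h' => absurd x.2 h'.not_gt⟩⟩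
  have h0 : T 0 ↔ Alternating B A :=
    ⟨fun h x => (h x).2 (Nat.zero_le _), fun h x => ⟨fun h' => absurd h' (Nat.not_lt_zero _),
      fun _ => h x⟩⟩
  have hT : ind (Alternating A B) + ind (Alternating B A) =
      ∑ u : Fin n, (ind (T (u + 1)) - ind (T u)) := by
    rw [Fin.sum_univ_eq_sum_range (fun i => ind (T (i + 1)) - ind (T i)) n,
      Finset.sum_range_sub (fun i => ind (T i)), ind_congr hn, ind_congr h0, CharTwo.sub_eq_add]
  have hs : ∀ u : Fin n, T (u + 1) ↔
      ((∀ x, x < u → AlternatingAt A B x) ∧ ∀ x, u < x → AlternatingAt B A x) ∧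
        AlternatingAt A B u := by
    intro u
    constructor
    · refine fun h => ⟨⟨fun x hx => (h x).1 ?_, fun x hx => (h x).2 ?_⟩, (h u).1 (Nat.lt_succ_self _)⟩
      · exact Nat.lt_succ_of_lt hx
      · exact hx
    · rintro ⟨⟨h1, h2⟩, h3⟩ x
      refine ⟨fun hx => ?_, fun hx => h2 x hx⟩
      rcases Nat.lt_succ_iff_lt_or_eq.1 hx with h | h
      · exact h1 x h
      · rw [Fin.ext h]; exact h3
  have hs' : ∀ u : Fin n, T u ↔
      ((∀ x, x < u → AlternatingAt A B x) ∧ ∀ x, u < x → AlternatingAt B A x) ∧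
        AlternatingAt B A u := by
    intro u
    constructor
    · refine fun h => ⟨⟨fun x hx => (h x).1 hx, fun x hx => (h x).2 (le_of_lt hx)⟩,
        (h u).2 le_rfl⟩
    · rintro ⟨⟨h1, h2⟩, h3⟩ x
      refine ⟨fun hx => h1 x hx, fun hx => ?_⟩
      rcases Nat.lt_or_eq_of_le hx with h | h
      · exact h2 x h
      · rw [← Fin.ext h]; exact h3
  have hadd : ∀ {p q r : Prop}, (q ↔ ¬ r) → ind (p ∧ q) + ind (p ∧ r) = ind p := by
    intro p q r h
    by_cases hp : p <;> by_cases hr : r <;> simp [ind, h, hp, hr]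
  rw [hT, ← Finset.univ_inter (A \ B), ← Finset.univ_inter (B \ A), ← Finset.sum_ite_mem,
    ← Finset.sum_ite_mem, ← Finset.sum_add_distrib]
  refine Finset.sum_congr rfl fun u _ => ?_
  rw [CharTwo.sub_eq_add, ind_congr (hs u), ind_congr (hs' u)]
  by_cases hA : u ∈ A <;> by_cases hB : u ∈ B
  · have h1 : AlternatingAt A B u := ⟨fun _ h => absurd hB h, fun _ h => absurd hA h⟩
    have h2 : AlternatingAt B A u := ⟨fun _ h => absurd hA h, fun _ h => absurd hB h⟩
    simp [hA, hB, h1, h2, zmod_two_add_self]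
  · have hx : AlternatingAt A B u ↔ ¬ AlternatingAt B A u := by
      simp [hA, hB, AlternatingAt, gapsBelow_comm B A]
    simp only [Finset.mem_sdiff, hA, hB, not_true_eq_false, not_false_eq_true, and_true, and_false,
      if_true, if_false, add_zero]
    rw [ind_congr (alternating_erase_iff hA hB), hadd hx]
  · have hx : AlternatingAt A B u ↔ ¬ AlternatingAt B A u := by
      simp [hA, hB, AlternatingAt, gapsBelow_comm B A]
    simp only [Finset.mem_sdiff, hA, hB, not_true_eq_false, not_false_eq_true, and_true, and_false,
      if_true, if_false, zero_add]
    rw [ind_congr (alternating_erase_iff' hA hB), hadd hx]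
  · have h1 : AlternatingAt A B u := ⟨fun h => absurd h hA, fun h => absurd h hB⟩
    have h2 : AlternatingAt B A u := ⟨fun h => absurd h hB, fun h => absurd h hA⟩
    simp [hA, hB, h1, h2, zmod_two_add_self]

/-- Vertices in both sets are not gaps, and vertices beyond the image of `φ` lie below no point of
it, so no gap count changes. The first case serves faces that delete a common vertex, the second
serves the cone vertex. -/
theorem alternating_iff_of_orderEmbedding {m : ℕ} (φ : Fin m ↪o Fin n) {A B : Finset (Fin n)}
    {A' B' : Finset (Fin m)} (hA : ∀ x, φ x ∈ A ↔ x ∈ A') (hB : ∀ x, φ x ∈ B ↔ x ∈ B')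
    (h : ∀ y, y ∉ Set.range φ → (y ∈ A ∧ y ∈ B) ∨ ((∀ x, φ x < y) ∧ y ∉ A ∧ y ∉ B)) :
    Alternating A B ↔ Alternating A' B' := by
  have hg : ∀ x, gapsBelow A B (φ x) = gapsBelow A' B' x := by
    intro x
    unfold gapsBelow
    rw [← Finset.card_map φ.toEmbedding]
    congr 1
    ext y
    simp only [Finset.mem_filter, Finset.mem_univ, true_and, Finset.mem_map]
    constructor
    · rintro ⟨h1, h2, h3⟩
      by_cases hy : y ∈ Set.range φ
      · obtain ⟨z, rfl⟩ := hy
        exact ⟨z, ⟨φ.lt_iff_lt.1 h1, (hA z).not.1 h2, (hB z).not.1 h3⟩, rfl⟩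
      · rcases h y hy with h' | h'
        · exact absurd h'.1 h2
        · exact absurd (h'.1 x) h1.not_gt
    · rintro ⟨z, ⟨h1, h2, h3⟩, rfl⟩
      exact ⟨φ.lt_iff_lt.2 h1, (hA z).not.2 h2, (hB z).not.2 h3⟩
  have hat : ∀ x, AlternatingAt A B (φ x) ↔ AlternatingAt A' B' x := fun x => by
    rw [AlternatingAt, AlternatingAt, hg, hA, hB]
  constructor
  · exact fun h' x => (hat x).1 (h' _)
  · intro h' y
    by_cases hy : y ∈ Set.range φ
    · obtain ⟨z, rfl⟩ := hy
      exact (hat z).2 (h' z)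
    · rcases h y hy with h'' | h''
      · exact ⟨fun _ h => absurd h''.2 h, fun _ h => absurd h''.1 h⟩
      · exact ⟨fun h => absurd h h''.2.1, fun h => absurd h h''.2.2⟩

end Alternating

/-! ### Chains of positive pairs -/

namespace SemiSimplicialObject

section Chains

variable {n : ℕ} {E : Finset (Fin n) → Prop} {pos : Finset (Fin n) → Finset (Fin n) → Prop}
  {D : Finset (Fin n)}

/-- A chain of positive pairs of sets. -/
def IsPosChain (pos : Finset (Fin n) → Finset (Fin n) → Prop) {r : ℕ}
    (W : Fin r → Finset (Fin n) × Finset (Fin n)) : Prop :=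
  (∀ i, pos (W i).1 (W i).2) ∧ ∀ i j : Fin r, (j : ℕ) = (i : ℕ) + 1 → Consecutive (W i) (W j)

theorem isPosChain_snoc {r : ℕ} (c : Fin (r + 1) → Finset (Fin n) × Finset (Fin n))
    (V : Finset (Fin n) × Finset (Fin n)) :
    IsPosChain pos (Fin.snoc (α := fun _ => Finset (Fin n) × Finset (Fin n)) c V) ↔
      pos V.1 V.2 ∧ Consecutive (c (Fin.last r)) V ∧ IsPosChain pos c := by
  constructor
  · rintro ⟨h1, h2⟩
    refine ⟨by simpa using h1 (Fin.last _), ?_, fun i => by simpa using h1 i.castSucc,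
      fun i j hij => by simpa using h2 i.castSucc j.castSucc hij⟩
    simpa using h2 (Fin.last r).castSucc (Fin.last _) rfl
  · rintro ⟨h1, h2, h3, h4⟩
    refine ⟨fun i => ?_, fun i j => ?_⟩
    · refine Fin.lastCases ?_ (fun i => ?_) i
      · simpa using h1
      · simpa using h3 i
    · refine Fin.lastCases ?_ (fun i => ?_) i
      · intro h
        exact absurd j.2 (by rw [h]; simp)
      · refine Fin.lastCases ?_ (fun j => ?_) j
        · intro h
          have : i = Fin.last r := Fin.ext (by simp at h; simp [h])
          subst this
          simpa using h2
        · intro h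
          simpa using h4 i j h

/-- The number of chains of `j + 1` positive pairs with prescribed last pair. -/
def chainsTo (pos : Finset (Fin n) → Finset (Fin n) → Prop) (j : ℕ)
    (V : Finset (Fin n) × Finset (Fin n)) : ZMod 2 :=
  ∑ c : Fin (j + 1) → Finset (Fin n) × Finset (Fin n), ind (IsPosChain pos c ∧ c (Fin.last j) = V)

theorem ind_and (p q : Prop) : ind (p ∧ q) = ind p * ind q := by
  by_cases hp : p <;> by_cases hq : q <;> simp [ind, hp, hq]

theorem sum_ind_eq_mul {α : Type*} [Fintype α] (a : α) (f : α → ZMod 2) :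
    ∑ x, ind (a = x) * f x = f a := by
  classical
  rw [Finset.sum_eq_single a]
  · rw [ind_true rfl, one_mul]
  · intro b _ hb
    rw [ind_false hb.symm, zero_mul]
  · exact fun h => absurd (Finset.mem_univ a) h

theorem chainsTo_succ (j : ℕ) (V : Finset (Fin n) × Finset (Fin n)) :
    chainsTo pos (j + 1) V = ind (pos V.1 V.2) * ∑ W, ind (Consecutive W V) * chainsTo pos j W := by
  have h1 : chainsTo pos (j + 1) V = ∑ c : Fin (j + 1) → Finset (Fin n) × Finset (Fin n),
      ind (pos V.1 V.2 ∧ Consecutive (c (Fin.last j)) V ∧ IsPosChain pos c) := by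
    rw [chainsTo, ← (Fin.snocEquiv fun _ => Finset (Fin n) × Finset (Fin n)).sum_comp,
      Fintype.sum_prod_type_right]
    refine Finset.sum_congr rfl fun c _ => ?_
    rw [← sum_ind_eq_mul V (fun V => ind (pos V.1 V.2 ∧ Consecutive (c (Fin.last j)) V ∧
      IsPosChain pos c))]
    refine Finset.sum_congr rfl fun V' _ => ?_
    rw [← ind_and]
    refine ind_congr ?_
    simp only [Fin.snocEquiv_apply, Fin.snoc_last]
    rw [and_comm, eq_comm (a := V')]
    exact and_congr_right fun _ => isPosChain_snoc c V'
  have h2 : ∀ W, chainsTo pos j W = ∑ c : Fin (j + 1) → Finset (Fin n) × Finset (Fin n),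
      ind (IsPosChain pos c) * ind (c (Fin.last j) = W) := fun W =>
    Finset.sum_congr rfl fun c _ => ind_and _ _
  rw [h1]
  simp only [h2, Finset.mul_sum]
  rw [Finset.sum_comm]
  refine Finset.sum_congr rfl fun c _ => ?_
  rw [ind_and, ind_and, ← Finset.mul_sum, mul_comm (ind (Consecutive _ _)),
    ← sum_ind_eq_mul (c (Fin.last j)) (fun W => ind (Consecutive W V)), Finset.mul_sum]
  congr 1
  refine Finset.sum_congr rfl fun W _ => ?_
  ring

/-- Disjointness makes the list of predecessors free of repetitions: `W.2` determines `x`, and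
membership of `x` in `W.1` decides between the two forms. -/
theorem ind_consecutive {P Q : Finset (Fin n)} (h : Disjoint P Q)
    (W : Finset (Fin n) × Finset (Fin n)) :
    ind (Consecutive W (P, Q)) =
      ∑ x ∈ Q, (ind ((P, Q.erase x) = W) + ind ((insert x P, Q.erase x) = W)) := by
  obtain ⟨A, B⟩ := W
  by_cases hc : Consecutive (A, B) (P, Q)
  · obtain ⟨x, hx, hQ, hP⟩ := hc
    simp only at hx hQ hP
    have hxQ : x ∈ Q := by rw [hQ]; exact Finset.mem_insert_self _ _
    have hxP : x ∉ P := by rw [hP]; exact Finset.notMem_erase _ _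
    have hB : Q.erase x = B := by rw [hQ, Finset.erase_insert hx]
    rw [ind_true ⟨x, hx, hQ, hP⟩, Finset.sum_eq_single x]
    · by_cases hA : x ∈ A
      · have e : insert x P = A := by rw [hP, Finset.insert_erase hA]
        rw [ind_false, ind_true (by rw [e, hB]), zero_add]
        intro h'
        exact hxP ((Prod.mk.inj h').1.symm ▸ hA)
      · have e : P = A := by rw [hP, Finset.erase_eq_of_notMem hA]
        rw [ind_true (by rw [e, hB]), ind_false, add_zero]
        intro h'
        exact hA ((Prod.mk.inj h').1 ▸ Finset.mem_insert_self x P)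
    · intro y hy hyx
      have : Q.erase y ≠ B := fun h' =>
        hx (h' ▸ Finset.mem_erase.2 ⟨hyx.symm, hxQ⟩)
      rw [ind_false fun h' => this (congrArg Prod.snd h'),
        ind_false fun h' => this (congrArg Prod.snd h'), add_zero]
    · exact fun h' => absurd hxQ h'
  · rw [ind_false hc, Finset.sum_eq_zero]
    intro x hx
    have hxP : x ∉ P := fun h' => Finset.disjoint_left.1 h h' hx
    rw [ind_false, ind_false, add_zero]
    · intro h'
      simp only [Prod.mk.injEq] at h'
      obtain ⟨rfl, rfl⟩ := h'
      exact hc ⟨x, Finset.notMem_erase _ _, (Finset.insert_erase hx).symm,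
        (Finset.erase_insert hxP).symm⟩
    · intro h'
      simp only [Prod.mk.injEq] at h'
      obtain ⟨rfl, rfl⟩ := h'
      exact hc ⟨x, Finset.notMem_erase _ _, (Finset.insert_erase hx).symm,
        (Finset.erase_eq_of_notMem hxP).symm⟩

theorem chainsTo_eq_chainCount (hd : ∀ P Q, pos P Q → Disjoint P Q)
    (hpos : ∀ P Q, pos P Q → E P ∧ ¬ E (P ∪ Q)) (j : ℕ) :
    ∀ P Q, Q.card = j + 1 → chainsTo pos j (P, Q) = chainCount E pos (j + 1) P Q := by
  induction j with
  | zero =>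
    intro P Q hQ
    obtain ⟨x, rfl⟩ := Finset.card_eq_one.1 hQ
    have h1 : chainsTo pos 0 (P, {x}) = ind (pos P {x}) := by
      rw [chainsTo, ← (Equiv.funUnique (Fin 1) _).symm.sum_comp,
        ← sum_ind_eq_mul (P, {x}) (fun V => ind (pos V.1 V.2))]
      refine Finset.sum_congr rfl fun V _ => ?_
      rw [← ind_and]
      refine ind_congr ⟨fun h => ⟨h.2.symm, h.1.1 0⟩, fun h => ⟨⟨fun _ => h.2, fun i j hij => ?_⟩,
        h.1.symm⟩⟩
      omega
    rw [h1, chainCount]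
    by_cases hp : pos P {x}
    · have := hpos _ _ hp
      rw [Finset.union_singleton] at this
      simp [ind_true hp, chainCount, ind_true this.1, ind_false this.2]
    · rw [ind_false hp, zero_mul]
  | succ j ih =>
    intro P Q hQ
    rw [chainsTo_succ, chainCount_succ, chainsBelow]
    by_cases hp : pos P Q
    · congr 1
      simp only [ind_consecutive (hd _ _ hp), Finset.sum_mul]
      rw [Finset.sum_comm]
      refine Finset.sum_congr rfl fun x hx => ?_
      have hc : (Q.erase x).card = j + 1 := by rw [Finset.card_erase_of_mem hx, hQ]; rfl
      simp only [add_mul]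
      rw [Finset.sum_add_distrib, sum_ind_eq_mul, sum_ind_eq_mul, ih _ _ hc, ih _ _ hc]
    · rw [ind_false hp, zero_mul, zero_mul]

theorem natCast_ncard_setOf {α : Type*} [Fintype α] (p : α → Prop) :
    (({a | p a}.ncard : ℕ) : ZMod 2) = ∑ a, ind (p a) := by
  classical
  rw [Set.ncard_eq_toFinset_card', Finset.card_eq_sum_ones, Nat.cast_sum]
  simp only [Set.toFinset_ofPred, Nat.cast_one, Finset.sum_filter]
  exact Finset.sum_congr rfl fun a _ => by by_cases h : p a <;> simp [ind, h]

/-- Second entries of good pairs are nonempty and gain one element at each step. The last of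
`D.card` pairs therefore has second entry all of `D`, and by disjointness first entry `∅`. So the
recursive count, which fixes the last pair, counts all chains. -/
theorem ncard_isPosChain (hE0 : E ∅)
    (hd : ∀ P Q, pos P Q → Disjoint P Q ∧ P ∪ Q ⊆ D)
    (hpos : ∀ P Q, pos P Q → E P ∧ ¬ E (P ∪ Q)) {r : ℕ} (hr : D.card = r) :
    (({W : Fin r → _ | IsPosChain pos W}.ncard : ℕ) : ZMod 2) = chainCount E pos D.card ∅ D := by
  rw [natCast_ncard_setOf, hr]
  cases r with
  | zero =>
    rw [chainCount, ind_true hE0, Fintype.sum_eq_single default fun x hx =>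
      absurd (Subsingleton.elim _ _) hx]
    exact ind_true ⟨fun i => i.elim0, fun i => i.elim0⟩
  | succ j =>
    have h1 : ∑ c : Fin (j + 1) → Finset (Fin n) × Finset (Fin n), ind (IsPosChain pos c) =
        ∑ V, chainsTo pos j V := by
      simp only [chainsTo]
      rw [Finset.sum_comm]
      refine Finset.sum_congr rfl fun c _ => ?_
      rw [← sum_ind_eq_mul (c (Fin.last j)) (fun _ => ind (IsPosChain pos c))]
      refine Finset.sum_congr rfl fun V _ => ?_
      rw [ind_and, mul_comm]
    rw [h1, ← chainsTo_eq_chainCount (fun P Q h => (hd P Q h).1) hpos j ∅ D hr]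
    refine Fintype.sum_eq_single _ fun V hV => Finset.sum_eq_zero fun c _ => ind_false ?_
    rintro ⟨⟨h2, h3⟩, h4⟩
    have hcard : ∀ i (hi : i < j + 1), i + 1 ≤ (c ⟨i, hi⟩).2.card := by
      intro i
      induction i with
      | zero =>
        intro hi
        rw [Nat.succ_le_iff, Finset.card_pos, Finset.nonempty_iff_ne_empty]
        intro h0
        have := hpos _ _ (h2 ⟨0, hi⟩)
        rw [h0, Finset.union_empty] at this
        exact this.2 this.1
      | succ i ih =>
        intro hi
        obtain ⟨x, hx, hx', -⟩ := h3 ⟨i, by omega⟩ ⟨i + 1, hi⟩ rfl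
        rw [hx', Finset.card_insert_of_notMem hx]
        exact Nat.succ_le_succ (ih _)
    have h5 := hcard j (Nat.lt_succ_self j)
    have h6 := hd _ _ (h2 (Fin.last j))
    rw [h4] at h6
    have h7 : V.2 = D := Finset.eq_of_subset_of_card_le (Finset.subset_union_right.trans h6.2)
      (by rw [hr, ← h4]; exact h5)
    have h8 : V.1 = ∅ := by
      rw [← Finset.disjoint_self_iff_empty]
      refine h6.1.mono_right ?_
      rw [h7]
      exact Finset.subset_union_left.trans h6.2
    exact hV (Prod.ext h8 h7)

end Chains

end SemiSimplicialObject

/-! ### Order-preserving injections and the elements they miss -/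

section Missing

variable {k m n : ℕ}

theorem mem_missing (g : Fin m ↪o Fin n) (x : Fin n) : x ∈ missing g ↔ ∀ i, g i ≠ x := by
  simp [missing]

theorem notMem_missing (g : Fin m ↪o Fin n) (x : Fin n) : x ∉ missing g ↔ ∃ i, g i = x := by
  simp [missing]

theorem card_missing (g : Fin m ↪o Fin n) : (missing g).card + m = n := by
  have h := Finset.card_compl_add_card (Finset.univ.map g.toEmbedding)
  simpa [missing] using h

theorem card_compl_missing (g : Fin m ↪o Fin n) : (missing g)ᶜ.card = m := by
  simp [missing]

/-- This allows an arbitrary factorisation to be identified with the canonical one through `faceMap`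
and `factor` by comparing missed vertices. -/
theorem missing_injective : Function.Injective (missing : (Fin m ↪o Fin n) → Finset (Fin n)) := by
  intro g g' h
  have key : ∀ f : Fin m ↪o Fin n, f = missEmb (missing f) (card_compl_missing f) := fun f =>
    Finset.orderEmbOfFin_unique' _ fun x => by simp [missing]
  rw [key g, key g']
  congr 1

theorem exists_missing_eq (W : Finset (Fin n)) (h : W.card + m = n) :
    ∃ f : Fin m ↪o Fin n, missing f = W := by
  have hc : Wᶜ.card = m := by
    have := Finset.card_compl_add_card W
    rw [Fintype.card_fin] at this
    omega
  exact ⟨missEmb W hc, missing_missEmb W hc⟩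

theorem trans_left_injective (f : Fin m ↪o Fin n) {g g' : Fin k ↪o Fin m}
    (h : g.trans f = g'.trans f) : g = g' := by
  ext i
  exact congrArg Fin.val (f.injective (DFunLike.congr_fun h i))

theorem missing_trans (f : Fin m ↪o Fin n) (g : Fin k ↪o Fin m) :
    missing (g.trans f) = missing f ∪ (missing g).map f.toEmbedding := by
  ext x
  rw [← not_iff_not, Finset.mem_union, not_or, notMem_missing, notMem_missing]
  constructor
  · rintro ⟨i, rfl⟩
    refine ⟨⟨g i, rfl⟩, fun h => ?_⟩
    obtain ⟨y, hy, hy'⟩ := Finset.mem_map.1 h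
    exact (mem_missing g y).1 hy i (f.injective hy').symm
  · rintro ⟨⟨j, rfl⟩, h⟩
    by_contra hne
    refine h (Finset.mem_map_of_mem f.toEmbedding ((mem_missing g j).2 fun i hi => hne ⟨i, ?_⟩))
    rw [← hi]
    rfl

theorem subset_missing_of_trans_eq {f : Fin m ↪o Fin n} {g : Fin k ↪o Fin m} {h : Fin k ↪o Fin n}
    (e : g.trans f = h) : missing f ⊆ missing h := by
  rw [← e, missing_trans]
  exact Finset.subset_union_left

theorem exists_trans_eq (f : Fin m ↪o Fin n) (h : Fin k ↪o Fin n) (hs : missing f ⊆ missing h) :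
    ∃ g : Fin k ↪o Fin m, g.trans f = h := by
  have key : ∀ (W : Finset (Fin n)), missing f = W → ∃ g : Fin k ↪o Fin m, g.trans f = h := by
    intro W hW
    obtain rfl : m = Wᶜ.card := by rw [← hW, card_compl_missing]
    obtain rfl : f = faceMap W := missing_injective (by rw [hW, missing_missEmb])
    exact ⟨factor h W (hW ▸ hs), factor_trans _ _ _⟩
  exact key _ rfl

end Missing

/-! ### Factorisations of elements of the face spans -/

namespace SemiSimplicialObject

section Factorisation

variable {X : SemiSimplicialObject.{u}} {a b k m n : ℕ}

/-- The first component of the decomposition of an element of `∂_h` along `h = f ∘ g`. -/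
def fst (X : SemiSimplicialObject.{u}) (f : Fin m ↪o Fin n) (g : Fin k ↪o Fin m)
    {h : Fin k ↪o Fin n} (e : g.trans f = h) (s : (X.face h).carrier) : (X.face f).carrier :=
  ((X.mu f g h e).toFun s).1.1

/-- The second component of the decomposition of an element of `∂_h` along `h = f ∘ g`. -/
def snd (X : SemiSimplicialObject.{u}) (f : Fin m ↪o Fin n) (g : Fin k ↪o Fin m)
    {h : Fin k ↪o Fin n} (e : g.trans f = h) (s : (X.face h).carrier) : (X.face g).carrier :=
  ((X.mu f g h e).toFun s).1.2

variable (f : Fin m ↪o Fin n) (g : Fin k ↪o Fin m) {h : Fin k ↪o Fin n} (e : g.trans f = h)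

theorem src_fst (s : (X.face h).carrier) :
    (X.face f).src (X.fst f g e s) = (X.face h).src s := (X.mu f g h e).src_eq s

theorem tgt_snd (s : (X.face h).carrier) :
    (X.face g).tgt (X.snd f g e s) = (X.face h).tgt s := (X.mu f g h e).tgt_eq s

theorem tgt_fst (s : (X.face h).carrier) :
    (X.face f).tgt (X.fst f g e s) = (X.face g).src (X.snd f g e s) :=
  ((X.mu f g h e).toFun s).2

theorem eq_of_fst_snd {s t : (X.face h).carrier} (h1 : X.fst f g e s = X.fst f g e t)
    (h2 : X.snd f g e s = X.snd f g e t) : s = t :=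
  (X.mu f g h e).toEquiv.injective (Subtype.ext (Prod.ext h1 h2))

theorem exists_fst_snd (x : (X.face f).carrier) (y : (X.face g).carrier)
    (hxy : (X.face f).tgt x = (X.face g).src y) :
    ∃ s, X.fst f g e s = x ∧ X.snd f g e s = y := by
  obtain ⟨s, hs⟩ := (X.mu f g h e).toEquiv.surjective ⟨(x, y), hxy⟩
  exact ⟨s, congrArg (fun p => p.1.1) hs, congrArg (fun p => p.1.2) hs⟩

variable {m₁ m₂ m₃ : ℕ} (f₁ : Fin m₁ ↪o Fin n) (f₂ : Fin m₂ ↪o Fin m₁) (f₃ : Fin m₃ ↪o Fin m₂)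
  {f₁₂ : Fin m₂ ↪o Fin n} {f₂₃ : Fin m₃ ↪o Fin m₁} {f₁₂₃ : Fin m₃ ↪o Fin n}
  (e₂₃ : f₃.trans f₂ = f₂₃) (e₁ : f₂₃.trans f₁ = f₁₂₃)
  (e₃ : f₃.trans f₁₂ = f₁₂₃) (s : (X.face f₁₂₃).carrier)

theorem fst_fst (e₁₂ : f₂.trans f₁ = f₁₂) : X.fst f₁ f₂ e₁₂ (X.fst f₁₂ f₃ e₃ s) = X.fst f₁ f₂₃ e₁ s :=
  have e₂₃ : f₃.trans f₂ = f₂₃ := trans_left_injective f₁ (by rw [e₁, ← e₃, ← e₁₂]; rfl)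
  (X.mu_assoc f₁ f₂ f₃ f₁₂ f₂₃ f₁₂₃ e₁₂ e₂₃ e₁ e₃ s).1.symm

theorem fst_snd (e₁₂ : f₂.trans f₁ = f₁₂) : X.fst f₂ f₃ e₂₃ (X.snd f₁ f₂₃ e₁ s) = X.snd f₁ f₂ e₁₂ (X.fst f₁₂ f₃ e₃ s) :=
  (X.mu_assoc f₁ f₂ f₃ f₁₂ f₂₃ f₁₂₃ e₁₂ e₂₃ e₁ e₃ s).2.1

theorem snd_snd (e₁₂ : f₂.trans f₁ = f₁₂) : X.snd f₂ f₃ e₂₃ (X.snd f₁ f₂₃ e₁ s) = X.snd f₁₂ f₃ e₃ s :=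
  (X.mu_assoc f₁ f₂ f₃ f₁₂ f₂₃ f₁₂₃ e₁₂ e₂₃ e₁ e₃ s).2.2

end Factorisation

/-! ### Agreement and comparison of projections -/

section Agree

variable {X : SemiSimplicialObject.{u}} {o : X.Ordering} {p q n : ℕ}
  {g : Fin p ↪o Fin n} {h : Fin q ↪o Fin n}

/-- `λ_P(s) = λ_P(t)`. -/
def Agree (s : (X.face g).carrier) (t : (X.face h).carrier) (P : Finset (Fin n)) : Prop :=
  ∃ (H₁ : P ⊆ missing g) (H₂ : P ⊆ missing h), lam s P H₁ = lam t P H₂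

/-- `(P, Q)` is `(s, t)`-good and `λ_{P,Q}(s) < λ_{P,Q}(t)`. -/
def Less (o : X.Ordering) (s : (X.face g).carrier) (t : (X.face h).carrier)
    (P Q : Finset (Fin n)) : Prop :=
  ∃ H : IsGood s t (P, Q),
    (o.order _).lt (lamPair s P Q H.subset_left) (lamPair t P Q H.subset_right)

/-- Agreement can be tested on any factorisation through a face missing `P`, which avoids transport
along equalities of cardinalities. `less_iff` plays the same role for the comparison. -/
theorem agree_iff {s : (X.face g).carrier} {t : (X.face h).carrier} {P : Finset (Fin n)} {a : ℕ}
    {f : Fin a ↪o Fin n} (hf : missing f = P) {g' : Fin p ↪o Fin a} {h' : Fin q ↪o Fin a}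
    (eg : g'.trans f = g) (eh : h'.trans f = h) :
    Agree s t P ↔ X.fst f g' eg s = X.fst f h' eh t := by
  obtain rfl : a = Pᶜ.card := by rw [← hf, card_compl_missing]
  obtain rfl : f = faceMap P := missing_injective (by rw [hf, missing_missEmb])
  have H₁ : P ⊆ missing g := hf ▸ subset_missing_of_trans_eq eg
  have H₂ : P ⊆ missing h := hf ▸ subset_missing_of_trans_eq eh
  obtain rfl : g' = factor g P H₁ := trans_left_injective _ (eg.trans (factor_trans _ _ _).symm)
  obtain rfl : h' = factor h P H₂ := trans_left_injective _ (eh.trans (factor_trans _ _ _).symm)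
  exact ⟨fun ⟨_, _, h⟩ => h, fun h => ⟨H₁, H₂, h⟩⟩

theorem agree_subset {s : (X.face g).carrier} {t : (X.face h).carrier} {P : Finset (Fin n)}
    (hP : Agree s t P) : P ⊆ missing g ∩ missing h :=
  Finset.subset_inter hP.1 hP.2.1

theorem agree_symm {s : (X.face g).carrier} {t : (X.face h).carrier} {P : Finset (Fin n)} :
    Agree s t P ↔ Agree t s P :=
  ⟨fun ⟨a, b, c⟩ => ⟨b, a, c.symm⟩, fun ⟨a, b, c⟩ => ⟨b, a, c.symm⟩⟩

theorem agree_mono {s : (X.face g).carrier} {t : (X.face h).carrier} (P P' : Finset (Fin n))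
    (hPP' : P ⊆ P') (hP' : Agree s t P') : Agree s t P := by
  obtain ⟨g₁, e₁⟩ := exists_trans_eq (faceMap P) (faceMap P')
    (by rwa [missing_missEmb, missing_missEmb])
  have H := agree_subset hP'
  obtain ⟨g', eg⟩ := exists_trans_eq (faceMap P') g
    (by rw [missing_missEmb]; exact H.trans Finset.inter_subset_left)
  obtain ⟨h', eh⟩ := exists_trans_eq (faceMap P') h
    (by rw [missing_missEmb]; exact H.trans Finset.inter_subset_right)
  have eg' : (g'.trans g₁).trans (faceMap P) = g := by rw [← eg, ← e₁]; rfl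
  have eh' : (h'.trans g₁).trans (faceMap P) = h := by rw [← eh, ← e₁]; rfl
  rw [agree_iff (missing_missEmb P' rfl) eg eh] at hP'
  rw [agree_iff (missing_missEmb P rfl) eg' eh', ← fst_fst _ g₁ g' eg' eg _ e₁,
    ← fst_fst _ g₁ h' eh' eh _ e₁, hP']

theorem lamPair_eq {s : (X.face g).carrier} {P Q : Finset (Fin n)} (H : P ∪ Q ⊆ missing g) :
    lamPair s P Q H = X.snd _ _ (factor_trans _ _ _) (lam s (P ∪ Q) H) :=
  fst_snd _ _ _ _ _ _ _ _

theorem src_injective_of_missing_eq_empty {a : ℕ} {f : Fin a ↪o Fin n} (hf : missing f = ∅) :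
    Function.Injective (X.face f).src := by
  obtain rfl : a = n := by simpa [hf] using card_missing f
  obtain rfl : f = idEmb a := missing_injective (by
    rw [hf, eq_comm, Finset.eq_empty_iff_forall_notMem]
    exact fun x => (notMem_missing _ x).2 ⟨x, rfl⟩)
  exact (X.face_id_bijective a).1

theorem agree_empty {s : (X.face g).carrier} {t : (X.face h).carrier}
    (hst : (X.face g).src s = (X.face h).src t) : Agree s t ∅ := by
  refine ⟨Finset.empty_subset _, Finset.empty_subset _, ?_⟩
  refine src_injective_of_missing_eq_empty (missing_missEmb ∅ rfl) ?_
  exact (src_fst _ _ _ s).trans (hst.trans (src_fst _ _ _ t).symm)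

/-- An element of `∂_{P ∪ Q}` is determined by its component in `∂_P` and the middle component. Once
the former agree, the middle components differ exactly when the projections to `∂_{P ∪ Q}` differ.
Goodness thus becomes a statement about the family `Agree s t` alone. -/
theorem isGood_iff {s : (X.face g).carrier} {t : (X.face h).carrier} {P Q : Finset (Fin n)} :
    IsGood s t (P, Q) ↔
      Disjoint P Q ∧ P ∪ Q ⊆ missing g ∩ missing h ∧ Agree s t P ∧ ¬ Agree s t (P ∪ Q) := by
  constructor
  · rintro ⟨h1, h2, h3, h4, h5⟩
    refine ⟨h1, Finset.subset_inter h2 h3, ⟨_, _, h4⟩, fun ⟨_, _, h6⟩ => h5 ?_⟩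
    rw [lamPair_eq, lamPair_eq]
    exact congrArg _ h6
  · rintro ⟨h1, h2, h3, h4⟩
    have h2' : P ∪ Q ⊆ missing g := h2.trans Finset.inter_subset_left
    have h2'' : P ∪ Q ⊆ missing h := h2.trans Finset.inter_subset_right
    refine ⟨h1, h2', h2'', h3.2.2, fun h5 => h4 ⟨h2', h2'', ?_⟩⟩
    rw [lamPair_eq, lamPair_eq] at h5
    refine eq_of_fst_snd _ _ (factor_trans (faceMap (P ∪ Q)) P
      (Finset.subset_union_left.trans (missing_missEmb (P ∪ Q) rfl).ge)) ?_ h5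
    refine (fst_fst _ _ _ (factor_trans g P (Finset.subset_union_left.trans h2')) _ s _).trans ?_
    exact h3.2.2.trans
      (fst_fst _ _ _ (factor_trans h P (Finset.subset_union_left.trans h2'')) _ t _).symm

theorem isGood_symm {s : (X.face g).carrier} {t : (X.face h).carrier} {P Q : Finset (Fin n)} :
    IsGood s t (P, Q) ↔ IsGood t s (P, Q) := by
  rw [isGood_iff, isGood_iff, Finset.inter_comm, agree_symm, agree_symm (P := P ∪ Q)]

theorem less_iff {s : (X.face g).carrier} {t : (X.face h).carrier} {P Q : Finset (Fin n)}
    (hPQ : Disjoint P Q) {a b : ℕ} {f₁ : Fin a ↪o Fin n} {f₂ : Fin b ↪o Fin a}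
    {f₁₂ : Fin b ↪o Fin n} (h₁ : missing f₁ = P) (h₁₂ : missing f₁₂ = P ∪ Q)
    (e₁₂ : f₂.trans f₁ = f₁₂) {g' : Fin p ↪o Fin b} {h' : Fin q ↪o Fin b}
    (eg : g'.trans f₁₂ = g) (eh : h'.trans f₁₂ = h) :
    Less o s t P Q ↔ Agree s t P ∧ (o.order f₂).lt (X.snd f₁ f₂ e₁₂ (X.fst f₁₂ g' eg s))
      (X.snd f₁ f₂ e₁₂ (X.fst f₁₂ h' eh t)) := by
  obtain rfl : a = Pᶜ.card := by rw [← h₁, card_compl_missing]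
  obtain rfl : b = (P ∪ Q)ᶜ.card := by rw [← h₁₂, card_compl_missing]
  obtain rfl : f₁ = faceMap P := missing_injective (by rw [h₁, missing_missEmb])
  obtain rfl : f₁₂ = faceMap (P ∪ Q) := missing_injective (by rw [h₁₂, missing_missEmb])
  have H₁ : P ∪ Q ⊆ missing g := h₁₂ ▸ subset_missing_of_trans_eq eg
  have H₂ : P ∪ Q ⊆ missing h := h₁₂ ▸ subset_missing_of_trans_eq eh
  obtain rfl : g' = factor g (P ∪ Q) H₁ :=
    trans_left_injective _ (eg.trans (factor_trans _ _ _).symm)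
  obtain rfl : h' = factor h (P ∪ Q) H₂ :=
    trans_left_injective _ (eh.trans (factor_trans _ _ _).symm)
  obtain rfl : f₂ = factor (faceMap (P ∪ Q)) P
      (Finset.subset_union_left.trans (missing_missEmb (P ∪ Q) rfl).ge) :=
    trans_left_injective _ (e₁₂.trans (factor_trans _ _ _).symm)
  constructor
  · rintro ⟨H, hlt⟩
    refine ⟨⟨_, _, H.lam_eq⟩, ?_⟩
    simp only [lamPair_eq] at hlt
    exact hlt
  · rintro ⟨hA, hlt⟩
    have hne : lamPair s P Q H₁ ≠ lamPair t P Q H₂ := by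
      intro h'
      rw [lamPair_eq, lamPair_eq] at h'
      exact (@ne_of_lt _ (o.order _).toPartialOrder.toPreorder _ _ hlt) h'
    refine ⟨⟨hPQ, H₁, H₂, hA.2.2, hne⟩, ?_⟩
    simp only [lamPair_eq]
    exact hlt

theorem less_iff_not_less {s : (X.face g).carrier} {t : (X.face h).carrier}
    {P Q : Finset (Fin n)} (H : IsGood s t (P, Q)) : Less o s t P Q ↔ ¬ Less o t s P Q := by
  let _ := o.order (factor (faceMap (P ∪ Q)) P
      (Finset.subset_union_left.trans (missing_missEmb (P ∪ Q) rfl).ge))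
  constructor
  · rintro ⟨_, h1⟩ ⟨_, h2⟩
    exact lt_asymm h1 h2
  · intro h'
    refine ⟨H, lt_of_le_of_ne (not_lt.1 fun h2 => h' ⟨isGood_symm.1 H, h2⟩) H.lamPair_ne⟩

open Classical in
/-- `Less o s t` or `Less o t s`, according to the truth of a condition. -/
def LessIf (c : Prop) (o : X.Ordering) (s : (X.face g).carrier) (t : (X.face h).carrier)
    (P Q : Finset (Fin n)) : Prop :=
  if c then Less o s t P Q else Less o t s P Q

theorem LessIf.isGood {c : Prop} {s : (X.face g).carrier} {t : (X.face h).carrier}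
    {P Q : Finset (Fin n)} (H : LessIf c o s t P Q) : IsGood s t (P, Q) := by
  unfold LessIf at H
  split_ifs at H
  · exact H.1
  · exact isGood_symm.1 H.1

theorem isPositive_iff {s : (X.face g).carrier} {t : (X.face h).carrier} {P Q : Finset (Fin n)} :
    IsPositive o s t (P, Q) ↔
      LessIf (Even (n + 1 + (missing g).card + (missing h).card)) o s t P Q := by
  unfold LessIf IsPositive
  by_cases hc : Even (n + 1 + (missing g).card + (missing h).card)
  · simp only [hc, Nat.not_odd_iff_even.2 hc, true_and, false_and, or_false, if_true]
    rfl
  · simp only [hc, Nat.not_even_iff_odd.1 hc, true_and, false_and, false_or, if_false]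
    exact ⟨fun ⟨H, h'⟩ => ⟨isGood_symm.1 H, h'⟩, fun ⟨H, h'⟩ => ⟨isGood_symm.1 H, h'⟩⟩

/-- The number of chains in `D` ending at `(P, D)` of pairs that are positive according to a given
sign condition. -/
def signedCount (c : Prop) (o : X.Ordering) (s : (X.face g).carrier) (t : (X.face h).carrier)
    (P D : Finset (Fin n)) : ZMod 2 :=
  chainCount (Agree s t) (LessIf c o s t) D.card P D

theorem natCast_ncard_positiveChains {s : (X.face g).carrier} {t : (X.face h).carrier}
    (hst : (X.face g).src s = (X.face h).src t) :
    ((positiveChains o s t).ncard : ZMod 2) =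
      signedCount (Even (n + 1 + (missing g).card + (missing h).card)) o s t ∅
        (missing g ∩ missing h) := by
  rw [signedCount, ← ncard_isPosChain (agree_empty hst)
    (fun P Q H => ⟨(isGood_iff.1 H.isGood).1, (isGood_iff.1 H.isGood).2.1⟩)
    (fun P Q H => (isGood_iff.1 H.isGood).2.2) rfl]
  have hp : LessIf (Even (n + 1 + (missing g).card + (missing h).card)) o s t =
      fun P Q => IsPositive o s t (P, Q) := funext fun P => funext fun Q => propext isPositive_iff.symm
  rw [hp]
  rfl

/-- The chain recursion for actual projections: `E` is `Agree s t`, and the two signs are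
complementary on good pairs because the order is linear. -/
theorem sum_signedCount_erase {c c' : Prop} (hc : c' ↔ ¬ c) {s : (X.face g).carrier}
    {t : (X.face h).carrier} (hst : (X.face g).src s = (X.face h).src t) {D : Finset (Fin n)}
    (hD : D ⊆ missing g ∩ missing h) :
    ∑ u ∈ D, (signedCount c o s t ∅ (D.erase u) + signedCount c o s t {u} (D.erase u)) =
      signedCount c o s t ∅ D + signedCount c' o s t ∅ D := by
  refine sum_chainCount_erase (agree_empty hst) agree_mono
    (fun P Q H => (isGood_iff.1 H.isGood).2.2) (fun P Q H => (isGood_iff.1 H.isGood).2.2) ?_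
  intro P Q h1 h2 h3 h4
  have H : IsGood s t (P, Q) := isGood_iff.2 ⟨h1, h2.trans hD, h3, h4⟩
  unfold LessIf
  by_cases h : c
  · simp only [hc, h, if_true, not_true_eq_false, if_false, less_iff_not_less H]
  · simp only [hc, h, if_true, not_false_eq_true, if_false, less_iff_not_less (isGood_symm.1 H)]

theorem signedCount_swap {c c' : Prop} (hc : c' ↔ ¬ c) {s : (X.face g).carrier}
    {t : (X.face h).carrier} (P D : Finset (Fin n)) :
    signedCount c o s t P D = signedCount c' o t s P D := by
  have h1 : Agree s t = Agree t s := funext fun P => propext agree_symm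
  have h2 : LessIf c o s t = LessIf c' o t s := by
    funext P Q
    unfold LessIf
    by_cases h : c <;> simp [h, hc]
  rw [signedCount, signedCount, h1, h2]

end Agree

/-! ### Invariance of the comparison of projections -/

section Invariance

variable {X : SemiSimplicialObject.{u}} {o : X.Ordering} {p q n : ℕ}
  {g : Fin p ↪o Fin n} {h : Fin q ↪o Fin n}

theorem agree_fst {a : ℕ} {f : Fin a ↪o Fin n} {d : Fin p ↪o Fin a} (e : d.trans f = g)
    (s : (X.face g).carrier) (t : (X.face h).carrier) {P : Finset (Fin n)} (hP : P ⊆ missing f) :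
    Agree (X.fst f d e s) t P ↔ Agree s t P := by
  by_cases hh : P ⊆ missing h
  · have hm := missing_missEmb P rfl
    obtain ⟨f', ef⟩ := exists_trans_eq (faceMap P) f (hm.symm ▸ hP)
    obtain ⟨h', eh⟩ := exists_trans_eq (faceMap P) h (hm.symm ▸ hh)
    have eg : (d.trans f').trans (faceMap P) = g := by rw [← e, ← ef]; rfl
    rw [agree_iff hm ef eh, agree_iff hm eg eh, fst_fst _ _ _ eg]
  · exact ⟨fun H => absurd ((agree_subset H).trans Finset.inter_subset_right) hh,
      fun H => absurd ((agree_subset H).trans Finset.inter_subset_right) hh⟩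

theorem Less.disjoint {s : (X.face g).carrier} {t : (X.face h).carrier} {P Q : Finset (Fin n)}
    (H : Less o s t P Q) : Disjoint P Q := H.1.disjoint

theorem Less.subset_right {s : (X.face g).carrier} {t : (X.face h).carrier}
    {P Q : Finset (Fin n)} (H : Less o s t P Q) : P ∪ Q ⊆ missing h := H.1.subset_right

theorem Less.subset_left {s : (X.face g).carrier} {t : (X.face h).carrier}
    {P Q : Finset (Fin n)} (H : Less o s t P Q) : P ∪ Q ⊆ missing g := H.1.subset_left

theorem exists_factorisation (P Q : Finset (Fin n)) :
    ∃ f₂ : Fin (P ∪ Q)ᶜ.card ↪o Fin Pᶜ.card, f₂.trans (faceMap P) = faceMap (P ∪ Q) :=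
  exists_trans_eq _ _ (by
    rw [missing_missEmb, missing_missEmb]
    exact Finset.subset_union_left)

theorem less_fst_and {a : ℕ} {f : Fin a ↪o Fin n} {d : Fin p ↪o Fin a} (e : d.trans f = g)
    (s : (X.face g).carrier) (t : (X.face h).carrier) {P Q : Finset (Fin n)}
    (hPQ : P ∪ Q ⊆ missing f) :
    (Less o (X.fst f d e s) t P Q ↔ Less o s t P Q) ∧
      (Less o t (X.fst f d e s) P Q ↔ Less o t s P Q) := by
  by_cases hd : Disjoint P Q
  · by_cases hh : P ∪ Q ⊆ missing h
    · have hm := missing_missEmb (P ∪ Q) rfl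
      have hP := missing_missEmb P rfl
      obtain ⟨f₂, e₂⟩ := exists_factorisation P Q
      obtain ⟨f', ef⟩ := exists_trans_eq (faceMap (P ∪ Q)) f (hm.symm ▸ hPQ)
      obtain ⟨h', eh⟩ := exists_trans_eq (faceMap (P ∪ Q)) h (hm.symm ▸ hh)
      have eg : (d.trans f').trans (faceMap (P ∪ Q)) = g := by rw [← e, ← ef]; rfl
      have hA := agree_fst e s t (Finset.subset_union_left.trans hPQ)
      constructor
      · rw [less_iff hd hP hm e₂ ef eh, less_iff hd hP hm e₂ eg eh, fst_fst _ _ _ eg, hA]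
      · rw [less_iff hd hP hm e₂ eh ef, less_iff hd hP hm e₂ eh eg, fst_fst _ _ _ eg, agree_symm,
          hA, agree_symm]
    · exact ⟨⟨fun H => absurd H.subset_right hh, fun H => absurd H.subset_right hh⟩,
        ⟨fun H => absurd H.subset_left hh, fun H => absurd H.subset_left hh⟩⟩
  · exact ⟨⟨fun H => absurd H.disjoint hd, fun H => absurd H.disjoint hd⟩,
      ⟨fun H => absurd H.disjoint hd, fun H => absurd H.disjoint hd⟩⟩

theorem lessIf_congr {c : Prop} {X' : SemiSimplicialObject.{u}} {o' : X'.Ordering} {p' q' n' : ℕ}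
    {g' : Fin p' ↪o Fin n'} {h' : Fin q' ↪o Fin n'} {s : (X.face g).carrier}
    {t : (X.face h).carrier} {s' : (X'.face g').carrier} {t' : (X'.face h').carrier}
    {P Q : Finset (Fin n)} {P' Q' : Finset (Fin n')}
    (H : (Less o s t P Q ↔ Less o' s' t' P' Q') ∧ (Less o t s P Q ↔ Less o' t' s' P' Q')) :
    LessIf c o s t P Q ↔ LessIf c o' s' t' P' Q' := by
  unfold LessIf
  by_cases h : c
  · simpa only [h, if_true] using H.1
  · simpa only [h, if_false] using H.2

/-- By coherence, projections to faces missing only vertices of `missing f` factor through the first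
component, so all comparisons made inside `D` are unchanged. -/
theorem signedCount_fst {c : Prop} {a : ℕ} {f : Fin a ↪o Fin n} {d : Fin p ↪o Fin a}
    (e : d.trans f = g) (s : (X.face g).carrier) (t : (X.face h).carrier) {D : Finset (Fin n)}
    (hD : D ⊆ missing f) :
    signedCount c o (X.fst f d e s) t ∅ D = signedCount c o s t ∅ D := by
  have := chainCount_map (Function.Embedding.refl (Fin n)) ∅ (E := Agree (X.fst f d e s) t)
    (pos := LessIf c o (X.fst f d e s) t) (E' := Agree s t) (pos' := LessIf c o s t) D
    (fun P hP => by
      rw [Finset.map_refl, Finset.union_empty]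
      exact agree_fst e s t (hP.trans hD))
    (fun P Q hP hQ => by
      rw [Finset.map_refl, Finset.map_refl, Finset.union_empty]
      exact lessIf_congr (less_fst_and e s t (Finset.union_subset (hP.trans hD) (hQ.trans hD))))
    D.card ∅ D (Finset.empty_subset _) subset_rfl
  rwa [Finset.map_refl, Finset.map_refl, Finset.union_empty] at this

variable {m : ℕ} {δ : Fin m ↪o Fin n} {g' : Fin p ↪o Fin m} {h' : Fin q ↪o Fin m}

theorem missing_trans_faceMap (P : Finset (Fin m)) :
    missing ((faceMap P).trans δ) = P.map δ.toEmbedding ∪ missing δ := by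
  rw [missing_trans, missing_missEmb, Finset.union_comm]

theorem subset_missing_iff (eg : g'.trans δ = g) (P : Finset (Fin m)) :
    P.map δ.toEmbedding ∪ missing δ ⊆ missing g ↔ P ⊆ missing g' := by
  rw [← missing_trans_faceMap]
  constructor
  · intro H
    obtain ⟨k, ek⟩ := exists_trans_eq _ _ H
    have : k.trans (faceMap P) = g' := trans_left_injective δ (by rw [eg, ← ek]; rfl)
    rw [← this, missing_trans, missing_missEmb]
    exact Finset.subset_union_left
  · intro H
    obtain ⟨k, ek⟩ := exists_trans_eq (faceMap P) g' (by rwa [missing_missEmb])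
    exact subset_missing_of_trans_eq (g := k) (by rw [← eg, ← ek]; rfl)

/-- Since `s` and `t` share their component over `δ`, agreement of second components on `P` is
agreement of `s` and `t` after adding `missing δ` to the set. -/
theorem agree_snd (eg : g'.trans δ = g) (eh : h'.trans δ = h) {s : (X.face g).carrier}
    {t : (X.face h).carrier} (hst : X.fst δ g' eg s = X.fst δ h' eh t) (P : Finset (Fin m)) :
    Agree (X.snd δ g' eg s) (X.snd δ h' eh t) P ↔
      Agree s t (P.map δ.toEmbedding ∪ missing δ) := by
  by_cases hP : P ⊆ missing g' ∧ P ⊆ missing h'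
  · have hm := missing_missEmb P rfl
    obtain ⟨k, ek⟩ := exists_trans_eq (faceMap P) g' (hm.symm ▸ hP.1)
    obtain ⟨l, el⟩ := exists_trans_eq (faceMap P) h' (hm.symm ▸ hP.2)
    have ek' : k.trans ((faceMap P).trans δ) = g := by rw [← eg, ← ek]; rfl
    have el' : l.trans ((faceMap P).trans δ) = h := by rw [← eh, ← el]; rfl
    rw [agree_iff hm ek el, agree_iff (missing_trans_faceMap P) ek' el',
      fst_snd δ (faceMap P) k ek eg ek' s rfl, fst_snd δ (faceMap P) l el eh el' t rfl]
    refine ⟨fun H => eq_of_fst_snd δ (faceMap P) rfl ?_ H, fun H => by rw [H]⟩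
    rw [fst_fst _ _ _ eg, fst_fst _ _ _ eh, hst]
  · constructor
    · intro H
      exact absurd (Finset.subset_inter_iff.1 (agree_subset H)) hP
    · intro H
      have := Finset.subset_inter_iff.1 (agree_subset H)
      rw [subset_missing_iff eg, subset_missing_iff eh] at this
      exact absurd this hP

theorem less_snd (eg : g'.trans δ = g) (eh : h'.trans δ = h) {s : (X.face g).carrier}
    {t : (X.face h).carrier} (hst : X.fst δ g' eg s = X.fst δ h' eh t) (P Q : Finset (Fin m)) :
    Less o (X.snd δ g' eg s) (X.snd δ h' eh t) P Q ↔
      Less o s t (P.map δ.toEmbedding ∪ missing δ) (Q.map δ.toEmbedding) := by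
  have hu : P.map δ.toEmbedding ∪ missing δ ∪ Q.map δ.toEmbedding =
      (P ∪ Q).map δ.toEmbedding ∪ missing δ := by
    rw [Finset.map_union, Finset.union_right_comm]
  have hdis : Disjoint (P.map δ.toEmbedding ∪ missing δ) (Q.map δ.toEmbedding) ↔
      Disjoint P Q := by
    rw [Finset.disjoint_union_left, Finset.disjoint_map, and_iff_left]
    rw [Finset.disjoint_left]
    intro x hx hx'
    obtain ⟨y, -, rfl⟩ := Finset.mem_map.1 hx'
    exact (mem_missing δ _).1 hx y rfl
  by_cases hd : Disjoint P Q
  · by_cases hP : P ∪ Q ⊆ missing g' ∧ P ∪ Q ⊆ missing h'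
    · have hm := missing_missEmb (P ∪ Q) rfl
      obtain ⟨f₂, e₂⟩ := exists_factorisation P Q
      obtain ⟨k, ek⟩ := exists_trans_eq (faceMap (P ∪ Q)) g' (hm.symm ▸ hP.1)
      obtain ⟨l, el⟩ := exists_trans_eq (faceMap (P ∪ Q)) h' (hm.symm ▸ hP.2)
      have ek' : k.trans ((faceMap (P ∪ Q)).trans δ) = g := by rw [← eg, ← ek]; rfl
      have el' : l.trans ((faceMap (P ∪ Q)).trans δ) = h := by rw [← eh, ← el]; rfl
      have e₂' : f₂.trans ((faceMap P).trans δ) = (faceMap (P ∪ Q)).trans δ := by rw [← e₂]; rfl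
      rw [less_iff hd (missing_missEmb P rfl) hm e₂ ek el,
        less_iff (hdis.2 hd) (missing_trans_faceMap P) (hu ▸ missing_trans_faceMap (P ∪ Q)) e₂'
          ek' el', agree_snd eg eh hst, fst_snd δ _ k ek eg ek' s rfl,
        fst_snd δ _ l el eh el' t rfl, snd_snd _ _ _ e₂ rfl e₂' _ rfl,
        snd_snd _ _ _ e₂ rfl e₂' _ rfl]
    · constructor
      · intro H
        exact absurd ⟨H.subset_left, H.subset_right⟩ hP
      · intro H
        have h1 := H.subset_left
        have h2 := H.subset_right
        rw [hu, subset_missing_iff eg] at h1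
        rw [hu, subset_missing_iff eh] at h2
        exact absurd ⟨h1, h2⟩ hP
  · exact ⟨fun H => absurd H.disjoint hd, fun H => absurd (hdis.1 H.disjoint) hd⟩

/-- Chains for the second components are chains for `s` and `t` with `missing δ` added to every
first entry. This produces the terms with first entry `{u}` in the recursion. -/
theorem signedCount_snd {c : Prop} (eg : g'.trans δ = g) (eh : h'.trans δ = h)
    {s : (X.face g).carrier} {t : (X.face h).carrier}
    (hst : X.fst δ g' eg s = X.fst δ h' eh t) (P D : Finset (Fin m)) :
    signedCount c o (X.snd δ g' eg s) (X.snd δ h' eh t) P D =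
      signedCount c o s t (P.map δ.toEmbedding ∪ missing δ) (D.map δ.toEmbedding) := by
  rw [signedCount, signedCount, Finset.card_map]
  exact chainCount_map δ.toEmbedding (missing δ) Finset.univ
    (fun P _ => agree_snd eg eh hst P)
    (fun P Q _ _ => lessIf_congr ⟨less_snd eg eh hst P Q, less_snd eh eg hst.symm P Q⟩)
    D.card P D (Finset.subset_univ _) (Finset.subset_univ _)

end Invariance

/-! ### The weight of a pair of faces -/

section Weight

variable {X : SemiSimplicialObject.{u}} {o : X.Ordering} {p q n : ℕ}

/-- The coefficient of `tgt s ⊗ tgt t` in the diagonals `∇_k`. -/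
def weight (o : X.Ordering) {g : Fin p ↪o Fin n} {h : Fin q ↪o Fin n} (s : (X.face g).carrier)
    (t : (X.face h).carrier) : ZMod 2 :=
  ind (Alternating (missing g) (missing h)) *
    signedCount (Even (n + 1 + (missing g).card + (missing h).card)) o s t ∅
      (missing g ∩ missing h)

/-! ### Coefficients of the coboundary formula -/

/-- A factorisation with a last step of codimension one is determined by the vertex `u` deleted in
that step, so the sum may be indexed by `u`. -/
theorem sum_factorisations (g : Fin p ↪o Fin n)
    (F : ∀ (f : Fin (p + 1) ↪o Fin n) (d : Fin p ↪o Fin (p + 1)), d.trans f = g → ZMod 2)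
    (G : Fin n → ZMod 2)
    (hFG : ∀ u ∈ missing g, ∀ f d e, missing f = (missing g).erase u → F f d e = G u) :
    ∑ x : {x : (Fin (p + 1) ↪o Fin n) × (Fin p ↪o Fin (p + 1)) // x.2.trans x.1 = g},
      F x.1.1 x.1.2 x.2 = ∑ u ∈ missing g, G u := by
  have key : ∀ u : {u // u ∈ missing g},
      ∃ x : {x : (Fin (p + 1) ↪o Fin n) × (Fin p ↪o Fin (p + 1)) // x.2.trans x.1 = g},
        missing x.1.1 = (missing g).erase u.1 := by
    intro u
    have hc := card_missing g
    have hpos := Finset.card_pos.2 ⟨u.1, u.2⟩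
    obtain ⟨f, hf⟩ := exists_missing_eq (m := p + 1) ((missing g).erase u.1)
      (by rw [Finset.card_erase_of_mem u.2]; omega)
    obtain ⟨d, hd⟩ := exists_trans_eq f g (hf ▸ Finset.erase_subset _ _)
    exact ⟨⟨(f, d), hd⟩, hf⟩
  choose e he using key
  rw [← Finset.sum_coe_sort (missing g)]
  symm
  refine Fintype.sum_bijective e ⟨fun u v huv => ?_, fun x => ?_⟩ _ _ fun u => ?_
  · have := (he u).symm.trans ((congrArg (fun x => missing x.1.1) huv).trans (he v))
    exact Subtype.ext (Finset.erase_injOn _ u.2 v.2 this)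
  · have hs := subset_missing_of_trans_eq x.2
    have h1 := card_missing g
    have h2 := card_missing x.1.1
    have hc : (missing g \ missing x.1.1).card = 1 := by
      rw [Finset.card_sdiff_of_subset hs]; omega
    obtain ⟨u, hu⟩ := Finset.card_eq_one.1 hc
    have hu' : u ∈ missing g \ missing x.1.1 := hu ▸ Finset.mem_singleton_self u
    refine ⟨⟨u, (Finset.mem_sdiff.1 hu').1⟩, ?_⟩
    have hm : missing (e ⟨u, (Finset.mem_sdiff.1 hu').1⟩).1.1 = missing x.1.1 := by
      rw [he, Finset.erase_eq, ← hu, Finset.sdiff_sdiff_eq_self hs]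
    have hm' := missing_injective hm
    refine Subtype.ext (Prod.ext hm' (trans_left_injective x.1.1 ?_))
    have h5 := (e ⟨u, (Finset.mem_sdiff.1 hu').1⟩).2
    rw [hm'] at h5
    exact h5.trans x.2.symm
  · exact (hFG u.1 u.2 _ _ _ (he u)).symm

/-- Here the first step has codimension one and is common to `g` and `h`, so it deletes a vertex
missed by both. -/
theorem sum_common_factorisations {r : ℕ} (g : Fin p ↪o Fin (r + 1)) (h : Fin q ↪o Fin (r + 1))
    (F : ∀ (f : Fin r ↪o Fin (r + 1)) (d : Fin p ↪o Fin r) (d' : Fin q ↪o Fin r),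
      d.trans f = g → d'.trans f = h → ZMod 2)
    (G : Fin (r + 1) → ZMod 2)
    (hFG : ∀ u ∈ missing g ∩ missing h, ∀ f d d' e e', missing f = {u} → F f d d' e e' = G u) :
    ∑ x : {x : (Fin r ↪o Fin (r + 1)) × (Fin p ↪o Fin r) × (Fin q ↪o Fin r) //
      (x.2.1.trans x.1, x.2.2.trans x.1) = (g, h)},
      F x.1.1 x.1.2.1 x.1.2.2 (Prod.mk.inj x.2).1 (Prod.mk.inj x.2).2 =
        ∑ u ∈ missing g ∩ missing h, G u := by
  have key : ∀ u : {u // u ∈ missing g ∩ missing h},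
      ∃ x : {x : (Fin r ↪o Fin (r + 1)) × (Fin p ↪o Fin r) × (Fin q ↪o Fin r) //
      (x.2.1.trans x.1, x.2.2.trans x.1) = (g, h)},
        missing x.1.1 = {u.1} := by
    intro u
    obtain ⟨f, hf⟩ := exists_missing_eq (m := r) (n := r + 1) {u.1}
      (by rw [Finset.card_singleton, add_comm])
    have hu := Finset.mem_inter.1 u.2
    obtain ⟨d, hd⟩ := exists_trans_eq f g (hf ▸ Finset.singleton_subset_iff.2 hu.1)
    obtain ⟨d', hd'⟩ := exists_trans_eq f h (hf ▸ Finset.singleton_subset_iff.2 hu.2)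
    exact ⟨⟨(f, d, d'), Prod.ext hd hd'⟩, hf⟩
  choose e he using key
  rw [← Finset.sum_coe_sort (missing g ∩ missing h)]
  symm
  refine Fintype.sum_bijective e ⟨fun u v huv => ?_, fun x => ?_⟩ _ _ fun u => ?_
  · have := (he u).symm.trans ((congrArg (fun x => missing x.1.1) huv).trans (he v))
    exact Subtype.ext (Finset.singleton_injective this)
  · have hx := Prod.mk.inj x.2
    have hs := Finset.subset_inter (subset_missing_of_trans_eq hx.1)
      (subset_missing_of_trans_eq hx.2)
    have h2 := card_missing x.1.1
    obtain ⟨u, hu⟩ := Finset.card_eq_one.1 (show (missing x.1.1).card = 1 by omega)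
    have hu' : u ∈ missing g ∩ missing h := hs (hu ▸ Finset.mem_singleton_self u)
    refine ⟨⟨u, hu'⟩, ?_⟩
    have hm : missing (e ⟨u, hu'⟩).1.1 = missing x.1.1 := by rw [he, hu]
    have hm' := missing_injective hm
    have hy := Prod.mk.inj (e ⟨u, hu'⟩).2
    refine Subtype.ext (Prod.ext hm' (Prod.ext (trans_left_injective x.1.1 ?_)
      (trans_left_injective x.1.1 ?_)))
    · rw [hx.1, ← hm', hy.1]
    · rw [hx.2, ← hm', hy.2]
  · exact (hFG u.1 u.2 _ _ _ _ _ (he u)).symm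

variable {g : Fin p ↪o Fin n} {h : Fin q ↪o Fin n}

/-- One vertex fewer is deleted, so the parity that defines positivity changes. -/
theorem weight_fst {s : (X.face g).carrier} {t : (X.face h).carrier} {u : Fin n}
    (hu : u ∈ missing g) {a : ℕ} {f : Fin a ↪o Fin n} {d : Fin p ↪o Fin a} (e : d.trans f = g)
    (hf : missing f = (missing g).erase u) :
    weight o (X.fst f d e s) t = ind (Alternating ((missing g).erase u) (missing h)) *
      signedCount (¬ Even (n + 1 + (missing g).card + (missing h).card)) o s t ∅
        ((missing g).erase u ∩ missing h) := by
  have hpos := Finset.card_pos.2 ⟨u, hu⟩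
  have hc : Even (n + 1 + (missing f).card + (missing h).card) ↔
      ¬ Even (n + 1 + (missing g).card + (missing h).card) := by
    rw [hf, Finset.card_erase_of_mem hu, Nat.even_iff, Nat.even_iff]
    omega
  rw [weight, propext hc, signedCount_fst e s t Finset.inter_subset_left, hf]

theorem weight_fst' {s : (X.face g).carrier} {t : (X.face h).carrier} {u : Fin n}
    (hu : u ∈ missing h) {a : ℕ} {f : Fin a ↪o Fin n} {d : Fin q ↪o Fin a} (e : d.trans f = h)
    (hf : missing f = (missing h).erase u) :
    weight o s (X.fst f d e t) = ind (Alternating (missing g) ((missing h).erase u)) *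
      signedCount (¬ Even (n + 1 + (missing g).card + (missing h).card)) o s t ∅
        (missing g ∩ (missing h).erase u) := by
  have hpos := Finset.card_pos.2 ⟨u, hu⟩
  have hc : Even (n + 1 + (missing g).card + (missing f).card) ↔
      ¬ Even (n + 1 + (missing g).card + (missing h).card) := by
    rw [hf, Finset.card_erase_of_mem hu, Nat.even_iff, Nat.even_iff]
    omega
  rw [weight, propext hc, signedCount_swap Iff.rfl, signedCount_fst e t s Finset.inter_subset_right,
    signedCount_swap not_not.symm, hf]

/-- The dimension and both numbers of deleted vertices drop by one. Three changes of parity again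
reverse the sign condition. -/
theorem weight_snd {r : ℕ} {g : Fin p ↪o Fin (r + 1)} {h : Fin q ↪o Fin (r + 1)}
    {s : (X.face g).carrier} {t : (X.face h).carrier} {u : Fin (r + 1)}
    {δ : Fin r ↪o Fin (r + 1)} {g' : Fin p ↪o Fin r} {h' : Fin q ↪o Fin r}
    (eg : g'.trans δ = g) (eh : h'.trans δ = h) (hδ : missing δ = {u})
    (hst : X.fst δ g' eg s = X.fst δ h' eh t) :
    weight o (X.snd δ g' eg s) (X.snd δ h' eh t) = ind (Alternating (missing g) (missing h)) *
      signedCount (¬ Even (r + 1 + 1 + (missing g).card + (missing h).card)) o s t {u}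
        ((missing g ∩ missing h).erase u) := by
  have h1 := card_missing g
  have h2 := card_missing h
  have h3 := card_missing g'
  have h4 := card_missing h'
  have hc : Even (r + 1 + (missing g').card + (missing h').card) ↔
      ¬ Even (r + 1 + 1 + (missing g).card + (missing h).card) := by
    rw [Nat.even_iff, Nat.even_iff]
    omega
  have hmg : ∀ x, δ x ∈ missing g ↔ x ∈ missing g' := fun x => by
    rw [← not_iff_not, notMem_missing, notMem_missing, ← eg]
    exact ⟨fun ⟨i, hi⟩ => ⟨i, δ.injective hi⟩, fun ⟨i, hi⟩ => ⟨i, congrArg δ hi⟩⟩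
  have hmh : ∀ x, δ x ∈ missing h ↔ x ∈ missing h' := fun x => by
    rw [← not_iff_not, notMem_missing, notMem_missing, ← eh]
    exact ⟨fun ⟨i, hi⟩ => ⟨i, δ.injective hi⟩, fun ⟨i, hi⟩ => ⟨i, congrArg δ hi⟩⟩
  have hug : u ∈ missing g := subset_missing_of_trans_eq eg (hδ ▸ Finset.mem_singleton_self u)
  have huh : u ∈ missing h := subset_missing_of_trans_eq eh (hδ ▸ Finset.mem_singleton_self u)
  have hrange : ∀ y, y ∉ Set.range δ ↔ y = u := fun y => by
    rw [← Finset.mem_singleton, ← hδ, mem_missing, Set.mem_range, not_exists]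
  have hA : Alternating (missing g) (missing h) ↔ Alternating (missing g') (missing h') :=
    alternating_iff_of_orderEmbedding δ hmg hmh fun y hy =>
      Or.inl ((hrange y).1 hy ▸ ⟨hug, huh⟩)
  have hD : (missing g' ∩ missing h').map δ.toEmbedding = (missing g ∩ missing h).erase u := by
    ext y
    simp only [Finset.mem_map, Finset.mem_inter, Finset.mem_erase]
    constructor
    · rintro ⟨x, hx, rfl⟩
      refine ⟨fun hxu => ?_, (hmg x).2 hx.1, (hmh x).2 hx.2⟩
      exact (hrange _).2 hxu ⟨x, rfl⟩
    · rintro ⟨h1, h2, h3⟩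
      obtain ⟨x, rfl⟩ := not_not.1 ((hrange y).not.2 h1)
      exact ⟨x, ⟨(hmg x).1 h2, (hmh x).1 h3⟩, rfl⟩
  rw [weight, propext hc, signedCount_snd eg eh hst, hD, hδ, ind_congr hA, Finset.map_empty,
    Finset.empty_union]

/-- The coefficient identity behind `d_cup`. The left side comes from d(α ⌣_k β), the two sums on
the right from dα and dβ, and the last two terms from the products with index k - 1. All terms are
expressed through counts with the reversed sign `c`, except `weight o s t`, which has the original
one. -/
theorem sum_weight {r : ℕ} {g : Fin p ↪o Fin (r + 1)} {h : Fin q ↪o Fin (r + 1)}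
    (s : (X.face g).carrier) (t : (X.face h).carrier)
    (hst : (X.face g).src s = (X.face h).src t) :
    (∑ x : {x : (Fin r ↪o Fin (r + 1)) × (Fin p ↪o Fin r) × (Fin q ↪o Fin r) //
      (x.2.1.trans x.1, x.2.2.trans x.1) = (g, h)},
      ind (X.fst x.1.1 x.1.2.2 (Prod.mk.inj x.2).2 t = X.fst x.1.1 x.1.2.1 (Prod.mk.inj x.2).1 s) *
        weight o (X.snd x.1.1 x.1.2.1 (Prod.mk.inj x.2).1 s)
          (X.snd x.1.1 x.1.2.2 (Prod.mk.inj x.2).2 t)) =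
    ∑ x : {x : (Fin (p + 1) ↪o Fin (r + 1)) × (Fin p ↪o Fin (p + 1)) // x.2.trans x.1 = g},
      weight o (X.fst x.1.1 x.1.2 x.2 s) t +
    ∑ x : {x : (Fin (q + 1) ↪o Fin (r + 1)) × (Fin q ↪o Fin (q + 1)) // x.2.trans x.1 = h},
      weight o s (X.fst x.1.1 x.1.2 x.2 t) + weight o s t + weight o t s := by
  set A := missing g with hA
  set B := missing h with hB
  set c : Prop := ¬ Even (r + 1 + 1 + A.card + B.card) with hc
  rw [sum_common_factorisations g h
      (fun f d d' e e' => ind (X.fst f d' e' t = X.fst f d e s) *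
        weight o (X.snd f d e s) (X.snd f d' e' t))
      (fun u => ind (Alternating A B) * signedCount c o s t {u} ((A ∩ B).erase u)),
    sum_factorisations g (fun f d e => weight o (X.fst f d e s) t)
      (fun u => ind (Alternating (A.erase u) B) * signedCount c o s t ∅ (A.erase u ∩ B))
      (fun u hu f d e hf => weight_fst hu e hf),
    sum_factorisations h (fun f d e => weight o s (X.fst f d e t))
      (fun u => ind (Alternating A (B.erase u)) * signedCount c o s t ∅ (A ∩ B.erase u))
      (fun u hu f d e hf => weight_fst' hu e hf)]
  · have hts : weight o t s = ind (Alternating B A) * signedCount c o s t ∅ (A ∩ B) := by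
      rw [weight, signedCount_swap (c' := c), Finset.inter_comm]
      rw [hc, add_right_comm]
    have hst' : weight o s t =
      ind (Alternating A B) * signedCount (¬ c) o s t ∅ (A ∩ B) := by
      rw [weight, hc, not_not]
    -- `hstar` is the chain recursion on `A ∩ B` and `hpat` the telescoping identity for `A \ B` and
    -- `B \ A`. For a vertex outside `A ∩ B` the deletion leaves the intersection, and hence the
    -- chain count, unchanged.
    have hstar := sum_signedCount_erase (o := o) (c := c) (c' := ¬ c) Iff.rfl hst
      (D := A ∩ B) subset_rfl
    have hpat := sum_ind_alternating_erase A B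
    have hsA : ∑ u ∈ A, ind (Alternating (A.erase u) B) * signedCount c o s t ∅ (A.erase u ∩ B) =
        ∑ u ∈ A ∩ B, ind (Alternating (A.erase u) B) * signedCount c o s t ∅ ((A ∩ B).erase u) +
        (∑ u ∈ A \ B, ind (Alternating (A.erase u) B)) * signedCount c o s t ∅ (A ∩ B) := by
      rw [← Finset.sum_inter_add_sum_sdiff A B, Finset.sum_mul]
      congr 1
      · refine Finset.sum_congr rfl fun u hu => ?_
        rw [Finset.erase_inter]
      · refine Finset.sum_congr rfl fun u hu => ?_
        rw [Finset.erase_inter, Finset.erase_eq_of_notMem (s := A ∩ B)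
          fun h' => (Finset.mem_sdiff.1 hu).2 (Finset.mem_inter.1 h').2]
    have hsB : ∑ u ∈ B, ind (Alternating A (B.erase u)) * signedCount c o s t ∅ (A ∩ B.erase u) =
        ∑ u ∈ A ∩ B, ind (Alternating A (B.erase u)) * signedCount c o s t ∅ ((A ∩ B).erase u) +
        (∑ u ∈ B \ A, ind (Alternating A (B.erase u))) * signedCount c o s t ∅ (A ∩ B) := by
      rw [← Finset.sum_inter_add_sum_sdiff B A, Finset.sum_mul, Finset.inter_comm B A]
      congr 1
      · refine Finset.sum_congr rfl fun u hu => ?_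
        rw [Finset.inter_erase]
      · refine Finset.sum_congr rfl fun u hu => ?_
        rw [Finset.inter_erase, Finset.erase_eq_of_notMem (s := A ∩ B)
          fun h' => (Finset.mem_sdiff.1 hu).2 (Finset.mem_inter.1 h').1]
    have hD : ∑ u ∈ A ∩ B, ind (Alternating (A.erase u) B) *
          signedCount c o s t ∅ ((A ∩ B).erase u) +
        ∑ u ∈ A ∩ B, ind (Alternating A (B.erase u)) *
          signedCount c o s t ∅ ((A ∩ B).erase u) =
        ind (Alternating A B) * ∑ u ∈ A ∩ B, signedCount c o s t ∅ ((A ∩ B).erase u) := by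
      rw [← Finset.sum_add_distrib, Finset.mul_sum]
      refine Finset.sum_congr rfl fun u hu => ?_
      have hu' := Finset.mem_inter.1 hu
      rw [← add_mul, ind_alternating_erase_of_mem hu'.1 hu'.2]
    rw [Finset.sum_add_distrib] at hstar
    rw [hsA, hsB, hts, hst', ← Finset.mul_sum]
    have h2 : (2 : ZMod 2) = 0 := rfl
    linear_combination ind (Alternating A B) * hstar - hD -
      signedCount c o s t ∅ (A ∩ B) * hpat -
      (ind (Alternating A B) * ∑ u ∈ A ∩ B, signedCount c o s t ∅ ((A ∩ B).erase u)) * h2 -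
      (ind (Alternating B A) * signedCount c o s t ∅ (A ∩ B)) * h2
  -- Equality of the first components is agreement on `{u}`. When it fails, the count starting from
  -- `{u}` is zero as well, so the indicator can be dropped.
  · intro u hu f d d' e e' hf
    by_cases hfst : X.fst f d e s = X.fst f d' e' t
    · rw [ind_true hfst.symm, one_mul, weight_snd e e' hf hfst]
    · rw [ind_false fun h' => hfst h'.symm, zero_mul]
      have hnA : ¬ Agree s t {u} := fun h' => hfst ((agree_iff hf e e').1 h')
      have : signedCount c o s t {u} ((A ∩ B).erase u) = 0 := by
        rw [signedCount]
        cases ((A ∩ B).erase u).card with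
        | zero => exact ind_false hnA
        | succ j =>
          exact chainCount_eq_zero (fun P Q H => (isGood_iff.1 H.isGood).2.2) j fun h' => hnA h'.1
      rw [this, mul_zero]

end Weight

end SemiSimplicialObject

/-! ### Sequences with repetitions and alternating pairs -/

namespace RepSeq

variable {n : ℕ}

/-- The numbers up to `x` are either entries of `U` or gaps below `x`, so the index is odd exactly
when the number of gaps is even. This turns the definition of U⁻ and U⁺ into `Alternating`. -/
theorem index_add_gapsBelow {U : RepSeq n} {x : Fin n} (hx : U x ≠ 0) {A B : Finset (Fin n)}
    (hAB : ∀ y, (y ∉ A ∧ y ∉ B) ↔ U y = 0) : U.index x + gapsBelow A B x = 2 * x + 1 := by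
  have h : (Finset.univ.filter fun y => U y ≠ 0 ∧ y ≤ x).card + gapsBelow A B x = x + 1 := by
    rw [gapsBelow, ← Finset.card_union_of_disjoint, ← Fin.card_Iic]
    · congr 1
      ext y
      simp only [Finset.mem_union, Finset.mem_filter, Finset.mem_univ, true_and, Finset.mem_Iic,
        hAB]
      constructor
      · rintro (h | h)
        · exact h.2
        · exact h.1.le
      · intro h
        by_cases hy : U y = 0
        · exact Or.inr ⟨lt_of_le_of_ne h fun h' => hx (h' ▸ hy), hy⟩
        · exact Or.inl ⟨hy, h⟩
    · rw [Finset.disjoint_left]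
      intro y hy hy'
      simp only [Finset.mem_filter, hAB] at hy hy'
      exact hy.2.1 hy'.2.2
  unfold index
  omega

theorem fin_three_cases (a : Fin 3) : a = 0 ∨ a = 1 ∨ a = 2 := by
  fin_cases a <;> simp

theorem mem_minus {U : RepSeq n} {x : Fin n} :
    x ∈ U.minus ↔ U x = 2 ∨ (U x = 1 ∧ Odd (U.index x)) := by
  simp [minus]

theorem mem_plus {U : RepSeq n} {x : Fin n} :
    x ∈ U.plus ↔ U x = 2 ∨ (U x = 1 ∧ Even (U.index x)) := by
  simp [plus]

theorem notMem_minus_and_notMem_plus (U : RepSeq n) (y : Fin n) :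
    (y ∉ U.minus ∧ y ∉ U.plus) ↔ U y = 0 := by
  rw [mem_minus, mem_plus]
  rcases fin_three_cases (U y) with h | h | h
  · simp [h]
  · rw [h, ← Nat.not_even_iff_odd]
    by_cases h' : Even (U.index y) <;> simp [h']
  · simp [h]

theorem apply_eq (U : RepSeq n) (x : Fin n) :
    ((U x : Fin 3) : ℕ) = (if x ∈ U.minus then 1 else 0) + if x ∈ U.plus then 1 else 0 := by
  simp only [mem_minus, mem_plus, ← Nat.not_even_iff_odd]
  rcases fin_three_cases (U x) with h | h | h
  · simp [h]
  · by_cases h' : Even (U.index x) <;> simp [h, h']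
  · simp [h]

theorem length_eq (U : RepSeq n) : U.length = U.minus.card + U.plus.card := by
  simp only [length, apply_eq, Finset.sum_add_distrib, Finset.sum_boole]
  simp

theorem ext_of_minus_plus {U V : RepSeq n} (h₁ : U.minus = V.minus) (h₂ : U.plus = V.plus) :
    U = V := by
  funext x
  refine Fin.ext ?_
  rw [apply_eq, apply_eq, h₁, h₂]

theorem alternating_minus_plus (U : RepSeq n) : Alternating U.minus U.plus := by
  intro x
  have hU := notMem_minus_and_notMem_plus U
  constructor
  · intro h1 h2
    have hx : U x ≠ 0 := fun h => ((hU x).2 h).1 h1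
    have := index_add_gapsBelow hx hU
    rw [mem_minus] at h1
    rw [mem_plus, not_or] at h2
    have ho := (h1.resolve_left h2.1).2
    rw [Nat.odd_iff] at ho
    rw [Nat.even_iff]
    omega
  · intro h1 h2
    have hx : U x ≠ 0 := fun h => ((hU x).2 h).2 h1
    have := index_add_gapsBelow hx hU
    rw [mem_plus] at h1
    rw [mem_minus, not_or] at h2
    have ho := (h1.resolve_left h2.1).2
    rw [Nat.even_iff] at ho ⊢
    omega

theorem exists_minus_plus {A B : Finset (Fin n)} (h : Alternating A B) :
    ∃ U : RepSeq n, U.minus = A ∧ U.plus = B := by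
  let U : RepSeq n := fun x => if x ∈ A then (if x ∈ B then 2 else 1) else if x ∈ B then 1 else 0
  have hU : ∀ y, (y ∉ A ∧ y ∉ B) ↔ U y = 0 := fun y => by
    by_cases h1 : y ∈ A <;> by_cases h2 : y ∈ B <;> simp [U, h1, h2]
  have hi : ∀ x, U x ≠ 0 → U.index x + gapsBelow A B x = 2 * x + 1 := fun x hx =>
    index_add_gapsBelow hx hU
  refine ⟨U, ?_, ?_⟩
  · ext x
    rw [mem_minus]
    by_cases h1 : x ∈ A <;> by_cases h2 : x ∈ B
    · simp [U, h1, h2]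
    · have hx : U x = 1 := by simp [U, h1, h2]
      have h3 := hi x (by simp [hx])
      have h4 := (h x).1 h1 h2
      simp only [hx, h1, iff_true, true_and]
      right
      rw [Nat.odd_iff]
      rw [Nat.even_iff] at h4
      omega
    · have hx : U x = 1 := by simp [U, h1, h2]
      have h3 := hi x (by simp [hx])
      have h4 := (h x).2 h2 h1
      simp only [hx, h1, iff_false, true_and, not_or]
      refine ⟨by decide, ?_⟩
      rw [Nat.odd_iff]
      rw [Nat.even_iff] at h4
      omega
    · simp [U, h1, h2]
  · ext x
    rw [mem_plus]
    by_cases h1 : x ∈ A <;> by_cases h2 : x ∈ B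
    · simp [U, h1, h2]
    · have hx : U x = 1 := by simp [U, h1, h2]
      have h3 := hi x (by simp [hx])
      have h4 := (h x).1 h1 h2
      simp only [hx, h2, iff_false, true_and, not_or]
      refine ⟨by decide, ?_⟩
      rw [Nat.even_iff] at h4 ⊢
      omega
    · have hx : U x = 1 := by simp [U, h1, h2]
      have h3 := hi x (by simp [hx])
      have h4 := (h x).2 h2 h1
      simp only [hx, h2, iff_true, true_and]
      right
      rw [Nat.even_iff] at h4 ⊢
      omega
    · simp [U, h1, h2]

end RepSeq

namespace SemiSimplicialObject

/-! ### The coboundary of a product -/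

section CupProduct

variable {X : SemiSimplicialObject.{u}} {o : X.Ordering} {p q r : ℕ}

/-- The product as a sum over all pairs of faces, with `weight` vanishing on pairs not of the form
(U⁻, U⁺). Since the length of U is |U⁻| + |U⁺|, the length condition becomes one on degrees alone;
the `- 1` comes from indexing by numbers of vertices. -/
theorem cup_apply (k : ℤ) (α : X.Cochain p) (β : X.Cochain q) (σ : X.obj r) :
    cup o k α β r σ = ind ((r : ℤ) = p + q - 1 - k) *
      ∑ x : (Fin p ↪o Fin r) × (Fin q ↪o Fin r),
        ∑ s ∈ (X.face x.1).fiber σ, ∑ t ∈ (X.face x.2).fiber σ,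
          weight o s t * (α ((X.face x.1).tgt s) * β ((X.face x.2).tgt t)) := by
  have hcard : ∀ U : RepSeq r, ∀ (h₁ : U.minusᶜ.card = p) (h₂ : U.plusᶜ.card = q),
      (U.length : ℤ) = r - 1 - k ↔ (r : ℤ) = p + q - 1 - k := by
    intro U h₁ h₂
    have h3 := Finset.card_compl_add_card U.minus
    have h4 := Finset.card_compl_add_card U.plus
    rw [Fintype.card_fin] at h3 h4
    rw [U.length_eq]
    push_cast
    omega
  by_cases hr : (r : ℤ) = p + q - 1 - k
  · rw [ind_true hr, one_mul]
    unfold cup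
    refine Finset.sum_of_injOn (fun U => (missEmb U.1.minus U.2.2.1, missEmb U.1.plus U.2.2.2))
      ?_ (fun _ _ => Finset.mem_coe.2 (Finset.mem_univ _)) ?_ ?_
    · intro U _ V _ hUV
      have h1 := congrArg (fun x => missing x.1) hUV
      have h2 := congrArg (fun x => missing x.2) hUV
      simp only [missing_missEmb] at h1 h2
      exact Subtype.ext (RepSeq.ext_of_minus_plus h1 h2)
    · rintro ⟨g, h⟩ - hx
      refine Finset.sum_eq_zero fun s _ => Finset.sum_eq_zero fun t _ => ?_
      rw [weight, ind_false, zero_mul, zero_mul]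
      intro hA
      obtain ⟨U, h1, h2⟩ := RepSeq.exists_minus_plus hA
      have h1' : U.minusᶜ.card = p := by rw [h1, card_compl_missing]
      have h2' : U.plusᶜ.card = q := by rw [h2, card_compl_missing]
      refine hx ⟨⟨U, (hcard U h1' h2').2 hr, h1', h2'⟩, Finset.mem_coe.2 (Finset.mem_univ _), ?_⟩
      exact Prod.ext (missing_injective (by rw [missing_missEmb, h1]))
        (missing_injective (by rw [missing_missEmb, h2]))
    · intro U _
      refine Finset.sum_congr rfl fun s hs => Finset.sum_congr rfl fun t ht => ?_
      rw [LFSpan.mem_fiber] at hs ht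
      rw [weight, natCast_ncard_positiveChains (hs.trans ht.symm), ind_true, one_mul]
      rw [missing_missEmb, missing_missEmb]
      exact U.1.alternating_minus_plus
  · rw [ind_false hr, zero_mul]
    refine Finset.sum_eq_zero fun U _ => ?_
    exact absurd ((hcard U.1 U.2.2.1 U.2.2.2).1 U.2.1) hr

/-! ### Reindexing sums over composite faces -/

theorem succAboveOrderEmb_bijective (n : ℕ) :
    Function.Bijective (Fin.succAboveOrderEmb : Fin (n + 1) → (Fin n ↪o Fin (n + 1))) := by
  have hm : ∀ i : Fin (n + 1), missing (Fin.succAboveOrderEmb i) = {i} := by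
    intro i
    ext x
    rw [← not_iff_not, notMem_missing, Finset.mem_singleton]
    exact Fin.exists_succAbove_eq_iff
  constructor
  · intro i j hij
    exact Finset.singleton_injective (by rw [← hm, ← hm, hij])
  · intro f
    have h := card_missing f
    obtain ⟨i, hi⟩ := Finset.card_eq_one.1 (show (missing f).card = 1 by omega)
    exact ⟨i, missing_injective (by rw [hm, hi])⟩

theorem d_apply (n : ℕ) (α : X.Cochain n) (σ : X.obj (n + 1)) :
    X.d n α σ = ∑ f : Fin n ↪o Fin (n + 1), ∑ s ∈ (X.face f).fiber σ, α ((X.face f).tgt s) := by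
  rw [d, LinearMap.sum_apply, Finset.sum_apply]
  exact Fintype.sum_bijective _ (succAboveOrderEmb_bijective n) _ _ fun i => rfl

theorem sum_fiber_comp {a b c : ℕ} {f : Fin b ↪o Fin c} {g : Fin a ↪o Fin b} {h : Fin a ↪o Fin c}
    (e : g.trans f = h) (σ : X.obj c) (F : (X.face f).carrier → (X.face g).carrier → ZMod 2) :
    ∑ s ∈ (X.face f).fiber σ, ∑ t ∈ (X.face g).fiber ((X.face f).tgt s), F s t =
      ∑ s ∈ (X.face h).fiber σ, F (X.fst f g e s) (X.snd f g e s) := by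
  rw [Finset.sum_sigma']
  symm
  refine Finset.sum_bij (fun s _ => ⟨X.fst f g e s, X.snd f g e s⟩) ?_ ?_ ?_ ?_
  · intro s hs
    rw [LFSpan.mem_fiber] at hs
    rw [Finset.mem_sigma, LFSpan.mem_fiber, LFSpan.mem_fiber]
    exact ⟨(src_fst _ _ _ _).trans hs, (tgt_fst _ _ _ _).symm⟩
  · intro s _ t _ hst
    rw [Sigma.mk.injEq] at hst
    exact eq_of_fst_snd f g e hst.1 (eq_of_heq hst.2)
  · rintro ⟨x, y⟩ hxy
    rw [Finset.mem_sigma, LFSpan.mem_fiber, LFSpan.mem_fiber] at hxy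
    obtain ⟨s, h1, h2⟩ := exists_fst_snd f g e x y hxy.2.symm
    refine ⟨s, ?_, by rw [h1, h2]⟩
    rw [LFSpan.mem_fiber, ← hxy.1, ← src_fst f g e, h1]
  · intros; rfl

/-- The summand takes the equation as an argument because the components `fst` and `snd` depend on a
factorisation proof. -/
theorem sum_fiberwise {ι κ : Type*} [Fintype ι] [Fintype κ] [DecidableEq κ] (φ : ι → κ)
    (M : ∀ (y : κ) (x : ι), φ x = y → ZMod 2) :
    ∑ x, M (φ x) x rfl = ∑ y, ∑ x : {x // φ x = y}, M y x.1 x.2 := by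
  rw [← Fintype.sum_fiberwise φ]
  refine Finset.sum_congr rfl fun y _ => Finset.sum_congr rfl fun x _ => ?_
  obtain ⟨x, rfl⟩ := x
  rfl

theorem sum_mul_d (α : X.Cochain p) (σ : X.obj r)
    (K : ∀ f : Fin (p + 1) ↪o Fin r, (X.face f).carrier → ZMod 2) :
    ∑ f : Fin (p + 1) ↪o Fin r, ∑ s ∈ (X.face f).fiber σ,
        K f s * X.d p α ((X.face f).tgt s) =
      ∑ g : Fin p ↪o Fin r, ∑ s ∈ (X.face g).fiber σ,
        (∑ x : {x : (Fin (p + 1) ↪o Fin r) × (Fin p ↪o Fin (p + 1)) // x.2.trans x.1 = g},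
          K x.1.1 (X.fst x.1.1 x.1.2 x.2 s)) * α ((X.face g).tgt s) := by
  have h1 : ∀ f : Fin (p + 1) ↪o Fin r, ∑ s ∈ (X.face f).fiber σ,
      K f s * X.d p α ((X.face f).tgt s) =
      ∑ d : Fin p ↪o Fin (p + 1), ∑ s ∈ (X.face (d.trans f)).fiber σ,
        K f (X.fst f d rfl s) * α ((X.face (d.trans f)).tgt s) := by
    intro f
    simp only [d_apply, Finset.mul_sum]
    rw [Finset.sum_comm]
    refine Finset.sum_congr rfl fun d _ => ?_
    rw [sum_fiber_comp (rfl : d.trans f = d.trans f) σ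
      (fun s t => K f s * α ((X.face d).tgt t))]
    exact Finset.sum_congr rfl fun s _ => by rw [tgt_snd]
  simp only [h1, Finset.sum_mul]
  rw [← Fintype.sum_prod_type' (f := fun (f : Fin (p + 1) ↪o Fin r) (d : Fin p ↪o Fin (p + 1)) =>
    ∑ s ∈ (X.face (d.trans f)).fiber σ,
        K f (X.fst f d rfl s) * α ((X.face (d.trans f)).tgt s))]
  rw [sum_fiberwise (fun x : (Fin (p + 1) ↪o Fin r) × (Fin p ↪o Fin (p + 1)) => x.2.trans x.1)
    (fun g x e => ∑ s ∈ (X.face g).fiber σ, K x.1 (X.fst x.1 x.2 e s) * α ((X.face g).tgt s))]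
  exact Finset.sum_congr rfl fun g _ => Finset.sum_comm

/-- On the left one element `e` over `f` serves both `s` and `t`. After composition this becomes the
condition that the first components coincide. -/
theorem sum_fiber_fiber {c : ℕ} {f : Fin r ↪o Fin c} {g : Fin p ↪o Fin r} {h : Fin q ↪o Fin r}
    {g' : Fin p ↪o Fin c} {h' : Fin q ↪o Fin c} (eg : g.trans f = g') (eh : h.trans f = h')
    (σ : X.obj c) (F : (X.face g).carrier → (X.face h).carrier → ZMod 2) :
    ∑ e ∈ (X.face f).fiber σ, ∑ s ∈ (X.face g).fiber ((X.face f).tgt e),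
        ∑ t ∈ (X.face h).fiber ((X.face f).tgt e), F s t =
      ∑ s ∈ (X.face g').fiber σ, ∑ t ∈ (X.face h').fiber σ,
        ind (X.fst f h eh t = X.fst f g eg s) * F (X.snd f g eg s) (X.snd f h eh t) := by
  rw [sum_fiber_comp eg σ (fun e s => ∑ t ∈ (X.face h).fiber ((X.face f).tgt e), F s t)]
  refine Finset.sum_congr rfl fun s hs => ?_
  rw [LFSpan.mem_fiber] at hs
  rw [← sum_fiber_comp eh σ (fun e t => ind (e = X.fst f g eg s) * F (X.snd f g eg s) t)]
  symm
  rw [Finset.sum_eq_single (X.fst f g eg s)]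
  · exact Finset.sum_congr rfl fun t _ => by rw [ind_true rfl, one_mul]
  · intro e _ he
    exact Finset.sum_eq_zero fun t _ => by rw [ind_false he, zero_mul]
  · intro h1
    rw [LFSpan.mem_fiber, src_fst] at h1
    exact absurd hs h1

theorem sum_pairs {ι κ : Type*} [Fintype ι] [Fintype κ] {γ : ι → Type*} {γ' : κ → Type*}
    (S : ∀ i, Finset (γ i)) (T : ∀ j, Finset (γ' j)) (W : ∀ i j, γ i → γ' j → ZMod 2)
    (a : ∀ i, γ i → ZMod 2) (b : ∀ j, γ' j → ZMod 2) :
    ∑ x : ι × κ, ∑ s ∈ S x.1, ∑ t ∈ T x.2, W x.1 x.2 s t * (a x.1 s * b x.2 t) =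
      ∑ i, ∑ s ∈ S i, (∑ j, ∑ t ∈ T j, W i j s t * b j t) * a i s := by
  rw [Fintype.sum_prod_type]
  refine Finset.sum_congr rfl fun i _ => ?_
  simp only
  rw [Finset.sum_comm]
  refine Finset.sum_congr rfl fun s _ => ?_
  simp only [Finset.sum_mul]
  exact Finset.sum_congr rfl fun j _ => Finset.sum_congr rfl fun t _ => by ring

theorem sum_pairs_swap {ι κ : Type*} [Fintype ι] [Fintype κ] {γ : ι → Type*} {γ' : κ → Type*}
    (S : ∀ i, Finset (γ i)) (T : ∀ j, Finset (γ' j)) (W : ∀ i j, γ i → γ' j → ZMod 2)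
    (a : ∀ i, γ i → ZMod 2) (b : ∀ j, γ' j → ZMod 2) :
    ∑ x : ι × κ, ∑ s ∈ S x.1, ∑ t ∈ T x.2, W x.1 x.2 s t * (a x.1 s * b x.2 t) =
      ∑ j, ∑ t ∈ T j, (∑ i, ∑ s ∈ S i, W i j s t * a i s) * b j t := by
  rw [← sum_pairs T S (fun j i t s => W i j s t) b a, ← (Equiv.prodComm _ _).sum_comp]
  refine Finset.sum_congr rfl fun x _ => ?_
  rw [Finset.sum_comm]
  exact Finset.sum_congr rfl fun t _ => Finset.sum_congr rfl fun s _ => by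
    simp only [Equiv.prodComm_apply, Prod.fst_swap, Prod.snd_swap]; ring

/-- All five terms are brought to sums over the same pairs of faces of σ and the same values of α
and β. Their coefficients are then compared by `sum_weight`. -/
theorem d_cup (k : ℤ) (α : X.Cochain p) (β : X.Cochain q) :
    X.d r (cup o k α β r) = cup o k (X.d p α) β (r + 1) + cup o k α (X.d q β) (r + 1) +
      cup o (k - 1) α β (r + 1) + cup o (k - 1) β α (r + 1) := by
  funext σ
  -- `J C` is the bilinear expression in α and β with coefficient function `C`.
  let J (C : ∀ (g : Fin p ↪o Fin (r + 1)) (h : Fin q ↪o Fin (r + 1)),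
      (X.face g).carrier → (X.face h).carrier → ZMod 2) : ZMod 2 :=
    ∑ x : (Fin p ↪o Fin (r + 1)) × (Fin q ↪o Fin (r + 1)), ∑ s ∈ (X.face x.1).fiber σ,
      ∑ t ∈ (X.face x.2).fiber σ, C x.1 x.2 s t *
        (α ((X.face x.1).tgt s) * β ((X.face x.2).tgt t))
  have h0 : X.d r (cup o k α β r) σ = ind ((r : ℤ) = p + q - 1 - k) * J (fun g h s t =>
      ∑ x : {x : (Fin r ↪o Fin (r + 1)) × (Fin p ↪o Fin r) × (Fin q ↪o Fin r) //
        (x.2.1.trans x.1, x.2.2.trans x.1) = (g, h)},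
      ind (X.fst x.1.1 x.1.2.2 (Prod.mk.inj x.2).2 t = X.fst x.1.1 x.1.2.1 (Prod.mk.inj x.2).1 s) *
        weight o (X.snd x.1.1 x.1.2.1 (Prod.mk.inj x.2).1 s)
          (X.snd x.1.1 x.1.2.2 (Prod.mk.inj x.2).2 t)) := by
    simp only [d_apply, cup_apply, ← Finset.mul_sum]
    congr 1
    have h : ∀ f : Fin r ↪o Fin (r + 1), ∑ e ∈ (X.face f).fiber σ,
        ∑ x : (Fin p ↪o Fin r) × (Fin q ↪o Fin r), ∑ s ∈ (X.face x.1).fiber ((X.face f).tgt e),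
          ∑ t ∈ (X.face x.2).fiber ((X.face f).tgt e),
            weight o s t * (α ((X.face x.1).tgt s) * β ((X.face x.2).tgt t)) =
        ∑ x : (Fin p ↪o Fin r) × (Fin q ↪o Fin r), ∑ s ∈ (X.face (x.1.trans f)).fiber σ,
          ∑ t ∈ (X.face (x.2.trans f)).fiber σ,
            ind (X.fst f x.2 rfl t = X.fst f x.1 rfl s) *
              weight o (X.snd f x.1 rfl s) (X.snd f x.2 rfl t) *
                (α ((X.face (x.1.trans f)).tgt s) * β ((X.face (x.2.trans f)).tgt t)) := by
      intro f
      rw [Finset.sum_comm]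
      refine Finset.sum_congr rfl fun x _ => ?_
      rw [sum_fiber_fiber (f := f) (g := x.1) (h := x.2) rfl rfl σ (fun s t => weight o s t *
        (α ((X.face x.1).tgt s) * β ((X.face x.2).tgt t)))]
      exact Finset.sum_congr rfl fun s _ => Finset.sum_congr rfl fun t _ => by
        rw [tgt_snd, tgt_snd, mul_assoc]
    rw [Finset.sum_congr rfl fun f _ => h f, ← Fintype.sum_prod_type']
    rw [sum_fiberwise (fun y : (Fin r ↪o Fin (r + 1)) × (Fin p ↪o Fin r) × (Fin q ↪o Fin r) =>
        (y.2.1.trans y.1, y.2.2.trans y.1))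
      (fun z y e => ∑ s ∈ (X.face z.1).fiber σ, ∑ t ∈ (X.face z.2).fiber σ,
        ind (X.fst y.1 y.2.2 (Prod.ext_iff.1 e).2 t = X.fst y.1 y.2.1 (Prod.ext_iff.1 e).1 s) *
          weight o (X.snd y.1 y.2.1 (Prod.ext_iff.1 e).1 s)
            (X.snd y.1 y.2.2 (Prod.ext_iff.1 e).2 t) *
              (α ((X.face z.1).tgt s) * β ((X.face z.2).tgt t)))]
    refine Finset.sum_congr rfl fun z _ => ?_
    rw [Finset.sum_comm]
    refine Finset.sum_congr rfl fun s _ => ?_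
    rw [Finset.sum_comm]
    refine Finset.sum_congr rfl fun t _ => ?_
    rw [Finset.sum_mul]
  have h1 : cup o k (X.d p α) β (r + 1) σ = ind ((r : ℤ) = p + q - 1 - k) * J (fun g h s t =>
      ∑ x : {x : (Fin (p + 1) ↪o Fin (r + 1)) × (Fin p ↪o Fin (p + 1)) // x.2.trans x.1 = g},
      weight o (X.fst x.1.1 x.1.2 x.2 s) t) := by
    rw [cup_apply]
    congr 1
    · refine ind_congr ?_
      push_cast
      omega
    · simp only [J]
      rw [sum_pairs (fun f => (X.face f).fiber σ) (fun f => (X.face f).fiber σ)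
        (fun _ _ s t => weight o s t) (fun f s => X.d p α ((X.face f).tgt s))
        (fun f s => β ((X.face f).tgt s)), sum_mul_d,
        sum_pairs (fun f => (X.face f).fiber σ) (fun f => (X.face f).fiber σ)
        (fun g _ s t => ∑ x : {x : (Fin (p + 1) ↪o Fin (r + 1)) × (Fin p ↪o Fin (p + 1)) //
          x.2.trans x.1 = g}, weight o (X.fst x.1.1 x.1.2 x.2 s) t)
        (fun f s => α ((X.face f).tgt s)) (fun f s => β ((X.face f).tgt s))]
      refine Finset.sum_congr rfl fun g _ => Finset.sum_congr rfl fun s _ => ?_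
      congr 1
      rw [Finset.sum_comm]
      refine Finset.sum_congr rfl fun h _ => ?_
      rw [Finset.sum_comm]
      exact Finset.sum_congr rfl fun t _ => (Finset.sum_mul _ _ _).symm
  have h2 : cup o k α (X.d q β) (r + 1) σ = ind ((r : ℤ) = p + q - 1 - k) * J (fun g h s t =>
      ∑ x : {x : (Fin (q + 1) ↪o Fin (r + 1)) × (Fin q ↪o Fin (q + 1)) // x.2.trans x.1 = h},
      weight o s (X.fst x.1.1 x.1.2 x.2 t)) := by
    rw [cup_apply]
    congr 1
    · refine ind_congr ?_
      push_cast
      omega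
    · simp only [J]
      rw [sum_pairs_swap (fun f => (X.face f).fiber σ) (fun f => (X.face f).fiber σ)
        (fun _ _ s t => weight o s t) (fun f s => α ((X.face f).tgt s))
        (fun f s => X.d q β ((X.face f).tgt s)), sum_mul_d,
        sum_pairs_swap (fun f => (X.face f).fiber σ) (fun f => (X.face f).fiber σ)
        (fun _ h s t => ∑ x : {x : (Fin (q + 1) ↪o Fin (r + 1)) × (Fin q ↪o Fin (q + 1)) //
          x.2.trans x.1 = h}, weight o s (X.fst x.1.1 x.1.2 x.2 t))
        (fun f s => α ((X.face f).tgt s)) (fun f s => β ((X.face f).tgt s))]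
      refine Finset.sum_congr rfl fun g _ => Finset.sum_congr rfl fun s _ => ?_
      congr 1
      rw [Finset.sum_comm]
      refine Finset.sum_congr rfl fun h _ => ?_
      rw [Finset.sum_comm]
      exact Finset.sum_congr rfl fun t _ => (Finset.sum_mul _ _ _).symm
  have h3 : cup o (k - 1) α β (r + 1) σ = ind ((r : ℤ) = p + q - 1 - k) * J (fun g h s t =>
      weight o s t) := by
    rw [cup_apply]
    congr 1
    refine ind_congr ?_
    push_cast
    omega
  have h4 : cup o (k - 1) β α (r + 1) σ = ind ((r : ℤ) = p + q - 1 - k) * J (fun g h s t =>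
      weight o t s) := by
    rw [cup_apply]
    congr 1
    · refine ind_congr ?_
      push_cast
      omega
    · simp only [J]
      rw [← (Equiv.prodComm _ _).sum_comp]
      refine Finset.sum_congr rfl fun x _ => ?_
      rw [Finset.sum_comm]
      refine Finset.sum_congr rfl fun s _ => Finset.sum_congr rfl fun t _ => ?_
      simp only [Equiv.prodComm_apply, Prod.fst_swap, Prod.snd_swap]
      ring
  simp only [Pi.add_apply]
  rw [h0, h1, h2, h3, h4, ← mul_add, ← mul_add, ← mul_add]
  congr 1
  simp only [J, ← Finset.sum_add_distrib, ← add_mul]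
  refine Finset.sum_congr rfl fun x _ => Finset.sum_congr rfl fun s hs =>
    Finset.sum_congr rfl fun t ht => ?_
  rw [LFSpan.mem_fiber] at hs ht
  rw [sum_weight s t (hs.trans ht.symm)]

end CupProduct

end SemiSimplicialObject

/-! ### Injections that hit or avoid the last vertex -/

section LastVertex

variable {k m n : ℕ}

/-- The injection `g` hits the last vertex. -/
def Hits (g : Fin m ↪o Fin n) : Prop := ∃ i, (g i : ℕ) + 1 = n

/-- There is a last vertex, which the injection `g` avoids. -/
def Avoids (g : Fin m ↪o Fin n) : Prop := 0 < n ∧ ∀ i, (g i : ℕ) + 1 < n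

theorem Hits.pos {g : Fin m ↪o Fin n} (h : Hits g) : 0 < n := by
  obtain ⟨i, hi⟩ := h
  omega

theorem Hits.pos' {g : Fin m ↪o Fin n} (h : Hits g) : 0 < m := by
  obtain ⟨i, hi⟩ := h
  exact i.pos

theorem Hits.not_avoids {g : Fin m ↪o Fin n} (h : Hits g) : ¬ Avoids g := by
  obtain ⟨i, hi⟩ := h
  exact fun h' => (h'.2 i).ne hi

theorem avoids_of_not_hits {g : Fin m ↪o Fin n} (hn : 0 < n) (h : ¬ Hits g) : Avoids g :=
  ⟨hn, fun i => lt_of_le_of_ne (g i).2 fun h' => h ⟨i, h'⟩⟩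

theorem apply_lt_pred (g : Fin m ↪o Fin n) (i : Fin m) (hi : (i : ℕ) < m - 1) :
    (g i : ℕ) < n - 1 := by
  have h1 : g i < g ⟨m - 1, by omega⟩ := g.strictMono hi
  have h2 := (g ⟨m - 1, by omega⟩).2
  have h3 : (g i : ℕ) < g ⟨m - 1, by omega⟩ := h1
  omega

theorem Hits.of_trans_left {f : Fin m ↪o Fin n} {g : Fin k ↪o Fin m} {h : Fin k ↪o Fin n}
    (e : g.trans f = h) (H : Hits h) : Hits f := by
  subst e
  obtain ⟨i, hi⟩ := H
  exact ⟨g i, hi⟩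

/-- If `g i` were not the last vertex of the middle ordinal, `f` would send the next one beyond the
last vertex. -/
theorem Hits.of_trans_right {f : Fin m ↪o Fin n} {g : Fin k ↪o Fin m} {h : Fin k ↪o Fin n}
    (e : g.trans f = h) (H : Hits h) : Hits g := by
  subst e
  obtain ⟨i, hi⟩ := H
  refine ⟨i, ?_⟩
  by_contra hne
  have h1 : (g i : ℕ) + 1 < m := lt_of_le_of_ne (g i).2 hne
  have h2 : f (g i) < f ⟨(g i : ℕ) + 1, h1⟩ := f.strictMono (Nat.lt_succ_self _)
  have h3 : (f (g i) : ℕ) < f ⟨(g i : ℕ) + 1, h1⟩ := h2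
  have h4 := (f ⟨(g i : ℕ) + 1, h1⟩).2
  have h5 : (f (g i) : ℕ) + 1 = n := hi
  omega

theorem Hits.trans {f : Fin m ↪o Fin n} {g : Fin k ↪o Fin m} {h : Fin k ↪o Fin n}
    (e : g.trans f = h) (hf : Hits f) (hg : Hits g) : Hits h := by
  subst e
  obtain ⟨i, hi⟩ := hg
  obtain ⟨j, hj⟩ := hf
  have hji : j ≤ g i := Fin.le_def.2 (by have := j.2; omega)
  have h1 : (f j : ℕ) ≤ f (g i) := f.monotone hji
  refine ⟨i, ?_⟩
  have h2 : (f (g i) : ℕ) < n := (f (g i)).2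
  show (f (g i) : ℕ) + 1 = n
  omega

theorem Avoids.of_trans {f : Fin m ↪o Fin n} {g : Fin k ↪o Fin m} {h : Fin k ↪o Fin n}
    (e : g.trans f = h) (hf : Hits f) (hh : Avoids h) : Avoids g :=
  avoids_of_not_hits hf.pos' fun hg => (hf.trans e hg).not_avoids hh

theorem Avoids.trans_left {f : Fin m ↪o Fin n} {g : Fin k ↪o Fin m} {h : Fin k ↪o Fin n}
    (e : g.trans f = h) (hf : Avoids f) : Avoids h := by
  subst e
  exact ⟨hf.1, fun i => hf.2 (g i)⟩

theorem Avoids.trans_right {f : Fin m ↪o Fin n} {g : Fin k ↪o Fin m} {h : Fin k ↪o Fin n}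
    (e : g.trans f = h) (hf : Hits f) (hg : Avoids g) : Avoids h :=
  avoids_of_not_hits hf.pos fun hh => (hh.of_trans_right e).not_avoids hg

/-- The restriction of an injection that hits the last vertex to the other vertices. -/
def restr (g : Fin m ↪o Fin n) (_h : Hits g) : Fin (m - 1) ↪o Fin (n - 1) :=
  OrderEmbedding.ofStrictMono
    (fun i => ⟨g ⟨i, by omega⟩, apply_lt_pred g _ i.2⟩)
    (fun i j hij => show g ⟨i, _⟩ < g ⟨j, _⟩ from g.strictMono hij)

/-- The corestriction of an injection that avoids the last vertex to the other vertices. -/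
def corestr (g : Fin m ↪o Fin n) (h : Avoids g) : Fin m ↪o Fin (n - 1) :=
  OrderEmbedding.ofStrictMono
    (fun i => ⟨g i, by have := h.2 i; omega⟩)
    (fun i j hij => show g i < g j from g.strictMono hij)

theorem restr_trans_restr {f : Fin m ↪o Fin n} {g : Fin k ↪o Fin m} {h : Fin k ↪o Fin n}
    (e : g.trans f = h) (hf : Hits f) (hg : Hits g) (hh : Hits h) :
    (restr g hg).trans (restr f hf) = restr h hh := by
  subst e
  rfl

theorem corestr_trans_restr {f : Fin m ↪o Fin n} {g : Fin k ↪o Fin m} {h : Fin k ↪o Fin n}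
    (e : g.trans f = h) (hf : Hits f) (hg : Avoids g) (hh : Avoids h) :
    (corestr g hg).trans (restr f hf) = corestr h hh := by
  subst e
  rfl

theorem trans_corestr {f : Fin m ↪o Fin n} {g : Fin k ↪o Fin m} {h : Fin k ↪o Fin n}
    (e : g.trans f = h) (hf : Avoids f) (hh : Avoids h) :
    g.trans (corestr f hf) = corestr h hh := by
  subst e
  rfl

theorem hits_idEmb (hn : 0 < n) : Hits (idEmb n) :=
  ⟨⟨n - 1, by omega⟩, Nat.sub_add_cancel hn⟩

theorem not_avoids_idEmb : ¬ Avoids (idEmb n) := fun h => (hits_idEmb h.1).not_avoids h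

theorem restr_idEmb (h : Hits (idEmb n)) : restr (idEmb n) h = idEmb (n - 1) := rfl

end LastVertex

namespace SemiSimplicialObject

/-! ### The mapping cone -/

section Cone

variable {X Y : SemiSimplicialObject.{u}} (φ : Map X Y) {k m n : ℕ}

/-- The simplices of the mapping cone: joins of simplices of `X` with the cone vertex, which is
the last one, and simplices of `Y`. -/
inductive ConeObj (X Y : SemiSimplicialObject.{u}) (n : ℕ) : Type u
  | inX (h : 0 < n) (σ : X.obj (n - 1)) : ConeObj X Y n
  | inY (τ : Y.obj n) : ConeObj X Y n

/-- The elements of the face spans of the mapping cone. -/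
inductive ConeFace (g : Fin m ↪o Fin n) : Type u
  | xx (h : Hits g) (s : (X.face (restr g h)).carrier) : ConeFace g
  | xy (h : Avoids g) (s : (X.face (corestr g h)).carrier) (t : (φ.span m).carrier)
      (e : (X.face (corestr g h)).tgt s = (φ.span m).src t) : ConeFace g
  | yy (s : (Y.face g).carrier) : ConeFace g

variable {φ}

/-- The source map of the face spans of the mapping cone. -/
def coneSrc {g : Fin m ↪o Fin n} : ConeFace φ g → ConeObj X Y n
  | .xx h s => .inX h.pos ((X.face (restr g h)).src s)
  | .xy h s _ _ => .inX h.1 ((X.face (corestr g h)).src s)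
  | .yy s => .inY ((Y.face g).src s)

/-- The target map of the face spans of the mapping cone. -/
def coneTgt {g : Fin m ↪o Fin n} : ConeFace φ g → ConeObj X Y m
  | .xx h s => .inX h.pos' ((X.face (restr g h)).tgt s)
  | .xy _ _ t _ => .inY ((φ.span m).tgt t)
  | .yy s => .inY ((Y.face g).tgt s)

variable (φ) in
/-- The face spans of the mapping cone. -/
def coneSpan (g : Fin m ↪o Fin n) : LFSpan (ConeObj X Y n) (ConeObj X Y m) where
  carrier := ConeFace φ g
  src := coneSrc
  tgt := coneTgt
  finite_fiber a := by
    cases a with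
    | inX h σ =>
      have h1 : (⋃ h : Hits g, ConeFace.xx (φ := φ) h ''
          {s | (X.face (restr g h)).src s = σ}).Finite :=
        Set.finite_iUnion fun h => ((X.face (restr g h)).finite_fiber σ).image _
      have h2 : (⋃ h : Avoids g,
          (fun p : ((X.face (corestr g h)).comp (φ.span m)).carrier =>
            ConeFace.xy (φ := φ) h p.1.1 p.1.2 p.2) ''
          {s | ((X.face (corestr g h)).comp (φ.span m)).src s = σ}).Finite :=
        Set.finite_iUnion fun h =>
          (((X.face (corestr g h)).comp (φ.span m)).finite_fiber σ).image _
      refine (h1.union h2).subset ?_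
      rintro (⟨h, s⟩ | ⟨h, s, t, e⟩ | s) hs
      · simp only [coneSrc, Set.mem_ofPred_eq, ConeObj.inX.injEq] at hs
        exact Or.inl (Set.mem_iUnion.2 ⟨h, s, hs, rfl⟩)
      · simp only [coneSrc, Set.mem_ofPred_eq, ConeObj.inX.injEq] at hs
        exact Or.inr (Set.mem_iUnion.2 ⟨h, ⟨(s, t), e⟩, hs, rfl⟩)
      · simp [coneSrc] at hs
    | inY τ =>
      refine (((Y.face g).finite_fiber τ).image (ConeFace.yy (φ := φ))).subset ?_
      rintro (⟨h, s⟩ | ⟨h, s, t, e⟩ | s) hs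
      · simp [coneSrc] at hs
      · simp [coneSrc] at hs
      · simp only [coneSrc, Set.mem_ofPred_eq, ConeObj.inY.injEq] at hs
        exact ⟨s, hs, rfl⟩

/-- The first component of the bijection `f_m ∘ ∂_g → ∂_g ∘ f_n`. -/
def Map.sqFst (φ : Map X Y) (g : Fin m ↪o Fin n) (s : (X.face g).carrier)
    (t : (φ.span m).carrier) (e : (X.face g).tgt s = (φ.span m).src t) : (φ.span n).carrier :=
  ((φ.square g).toFun ⟨(s, t), e⟩).1.1

/-- The second component of the bijection `f_m ∘ ∂_g → ∂_g ∘ f_n`. -/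
def Map.sqSnd (φ : Map X Y) (g : Fin m ↪o Fin n) (s : (X.face g).carrier)
    (t : (φ.span m).carrier) (e : (X.face g).tgt s = (φ.span m).src t) : (Y.face g).carrier :=
  ((φ.square g).toFun ⟨(s, t), e⟩).1.2

theorem Map.src_sqFst (g : Fin m ↪o Fin n) (s : (X.face g).carrier)
    (t : (φ.span m).carrier) (e : (X.face g).tgt s = (φ.span m).src t) :
    (φ.span n).src (φ.sqFst g s t e) = (X.face g).src s := (φ.square g).src_eq ⟨(s, t), e⟩

theorem Map.tgt_sqSnd (g : Fin m ↪o Fin n) (s : (X.face g).carrier)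
    (t : (φ.span m).carrier) (e : (X.face g).tgt s = (φ.span m).src t) :
    (Y.face g).tgt (φ.sqSnd g s t e) = (φ.span m).tgt t := (φ.square g).tgt_eq ⟨(s, t), e⟩

theorem Map.tgt_sqFst (g : Fin m ↪o Fin n) (s : (X.face g).carrier)
    (t : (φ.span m).carrier) (e : (X.face g).tgt s = (φ.span m).src t) :
    (φ.span n).tgt (φ.sqFst g s t e) = (Y.face g).src (φ.sqSnd g s t e) :=
  ((φ.square g).toFun ⟨(s, t), e⟩).2

theorem Map.sq_injective (g : Fin m ↪o Fin n) {s s' : (X.face g).carrier}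
    {t t' : (φ.span m).carrier} (e : (X.face g).tgt s = (φ.span m).src t)
    (e' : (X.face g).tgt s' = (φ.span m).src t') (h₁ : φ.sqFst g s t e = φ.sqFst g s' t' e')
    (h₂ : φ.sqSnd g s t e = φ.sqSnd g s' t' e') : s = s' ∧ t = t' := by
  have := (φ.square g).toEquiv.injective (a₁ := ⟨(s, t), e⟩) (a₂ := ⟨(s', t'), e'⟩)
    (Subtype.ext (Prod.ext h₁ h₂))
  exact Prod.mk.inj (congrArg Subtype.val this)

theorem Map.exists_sq (g : Fin m ↪o Fin n) (x : (φ.span n).carrier) (y : (Y.face g).carrier)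
    (h : (φ.span n).tgt x = (Y.face g).src y) :
    ∃ s t, ∃ e : (X.face g).tgt s = (φ.span m).src t, φ.sqFst g s t e = x ∧ φ.sqSnd g s t e = y := by
  obtain ⟨⟨⟨s, t⟩, e⟩, hs⟩ := (φ.square g).toEquiv.surjective ⟨(x, y), h⟩
  exact ⟨s, t, e, congrArg (fun p => p.1.1) hs, congrArg (fun p => p.1.2) hs⟩

variable (f : Fin m ↪o Fin n) (g : Fin k ↪o Fin m) {h : Fin k ↪o Fin n} (e : g.trans f = h)

open Classical in
/-- The decomposition of the elements of the face spans of the mapping cone. -/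
def coneSplit : ConeFace φ h → ConeFace φ f × ConeFace φ g
  | .xx hh s =>
      (.xx (hh.of_trans_left e) (X.fst _ _
          (restr_trans_restr e (hh.of_trans_left e) (hh.of_trans_right e) hh) s),
        .xx (hh.of_trans_right e) (X.snd _ _
          (restr_trans_restr e (hh.of_trans_left e) (hh.of_trans_right e) hh) s))
  | .xy hh s t et =>
      -- If `f` keeps the cone vertex, the second face drops it. Otherwise it is dropped at once,
      -- and `φ`, which then acts before `g`, has to be moved past `g` by its coherence square.
      if hf : Hits f then
        (.xx hf (X.fst _ _ (corestr_trans_restr e hf (hh.of_trans e hf) hh) s),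
          .xy (hh.of_trans e hf) (X.snd _ _ (corestr_trans_restr e hf (hh.of_trans e hf) hh) s) t
            ((tgt_snd _ _ _ s).trans et))
      else
        (.xy (avoids_of_not_hits hh.1 hf)
            (X.fst _ _ (trans_corestr e (avoids_of_not_hits hh.1 hf) hh) s)
            (φ.sqFst g (X.snd _ _ (trans_corestr e (avoids_of_not_hits hh.1 hf) hh) s) t
              ((tgt_snd _ _ _ s).trans et))
            ((tgt_fst _ _ _ s).trans (Map.src_sqFst _ _ _ _).symm),
          .yy (φ.sqSnd g (X.snd _ _ (trans_corestr e (avoids_of_not_hits hh.1 hf) hh) s) t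
              ((tgt_snd _ _ _ s).trans et)))
  | .yy s => (.yy (Y.fst f g e s), .yy (Y.snd f g e s))

theorem coneSplit_xy_of_hits (hf : Hits f) (hg : Avoids g) (hh : Avoids h)
    (s : (X.face (corestr h hh)).carrier)
    (t : (φ.span k).carrier) (et : (X.face (corestr h hh)).tgt s = (φ.span k).src t) :
    coneSplit f g e (.xy hh s t et) =
      (.xx hf (X.fst _ _ (corestr_trans_restr e hf hg hh) s),
        .xy hg (X.snd _ _ (corestr_trans_restr e hf hg hh) s) t ((tgt_snd _ _ _ s).trans et)) :=
  dif_pos hf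

theorem coneSplit_xy_of_avoids (hf : Avoids f) (hh : Avoids h)
    (s : (X.face (corestr h hh)).carrier)
    (t : (φ.span k).carrier) (et : (X.face (corestr h hh)).tgt s = (φ.span k).src t) :
    coneSplit f g e (.xy hh s t et) =
        (.xy hf (X.fst _ _ (trans_corestr e hf hh) s)
            (φ.sqFst g (X.snd _ _ (trans_corestr e hf hh) s) t ((tgt_snd _ _ _ s).trans et))
            ((tgt_fst _ _ _ s).trans (Map.src_sqFst _ _ _ _).symm),
          .yy (φ.sqSnd g (X.snd _ _ (trans_corestr e hf hh) s) t ((tgt_snd _ _ _ s).trans et))) :=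
  dif_neg fun h => h.not_avoids hf

theorem hits_or_avoids {h : Fin k ↪o Fin n} (hh : Avoids h) (f : Fin m ↪o Fin n) :
    Hits f ∨ Avoids f :=
  or_iff_not_imp_left.2 (avoids_of_not_hits hh.1)

theorem coneTgt_coneSplit (s : ConeFace φ h) :
    coneTgt (coneSplit f g e s).1 = coneSrc (coneSplit f g e s).2 := by
  rcases s with ⟨hh, s⟩ | ⟨hh, s, t, et⟩ | s
  · exact congrArg (ConeObj.inX _) (tgt_fst _ _ _ s)
  · rcases hits_or_avoids hh f with hf | hf
    · rw [coneSplit_xy_of_hits f g e hf (hh.of_trans e hf)]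
      exact congrArg (ConeObj.inX _) (tgt_fst _ _ _ s)
    · rw [coneSplit_xy_of_avoids f g e hf]
      exact congrArg ConeObj.inY (Map.tgt_sqFst _ _ _ _)
  · exact congrArg ConeObj.inY (tgt_fst _ _ _ s)

theorem coneSrc_coneSplit (s : ConeFace φ h) : coneSrc (coneSplit f g e s).1 = coneSrc s := by
  rcases s with ⟨hh, s⟩ | ⟨hh, s, t, et⟩ | s
  · exact congrArg (ConeObj.inX _) (src_fst _ _ _ s)
  · rcases hits_or_avoids hh f with hf | hf
    · rw [coneSplit_xy_of_hits f g e hf (hh.of_trans e hf)]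
      exact congrArg (ConeObj.inX _) (src_fst _ _ _ s)
    · rw [coneSplit_xy_of_avoids f g e hf]
      exact congrArg (ConeObj.inX _) (src_fst _ _ _ s)
  · exact congrArg ConeObj.inY (src_fst _ _ _ s)

theorem coneTgt_coneSplit_snd (s : ConeFace φ h) :
    coneTgt (coneSplit f g e s).2 = coneTgt s := by
  rcases s with ⟨hh, s⟩ | ⟨hh, s, t, et⟩ | s
  · exact congrArg (ConeObj.inX _) (tgt_snd _ _ _ s)
  · rcases hits_or_avoids hh f with hf | hf
    · rw [coneSplit_xy_of_hits f g e hf (hh.of_trans e hf)]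
      rfl
    · rw [coneSplit_xy_of_avoids f g e hf]
      exact congrArg ConeObj.inY (Map.tgt_sqSnd _ _ _ _)
  · exact congrArg ConeObj.inY (tgt_snd _ _ _ s)

theorem coneSplit_injective : Function.Injective (coneSplit f g e : ConeFace φ h → _) := by
  intro s s' hs
  rcases s with ⟨hh, s⟩ | ⟨hh, s, t, et⟩ | s <;> rcases s' with ⟨hh', s'⟩ | ⟨hh', s', t', et'⟩ | s'
  · simp only [coneSplit, Prod.mk.injEq, ConeFace.xx.injEq] at hs
    exact congrArg _ (eq_of_fst_snd _ _ _ hs.1 hs.2)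
  · exact absurd hh' hh.not_avoids
  · simp [coneSplit] at hs
  · exact absurd hh hh'.not_avoids
  · rcases hits_or_avoids hh f with hf | hf
    · rw [coneSplit_xy_of_hits f g e hf (hh.of_trans e hf),
        coneSplit_xy_of_hits f g e hf (hh.of_trans e hf)] at hs
      simp only [Prod.mk.injEq, ConeFace.xx.injEq, ConeFace.xy.injEq] at hs
      obtain rfl := eq_of_fst_snd _ _ _ hs.1 hs.2.1
      obtain rfl := hs.2.2
      rfl
    · rw [coneSplit_xy_of_avoids f g e hf, coneSplit_xy_of_avoids f g e hf] at hs
      simp only [Prod.mk.injEq, ConeFace.yy.injEq, ConeFace.xy.injEq] at hs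
      obtain ⟨h1, rfl⟩ := Map.sq_injective _ _ _ hs.1.2 hs.2
      obtain rfl := eq_of_fst_snd _ _ _ hs.1.1 h1
      rfl
  · rcases hits_or_avoids hh f with hf | hf
    · rw [coneSplit_xy_of_hits f g e hf (hh.of_trans e hf)] at hs
      simp [coneSplit] at hs
    · rw [coneSplit_xy_of_avoids f g e hf] at hs
      simp [coneSplit] at hs
  · simp [coneSplit] at hs
  · rcases hits_or_avoids hh' f with hf | hf
    · rw [coneSplit_xy_of_hits f g e hf (hh'.of_trans e hf)] at hs
      simp [coneSplit] at hs
    · rw [coneSplit_xy_of_avoids f g e hf] at hs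
      simp [coneSplit] at hs
  · simp only [coneSplit, Prod.mk.injEq, ConeFace.yy.injEq] at hs
    exact congrArg _ (eq_of_fst_snd _ _ _ hs.1 hs.2)

theorem coneSplit_surjective (a : ConeFace φ f) (b : ConeFace φ g) (hab : coneTgt a = coneSrc b) :
    ∃ s : ConeFace φ h, coneSplit f g e s = (a, b) := by
  rcases a with ⟨hf, a⟩ | ⟨hf, a, t, et⟩ | a <;> rcases b with ⟨hg, b⟩ | ⟨hg, b, t', et'⟩ | b
  · simp only [coneTgt, coneSrc, ConeObj.inX.injEq] at hab
    obtain ⟨s, rfl, rfl⟩ := exists_fst_snd _ _ (restr_trans_restr e hf hg (hf.trans e hg)) a b hab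
    exact ⟨.xx (hf.trans e hg) s, rfl⟩
  · simp only [coneTgt, coneSrc, ConeObj.inX.injEq] at hab
    have hh := hg.trans_right e hf
    obtain ⟨s, rfl, rfl⟩ := exists_fst_snd _ _ (corestr_trans_restr e hf hg hh) a b hab
    exact ⟨.xy hh s t' ((tgt_snd _ _ _ _).symm.trans et'), coneSplit_xy_of_hits f g e hf hg hh _ _ _⟩
  · simp [coneTgt, coneSrc] at hab
  · simp [coneTgt, coneSrc] at hab
  · simp [coneTgt, coneSrc] at hab
  · simp only [coneTgt, coneSrc, ConeObj.inY.injEq] at hab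
    obtain ⟨c, t', ec, rfl, rfl⟩ := Map.exists_sq g t b hab
    have hh := hf.trans_left e
    obtain ⟨s, rfl, rfl⟩ := exists_fst_snd _ _ (trans_corestr e hf hh) a c
      (et.trans (Map.src_sqFst _ _ _ _))
    exact ⟨.xy hh s t' ((tgt_snd _ _ _ _).symm.trans ec), coneSplit_xy_of_avoids f g e hf hh _ _ _⟩
  · simp [coneTgt, coneSrc] at hab
  · simp [coneTgt, coneSrc] at hab
  · simp only [coneTgt, coneSrc, ConeObj.inY.injEq] at hab
    obtain ⟨s, rfl, rfl⟩ := exists_fst_snd f g e a b hab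
    exact ⟨.yy s, rfl⟩

variable (φ) in
/-- The structural 2-morphisms of the mapping cone. -/
def coneMu : LFSpan.FibrewiseBijection (coneSpan φ h) ((coneSpan φ f).comp (coneSpan φ g)) where
  toEquiv := Equiv.ofBijective
    (fun s : ConeFace φ h => (⟨coneSplit f g e s, coneTgt_coneSplit f g e s⟩ :
      ((coneSpan φ f).comp (coneSpan φ g)).carrier))
    ⟨fun _ _ hs => coneSplit_injective f g e (congrArg Subtype.val hs), fun p => by
      obtain ⟨s, hs⟩ := coneSplit_surjective f g e p.1.1 p.1.2 p.2
      exact ⟨s, Subtype.ext hs⟩⟩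
  src_eq := coneSrc_coneSplit f g e
  tgt_eq := coneTgt_coneSplit_snd f g e

theorem fst_of_eq_idEmb {i : Fin k ↪o Fin k} (hi : i = idEmb k) {f : Fin k ↪o Fin n}
    (e : i.trans f = f) (s : (X.face f).carrier) : X.fst f i e s = s := by
  subst hi
  exact X.mu_id_right f e s

theorem snd_of_eq_idEmb {i : Fin n ↪o Fin n} (hi : i = idEmb n) {f : Fin k ↪o Fin n}
    (e : f.trans i = f) (s : (X.face f).carrier) : X.snd i f e s = s := by
  subst hi
  exact X.mu_id_left f e s

theorem ConeFace.xy_congr {g : Fin m ↪o Fin n} {hg : Avoids g}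
    {s s' : (X.face (corestr g hg)).carrier} {t t' : (φ.span m).carrier}
    (e : (X.face (corestr g hg)).tgt s = (φ.span m).src t)
    (e' : (X.face (corestr g hg)).tgt s' = (φ.span m).src t') (hs : s = s') (ht : t = t') :
    ConeFace.xy (φ := φ) hg s t e = .xy hg s' t' e' := by
  subst hs ht
  rfl

theorem Map.sq_congr {g : Fin m ↪o Fin n} {s s' : (X.face g).carrier} {t t' : (φ.span m).carrier}
    (e : (X.face g).tgt s = (φ.span m).src t) (e' : (X.face g).tgt s' = (φ.span m).src t')
    (hs : s = s') (ht : t = t') :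
    φ.sqFst g s t e = φ.sqFst g s' t' e' ∧ φ.sqSnd g s t e = φ.sqSnd g s' t' e' := by
  subst hs ht
  exact ⟨rfl, rfl⟩

theorem Map.sq_trans (s : (X.face h).carrier) (t : (φ.span k).carrier)
    (et : (X.face h).tgt s = (φ.span k).src t)
    (e₁ : (X.face g).tgt (X.snd f g e s) = (φ.span k).src t)
    (e₂ : (X.face f).tgt (X.fst f g e s) = (φ.span m).src (φ.sqFst g (X.snd f g e s) t e₁)) :
    φ.sqFst h s t et = φ.sqFst f (X.fst f g e s) (φ.sqFst g (X.snd f g e s) t e₁) e₂ ∧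
      Y.fst f g e (φ.sqSnd h s t et) =
        φ.sqSnd f (X.fst f g e s) (φ.sqFst g (X.snd f g e s) t e₁) e₂ ∧
      Y.snd f g e (φ.sqSnd h s t et) = φ.sqSnd g (X.snd f g e s) t e₁ :=
  φ.square_comp f g h e ⟨(s, t), et⟩

/-- For a face from joins to `Y`, the cases are whether the cone vertex is dropped by `f₃`, `f₂` or
`f₁`. They need respectively no square, one square applied to equal arguments, and the compatibility
of squares with composition (`Map.sq_trans`). -/
theorem coneSplit_assoc {m₁ m₂ m₃ : ℕ} (f₁ : Fin m₁ ↪o Fin n) (f₂ : Fin m₂ ↪o Fin m₁)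
    (f₃ : Fin m₃ ↪o Fin m₂) {f₁₂ : Fin m₂ ↪o Fin n} {f₂₃ : Fin m₃ ↪o Fin m₁}
    {f₁₂₃ : Fin m₃ ↪o Fin n} (e₁₂ : f₂.trans f₁ = f₁₂) (e₂₃ : f₃.trans f₂ = f₂₃)
    (e₁ : f₂₃.trans f₁ = f₁₂₃) (e₃ : f₃.trans f₁₂ = f₁₂₃) (s : ConeFace φ f₁₂₃) :
    (coneSplit f₁ f₂₃ e₁ s).1 = (coneSplit f₁ f₂ e₁₂ (coneSplit f₁₂ f₃ e₃ s).1).1 ∧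
    (coneSplit f₂ f₃ e₂₃ (coneSplit f₁ f₂₃ e₁ s).2).1 =
      (coneSplit f₁ f₂ e₁₂ (coneSplit f₁₂ f₃ e₃ s).1).2 ∧
    (coneSplit f₂ f₃ e₂₃ (coneSplit f₁ f₂₃ e₁ s).2).2 = (coneSplit f₁₂ f₃ e₃ s).2 := by
  rcases s with ⟨hh, s⟩ | ⟨hh, s, t, et⟩ | s
  · have h₁ := hh.of_trans_left e₁
    have h₂₃ := hh.of_trans_right e₁
    have h₁₂ := hh.of_trans_left e₃
    have h₃ := hh.of_trans_right e₃
    have h₂ := h₁₂.of_trans_right e₁₂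
    exact ⟨congrArg _ (fst_fst _ _ _ _ _ _ _).symm,
      congrArg _ (fst_snd _ _ _ (restr_trans_restr e₂₃ h₂ h₃ h₂₃) _ _ _
        (restr_trans_restr e₁₂ h₁ h₂ h₁₂)),
      congrArg _ (snd_snd _ _ _ (restr_trans_restr e₂₃ h₂ h₃ h₂₃) _ _ _
        (restr_trans_restr e₁₂ h₁ h₂ h₁₂))⟩
  · rcases hits_or_avoids hh f₁ with h₁ | h₁
    · have h₂₃ := hh.of_trans e₁ h₁
      rw [coneSplit_xy_of_hits f₁ f₂₃ e₁ h₁ h₂₃]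
      rcases hits_or_avoids h₂₃ f₂ with h₂ | h₂
      · have h₁₂ := h₁.trans e₁₂ h₂
        have h₃ := hh.of_trans e₃ h₁₂
        rw [coneSplit_xy_of_hits f₁₂ f₃ e₃ h₁₂ h₃, coneSplit_xy_of_hits f₂ f₃ e₂₃ h₂ h₃]
        exact ⟨congrArg _ (fst_fst _ _ _ _ _ _ _).symm,
          congrArg _ (fst_snd _ _ _ (corestr_trans_restr e₂₃ h₂ h₃ h₂₃) _ _ _
            (restr_trans_restr e₁₂ h₁ h₂ h₁₂)),
          ConeFace.xy_congr _ _ (snd_snd _ _ _ (corestr_trans_restr e₂₃ h₂ h₃ h₂₃) _ _ _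
            (restr_trans_restr e₁₂ h₁ h₂ h₁₂)) rfl⟩
      · have h₁₂ := h₂.trans_right e₁₂ h₁
        have a1 := fst_fst _ _ _ (corestr_trans_restr e₁ h₁ h₂₃ hh) (trans_corestr e₃ h₁₂ hh) s
          (corestr_trans_restr e₁₂ h₁ h₂ h₁₂)
        have a2 := fst_snd _ _ _ (trans_corestr e₂₃ h₂ h₂₃) (corestr_trans_restr e₁ h₁ h₂₃ hh)
          (trans_corestr e₃ h₁₂ hh) s (corestr_trans_restr e₁₂ h₁ h₂ h₁₂)
        have a3 := snd_snd _ _ _ (trans_corestr e₂₃ h₂ h₂₃) (corestr_trans_restr e₁ h₁ h₂₃ hh)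
          (trans_corestr e₃ h₁₂ hh) s (corestr_trans_restr e₁₂ h₁ h₂ h₁₂)
        rw [coneSplit_xy_of_avoids f₁₂ f₃ e₃ h₁₂, coneSplit_xy_of_avoids f₂ f₃ e₂₃ h₂,
          coneSplit_xy_of_hits f₁ f₂ e₁₂ h₁ h₂]
        have a4 := Map.sq_congr ((tgt_snd _ _ _ _).trans ((tgt_snd _ _ _ s).trans et))
          ((tgt_snd _ _ _ s).trans et) a3 rfl
        exact ⟨congrArg _ a1.symm, ConeFace.xy_congr _ _ a2 a4.1, congrArg _ a4.2⟩
    · have h₁₂ := h₁.trans_left e₁₂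
      have a1 := fst_fst _ _ _ (trans_corestr e₁ h₁ hh) (trans_corestr e₃ h₁₂ hh) s
        (trans_corestr e₁₂ h₁ h₁₂)
      have a2 := fst_snd _ _ _ e₂₃ (trans_corestr e₁ h₁ hh) (trans_corestr e₃ h₁₂ hh) s
        (trans_corestr e₁₂ h₁ h₁₂)
      have a3 := snd_snd _ _ _ e₂₃ (trans_corestr e₁ h₁ hh) (trans_corestr e₃ h₁₂ hh) s
        (trans_corestr e₁₂ h₁ h₁₂)
      rw [coneSplit_xy_of_avoids f₁ f₂₃ e₁ h₁, coneSplit_xy_of_avoids f₁₂ f₃ e₃ h₁₂,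
        coneSplit_xy_of_avoids f₁ f₂ e₁₂ h₁]
      have b := Map.sq_trans f₂ f₃ e₂₃ _ t ((tgt_snd _ _ (trans_corestr e₁ h₁ hh) s).trans et)
        ((tgt_snd _ _ _ _).trans ((tgt_snd _ _ _ s).trans et))
        ((tgt_fst _ _ _ _).trans (Map.src_sqFst _ _ _ _).symm)
      have b3 := Map.sq_congr ((tgt_snd _ _ _ _).trans ((tgt_snd _ _ _ s).trans et))
        ((tgt_snd _ _ (trans_corestr e₃ h₁₂ hh) s).trans et) a3 rfl
      have b4 := Map.sq_congr ((tgt_fst _ _ _ _).trans (Map.src_sqFst _ _ _ _).symm)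
        ((tgt_snd _ _ (trans_corestr e₁₂ h₁ h₁₂) _).trans
          ((tgt_fst _ _ _ s).trans (Map.src_sqFst _ _ _ _).symm)) a2 b3.1
      exact ⟨ConeFace.xy_congr _ _ a1.symm (b.1.trans b4.1), congrArg _ (b.2.1.trans b4.2),
        congrArg _ (b.2.2.trans b3.2)⟩
  · exact ⟨congrArg _ (fst_fst _ _ _ _ _ _ _).symm, congrArg _ (fst_snd _ _ _ e₂₃ _ _ _ e₁₂),
      congrArg _ (snd_snd _ _ _ e₂₃ _ _ _ e₁₂)⟩

variable (φ) in
/-- The mapping cone of a map. -/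
def cone : SemiSimplicialObject.{u} where
  obj := ConeObj X Y
  face := coneSpan φ
  mu := coneMu φ
  face_id_bijective n := by
    constructor
    · rintro (⟨h, s⟩ | ⟨h, s, t, e⟩ | s) (⟨h', s'⟩ | ⟨h', s', t', e'⟩ | s') hs
      · simp only [coneSpan, coneSrc, ConeObj.inX.injEq] at hs
        exact congrArg _ ((X.face_id_bijective (n - 1)).1 hs)
      · exact absurd h' not_avoids_idEmb
      · simp [coneSpan, coneSrc] at hs
      · exact absurd h not_avoids_idEmb
      · exact absurd h not_avoids_idEmb
      · exact absurd h not_avoids_idEmb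
      · simp [coneSpan, coneSrc] at hs
      · exact absurd h' not_avoids_idEmb
      · simp only [coneSpan, coneSrc, ConeObj.inY.injEq] at hs
        exact congrArg _ ((Y.face_id_bijective n).1 hs)
    · rintro (⟨h, σ⟩ | τ)
      · obtain ⟨s, rfl⟩ := (X.face_id_bijective (n - 1)).2 σ
        exact ⟨.xx (hits_idEmb h) s, rfl⟩
      · obtain ⟨s, rfl⟩ := (Y.face_id_bijective n).2 τ
        exact ⟨.yy s, rfl⟩
  face_id_tgt n := by
    rintro (⟨h, s⟩ | ⟨h, s, t, e⟩ | s)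
    · exact congrArg (ConeObj.inX _) (X.face_id_tgt _ s)
    · exact absurd h not_avoids_idEmb
    · exact congrArg ConeObj.inY (Y.face_id_tgt _ s)
  mu_id_left := by
    rintro m n f e (⟨h, s⟩ | ⟨h, s, t, et⟩ | s)
    · exact congrArg _ (snd_of_eq_idEmb (restr_idEmb _) _ s)
    · show (coneSplit (idEmb n) f e (.xy h s t et)).2 = _
      rw [coneSplit_xy_of_hits _ _ _ (hits_idEmb h.1) h]
      exact ConeFace.xy_congr _ _ (snd_of_eq_idEmb (restr_idEmb _) _ s) rfl
    · exact congrArg _ (snd_of_eq_idEmb rfl e s)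
  mu_id_right := by
    rintro m n f e (⟨h, s⟩ | ⟨h, s, t, et⟩ | s)
    · exact congrArg _ (fst_of_eq_idEmb (restr_idEmb _) _ s)
    · show (coneSplit f (idEmb m) e (.xy h s t et)).1 = _
      rw [coneSplit_xy_of_avoids _ _ _ h]
      exact ConeFace.xy_congr _ _ (fst_of_eq_idEmb rfl _ s) (φ.square_id m ⟨(_, t), _⟩)
    · exact congrArg _ (fst_of_eq_idEmb rfl e s)
  mu_assoc f₁ f₂ f₃ _ _ _ e₁₂ e₂₃ e₁ e₃ s := coneSplit_assoc f₁ f₂ f₃ e₁₂ e₂₃ e₁ e₃ s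

end Cone

/-! ### The ordering of the mapping cone -/

section ConeOrdering

variable {X Y : SemiSimplicialObject.{u}} {φ : Map X Y} (oX : X.Ordering) (oY : Y.Ordering)
  {p q m n : ℕ}

/-- The order on the face spans of the mapping cone: that of `X` is reversed. -/
def coneLt {g : Fin m ↪o Fin n} : ConeFace φ g → ConeFace φ g → Prop
  -- Joining with the cone vertex adds one to the dimension but nothing to the deleted sets, which
  -- reverses the sign condition. Reversing the order compensates for this.
  | .xx h s, .xx _ t => (oX.order (restr g h)).lt t s
  | .xx _ _, .xy _ _ _ _ => True
  | .xx _ _, .yy _ => True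
  | .xy _ _ _ _, .xx _ _ => False
  -- Any linear order serves here: faces of joins that drop the cone vertex are not compared in the
  -- weights of pairs within `Y` or of pairs of joins.
  | .xy h s t e, .xy _ s' t' e' =>
      WellOrderingRel (⟨(s, t), e⟩ : ((X.face (corestr g h)).comp (φ.span m)).carrier)
        ⟨(s', t'), e'⟩
  | .xy _ _ _ _, .yy _ => True
  | .yy _, .xx _ _ => False
  | .yy _, .xy _ _ _ _ => False
  | .yy s, .yy t => (oY.order g).lt s t

theorem isStrictTotalOrder_coneLt (g : Fin m ↪o Fin n) :
    IsStrictTotalOrder (ConeFace φ g) (coneLt oX oY) where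
  irrefl := by
    rintro (⟨h, s⟩ | ⟨h, s, t, e⟩ | s) hs
    · exact @lt_irrefl _ (oX.order (restr g h)).toPartialOrder.toPreorder _ hs
    · exact irrefl_of WellOrderingRel _ hs
    · exact @lt_irrefl _ (oY.order g).toPartialOrder.toPreorder _ hs
  trans := by
    rintro (⟨h, s⟩ | ⟨h, s, t, e⟩ | s) (⟨h', s'⟩ | ⟨h', s', t', e'⟩ | s')
      (⟨h'', s''⟩ | ⟨h'', s'', t'', e''⟩ | s'') h1 h2 <;>
      first
        | exact trivial
        | exact False.elim h1
        | exact False.elim h2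
        | exact @lt_trans _ (oX.order (restr g h)).toPartialOrder.toPreorder _ _ _ h2 h1
        | exact trans_of WellOrderingRel h1 h2
        | exact @lt_trans _ (oY.order g).toPartialOrder.toPreorder _ _ _ h1 h2
  trichotomous := by
    rintro (⟨h, s⟩ | ⟨h, s, t, e⟩ | s) (⟨h', s'⟩ | ⟨h', s', t', e'⟩ | s') h1 h2
    · let _ := oX.order (restr g h)
      exact congrArg _ (le_antisymm (not_lt.1 h1) (not_lt.1 h2))
    · exact absurd trivial h1
    · exact absurd trivial h1
    · exact absurd trivial h2
    · rcases trichotomous_of WellOrderingRel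
        (⟨(s, t), e⟩ : ((X.face (corestr g h)).comp (φ.span m)).carrier) ⟨(s', t'), e'⟩ with
        h3 | h3 | h3
      · exact absurd h3 h1
      · have h4 := Prod.mk.inj (congrArg Subtype.val h3)
        exact ConeFace.xy_congr e e' h4.1 h4.2
      · exact absurd h3 h2
    · exact absurd trivial h1
    · exact absurd trivial h2
    · exact absurd trivial h2
    · let _ := oY.order g
      exact congrArg _ (le_antisymm (not_lt.1 h2) (not_lt.1 h1))

/-- An ordering of the mapping cone. -/
def coneOrdering (φ : Map X Y) (oX : X.Ordering) (oY : Y.Ordering) : (cone φ).Ordering where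
  order g := @linearOrderOfSTO (ConeFace φ g) (coneLt oX oY) (isStrictTotalOrder_coneLt oX oY g)
    (Classical.decRel _)

/-! ### Simplices of the target of the map -/

/-- An element of a face span of `Y` as one of the mapping cone. -/
def yFace (φ : Map X Y) {g : Fin m ↪o Fin n} (s : (Y.face g).carrier) :
    ((cone φ).face g).carrier := ConeFace.yy (φ := φ) s

variable {g : Fin p ↪o Fin n} {h : Fin q ↪o Fin n}

theorem agree_yFace {s : (Y.face g).carrier} {t : (Y.face h).carrier} (P : Finset (Fin n)) :
    Agree (yFace φ s) (yFace φ t) P ↔ Agree s t P :=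
  exists_congr fun _ => exists_congr fun _ => by
    show ConeFace.yy _ = ConeFace.yy _ ↔ _
    rw [ConeFace.yy.injEq]
    rfl

theorem less_yFace {s : (Y.face g).carrier} {t : (Y.face h).carrier} (P Q : Finset (Fin n)) :
    Less (coneOrdering φ oX oY) (yFace φ s) (yFace φ t) P Q ↔ Less oY s t P Q := by
  have hg : IsGood (yFace φ s) (yFace φ t) (P, Q) ↔ IsGood s t (P, Q) := by
    rw [isGood_iff, isGood_iff, agree_yFace, agree_yFace]
  exact ⟨fun ⟨H, hl⟩ => ⟨hg.1 H, hl⟩, fun ⟨H, hl⟩ => ⟨hg.2 H, hl⟩⟩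

theorem weight_yFace (s : (Y.face g).carrier) (t : (Y.face h).carrier) :
    weight (coneOrdering φ oX oY) (yFace φ s) (yFace φ t) = weight oY s t := by
  have h1 : Agree (yFace φ s) (yFace φ t) = Agree s t := funext fun P => propext (agree_yFace P)
  have h2 : ∀ c, LessIf c (coneOrdering φ oX oY) (yFace φ s) (yFace φ t) = LessIf c oY s t :=
    fun c => funext fun P => funext fun Q =>
      propext (lessIf_congr ⟨less_yFace oX oY P Q, less_yFace oX oY P Q⟩)
  rw [weight, weight, signedCount, signedCount, h1, h2]

/-! ### Joins of simplices with the cone vertex -/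

/-- The inclusion of the vertices other than the last one. -/
def initEmb (n : ℕ) : Fin (n - 1) ↪o Fin n := Fin.castLEOrderEmb (Nat.sub_le n 1)

theorem initEmb_val (x : Fin (n - 1)) : ((initEmb n x : Fin n) : ℕ) = x := rfl

theorem initEmb_mem_missing (hg : Hits g) (x : Fin (n - 1)) :
    initEmb n x ∈ missing g ↔ x ∈ missing (restr g hg) := by
  rw [← not_iff_not, notMem_missing, notMem_missing]
  constructor
  · rintro ⟨i, hi⟩
    have hi' : (g i : ℕ) = x := congrArg Fin.val hi
    obtain ⟨j, hj⟩ := id hg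
    have hij : g i < g j := Fin.lt_def.2 (by have := x.2; omega)
    have hij' : (i : ℕ) < j := g.lt_iff_lt.1 hij
    exact ⟨⟨i, by have := j.2; omega⟩, Fin.ext hi'⟩
  · rintro ⟨i, hi⟩
    have hi' := congrArg Fin.val hi
    exact ⟨⟨i, by have := i.2; omega⟩, Fin.ext hi'⟩

theorem notMem_range_initEmb {y : Fin n} : y ∉ Set.range (initEmb n) ↔ (y : ℕ) + 1 = n := by
  rw [Set.mem_range, not_exists]
  constructor
  · intro h
    by_contra hne
    exact h ⟨y, by have := y.2; omega⟩ rfl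
  · rintro h x rfl
    have := x.2
    rw [initEmb_val] at h
    omega

theorem notMem_missing_of_hits (hg : Hits g) {y : Fin n} (hy : (y : ℕ) + 1 = n) : y ∉ missing g := by
  rw [notMem_missing]
  obtain ⟨i, hi⟩ := hg
  exact ⟨i, Fin.ext (by omega)⟩

theorem missing_eq_map (hg : Hits g) :
    missing g = (missing (restr g hg)).map (initEmb n).toEmbedding := by
  ext y
  by_cases hy : (y : ℕ) + 1 = n
  · refine iff_of_false (notMem_missing_of_hits hg hy) fun h' => ?_
    obtain ⟨x, -, rfl⟩ := Finset.mem_map.1 h'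
    exact notMem_range_initEmb.2 hy ⟨x, rfl⟩
  · obtain ⟨x, rfl⟩ := not_not.1 (notMem_range_initEmb.not.2 hy)
    rw [initEmb_mem_missing hg]
    exact (Finset.mem_map' (initEmb n).toEmbedding).symm

theorem hits_of_missing_eq_map (hn : 0 < n) {W : Finset (Fin (n - 1))}
    (hg : missing g = W.map (initEmb n).toEmbedding) : Hits g := by
  have : (⟨n - 1, by omega⟩ : Fin n) ∉ missing g := by
    rw [hg]
    intro h'
    obtain ⟨x, -, hx⟩ := Finset.mem_map.1 h'
    exact notMem_range_initEmb.2 (Nat.sub_add_cancel hn) ⟨x, hx⟩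
  obtain ⟨i, hi⟩ := (notMem_missing g _).1 this
  exact ⟨i, by rw [hi]; exact Nat.sub_add_cancel hn⟩

theorem missing_restr_eq (hg : Hits g) {W : Finset (Fin (n - 1))}
    (h : missing g = W.map (initEmb n).toEmbedding) : missing (restr g hg) = W := by
  rw [missing_eq_map hg] at h
  exact Finset.map_injective _ h

/-- An element of a face span of `X`, joined with the cone vertex. -/
def xFace (φ : Map X Y) {g : Fin m ↪o Fin n} (hg : Hits g) (s : (X.face (restr g hg)).carrier) :
    ((cone φ).face g).carrier := ConeFace.xx (φ := φ) hg s

theorem xFace_inj {g : Fin m ↪o Fin n} (hg : Hits g) {s t : (X.face (restr g hg)).carrier} :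
    xFace φ hg s = xFace φ hg t ↔ s = t :=
  ⟨fun h => ConeFace.xx.inj h, fun h => h ▸ rfl⟩

variable (hg : Hits g) (hh : Hits h) (s : (X.face (restr g hg)).carrier)
  (t : (X.face (restr h hh)).carrier)

theorem subset_missing_restr (P : Finset (Fin (n - 1))) :
    P.map (initEmb n).toEmbedding ⊆ missing g ↔ P ⊆ missing (restr g hg) := by
  rw [missing_eq_map hg, Finset.map_subset_map]

theorem agree_xFace (P : Finset (Fin (n - 1))) :
    Agree (xFace φ hg s) (xFace φ hh t) (P.map (initEmb n).toEmbedding) ↔ Agree s t P := by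
  by_cases hP : P ⊆ missing (restr g hg) ∧ P ⊆ missing (restr h hh)
  · have hm := missing_missEmb (P.map (initEmb n).toEmbedding) rfl
    have hf := hits_of_missing_eq_map hg.pos hm
    obtain ⟨g', eg⟩ := exists_trans_eq _ g (hm.symm ▸ (subset_missing_restr hg P).2 hP.1)
    obtain ⟨h', eh⟩ := exists_trans_eq _ h (hm.symm ▸ (subset_missing_restr hh P).2 hP.2)
    rw [agree_iff hm eg eh, agree_iff (missing_restr_eq hf hm)
      (restr_trans_restr eg hf (hg.of_trans_right eg) hg)
      (restr_trans_restr eh hf (hh.of_trans_right eh) hh)]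
    exact xFace_inj hf
  · constructor
    · intro H
      have H' := Finset.subset_inter_iff.1 (agree_subset H)
      rw [subset_missing_restr hg, subset_missing_restr hh] at H'
      exact absurd H' hP
    · exact fun H => absurd (Finset.subset_inter_iff.1 (agree_subset H)) hP

theorem less_xFace (P Q : Finset (Fin (n - 1))) :
    Less (coneOrdering φ oX oY) (xFace φ hg s) (xFace φ hh t) (P.map (initEmb n).toEmbedding)
      (Q.map (initEmb n).toEmbedding) ↔ Less oX t s P Q := by
  have hu : P.map (initEmb n).toEmbedding ∪ Q.map (initEmb n).toEmbedding =
      (P ∪ Q).map (initEmb n).toEmbedding := (Finset.map_union _ _).symm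
  by_cases hd : Disjoint P Q
  · by_cases hP : P ∪ Q ⊆ missing (restr g hg) ∧ P ∪ Q ⊆ missing (restr h hh)
    · have hm₁ := missing_missEmb (P.map (initEmb n).toEmbedding) rfl
      have hm := missing_missEmb
        (P.map (initEmb n).toEmbedding ∪ Q.map (initEmb n).toEmbedding) rfl
      obtain ⟨f₂, e₂⟩ := exists_factorisation (P.map (initEmb n).toEmbedding)
        (Q.map (initEmb n).toEmbedding)
      have hf₁ := hits_of_missing_eq_map hg.pos hm₁
      have hf := hits_of_missing_eq_map hg.pos (hm.trans hu)
      have hf₂ := hf.of_trans_right e₂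
      obtain ⟨g', eg⟩ := exists_trans_eq (faceMap (P.map (initEmb n).toEmbedding ∪
        Q.map (initEmb n).toEmbedding)) g
        (by rw [hm, hu]; exact (subset_missing_restr hg _).2 hP.1)
      obtain ⟨h', eh⟩ := exists_trans_eq (faceMap (P.map (initEmb n).toEmbedding ∪
        Q.map (initEmb n).toEmbedding)) h
        (by rw [hm, hu]; exact (subset_missing_restr hh _).2 hP.2)
      have er₂ := restr_trans_restr e₂ hf₁ hf₂ hf
      have erg := restr_trans_restr eg hf (hg.of_trans_right eg) hg
      have erh := restr_trans_restr eh hf (hh.of_trans_right eh) hh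
      rw [less_iff ((Finset.disjoint_map _).2 hd) hm₁ hm e₂ eg eh,
        less_iff hd (missing_restr_eq hf₁ hm₁) (missing_restr_eq hf (hm.trans hu)) er₂ erh erg,
        agree_xFace, agree_symm]
      rfl
    · constructor
      · intro H
        have h1 := H.subset_left
        have h2 := H.subset_right
        rw [hu, subset_missing_restr hg] at h1
        rw [hu, subset_missing_restr hh] at h2
        exact absurd ⟨h1, h2⟩ hP
      · exact fun H => absurd ⟨H.subset_right, H.subset_left⟩ hP
  · exact ⟨fun H => absurd ((Finset.disjoint_map _).1 H.disjoint) hd,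
      fun H => absurd H.disjoint hd⟩

theorem signedCount_xFace {c c' : Prop} (hc : c' ↔ ¬ c) (D : Finset (Fin (n - 1))) :
    signedCount c (coneOrdering φ oX oY) (xFace φ hg s) (xFace φ hh t) ∅
      (D.map (initEmb n).toEmbedding) = signedCount c' oX s t ∅ D := by
  have hl : ∀ P Q, LessIf c' oX s t P Q ↔
      LessIf c (coneOrdering φ oX oY) (xFace φ hg s) (xFace φ hh t)
        (P.map (initEmb n).toEmbedding) (Q.map (initEmb n).toEmbedding) := by
    intro P Q
    unfold LessIf
    by_cases h : c
    · simp only [h, hc, not_true_eq_false, if_true, if_false]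
      exact (less_xFace oX oY hg hh s t P Q).symm
    · simp only [h, hc, not_false_eq_true, if_true, if_false]
      exact (less_xFace oX oY hh hg t s P Q).symm
  have := chainCount_map (initEmb n).toEmbedding ∅ (E := Agree s t) (pos := LessIf c' oX s t)
    (E' := Agree (xFace φ hg s) (xFace φ hh t))
    (pos' := LessIf c (coneOrdering φ oX oY) (xFace φ hg s) (xFace φ hh t)) Finset.univ
    (fun P _ => by
      rw [Finset.union_empty]
      exact (agree_xFace hg hh s t P).symm)
    (fun P Q _ _ => by
      rw [Finset.union_empty]
      exact hl P Q)
    D.card ∅ D (Finset.empty_subset _) (Finset.subset_univ _)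
  rw [signedCount, signedCount, this, Finset.card_map, Finset.map_empty, Finset.empty_union]

/-- The cone vertex is a gap above all other vertices, so it does not affect the pattern. The parity
shift from the extra dimension cancels against the reversed order. -/
theorem weight_xFace :
    weight (coneOrdering φ oX oY) (xFace φ hg s) (xFace φ hh t) = weight oX s t := by
  have hA : Alternating (missing g) (missing h) ↔
      Alternating (missing (restr g hg)) (missing (restr h hh)) := by
    refine alternating_iff_of_orderEmbedding (initEmb n) (initEmb_mem_missing hg)
      (initEmb_mem_missing hh) fun y hy => Or.inr ?_
    rw [notMem_range_initEmb] at hy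
    refine ⟨fun x => Fin.lt_def.2 ?_, notMem_missing_of_hits hg hy, notMem_missing_of_hits hh hy⟩
    rw [initEmb_val]
    have := x.2
    omega
  have hD : missing g ∩ missing h =
      (missing (restr g hg) ∩ missing (restr h hh)).map (initEmb n).toEmbedding := by
    rw [Finset.map_inter, ← missing_eq_map, ← missing_eq_map]
  have h1 : (missing g).card = (missing (restr g hg)).card := by
    rw [missing_eq_map hg, Finset.card_map]
  have h2 : (missing h).card = (missing (restr h hh)).card := by
    rw [missing_eq_map hh, Finset.card_map]
  rw [weight, weight, ind_congr hA, hD, signedCount_xFace oX oY hg hh s t]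
  -- Positivity of `n` is needed for `n - 1` to have the opposite parity of `n`.
  have := hg.pos
  rw [h1, h2, Nat.even_iff, Nat.even_iff]
  omega

end ConeOrdering

/-! ### Bilinearity of the products -/

section Bilinear

variable {X : SemiSimplicialObject.{u}} {o : X.Ordering} {p q : ℕ} (k : ℤ) (r : ℕ)

theorem cup_add_left (α α' : X.Cochain p) (β : X.Cochain q) :
    cup o k (α + α') β r = cup o k α β r + cup o k α' β r := by
  funext σ
  simp only [cup, Pi.add_apply, add_mul, mul_add, Finset.sum_add_distrib]

theorem cup_add_right (α : X.Cochain p) (β β' : X.Cochain q) :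
    cup o k α (β + β') r = cup o k α β r + cup o k α β' r := by
  funext σ
  simp only [cup, Pi.add_apply, mul_add, Finset.sum_add_distrib]

theorem zero_cup (β : X.Cochain q) : cup o k (0 : X.Cochain p) β r = 0 := by
  funext σ
  simp only [cup, Pi.zero_apply, zero_mul, mul_zero, Finset.sum_const_zero]

theorem cup_zero (α : X.Cochain p) : cup o k α (0 : X.Cochain q) r = 0 := by
  funext σ
  simp only [cup, Pi.zero_apply, mul_zero, Finset.sum_const_zero]

theorem cochain_add_self (α : X.Cochain p) : α + α = 0 := funext fun _ => zmod_two_add_self _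

theorem cochain_sub (α β : X.Cochain p) : α - β = α + β :=
  sub_eq_of_eq_add (by rw [add_assoc, cochain_add_self, add_zero])

/-- The symmetric terms in the coboundary of α ⌣_k α cancel, leaving dα ⌣_k α + α ⌣_k dα. The
coboundary of α ⌣_{k+1} dα cancels these and adds the right side. -/
theorem d_cup_self (α : X.Cochain p) :
    X.d r (cup o k α α r + cup o (k + 1) α (X.d p α) r) =
      cup o (k + 1) (X.d p α) (X.d p α) (r + 1) := by
  rw [map_add, d_cup, d_cup, d_d, cup_zero, add_zero, add_sub_cancel_right]
  have h1 := cochain_add_self (cup o k (X.d p α) α (r + 1))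
  have h2 := cochain_add_self (cup o k α (X.d p α) (r + 1))
  have h3 := cochain_add_self (cup o (k - 1) α α (r + 1))
  linear_combination (exp := 1) h1 + h2 + h3

variable {k r}

theorem cup_self_mem_cocycles {α : X.Cochain p} (h : α ∈ X.cocycles p) :
    cup o k α α r ∈ X.cocycles r := by
  have h' : X.d p α = 0 := h
  show X.d r _ = 0
  rw [d_cup, h', zero_cup, cup_zero, zero_add, zero_add, cochain_add_self]

theorem cup_self_add_cup_self_mem_coboundaries {α β : X.Cochain p} (hα : α ∈ X.cocycles p)
    (h : β ∈ X.coboundaries p) (hr : p ≤ r) :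
    cup o k (α + β) (α + β) r + cup o k α α r ∈ X.coboundaries r := by
  have hα' : X.d p α = 0 := hα
  cases p with
  | zero =>
    have hβ : β = 0 := h
    rw [hβ, add_zero, cochain_add_self]
    exact Submodule.zero_mem _
  | succ p =>
    -- The bound `hr` makes `r` positive, so there is a cochain group below it.
    obtain ⟨r, rfl⟩ := Nat.exists_eq_add_of_lt (Nat.lt_of_lt_of_le p.succ_pos hr)
    rw [zero_add]
    obtain ⟨β, rfl⟩ := h
    -- The first summand bounds the mixed terms α ⌣_k dβ + dβ ⌣_k α; the other two bound dβ ⌣_k dβ,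
    -- by `d_cup_self` with index `k - 1`.
    refine ⟨cup o (k + 1) α (X.d p β) r + (cup o (k - 1) β β r + cup o (k - 1 + 1) β (X.d p β) r), ?_⟩
    rw [map_add, d_cup_self, d_cup, hα', d_d, zero_cup, cup_zero, add_sub_cancel_right,
      sub_add_cancel, cup_add_left, cup_add_right, cup_add_right]
    have h1 := cochain_add_self (cup o k α α (r + 1))
    linear_combination (exp := 1) - h1

end Bilinear

/-! ### Cochains on the mapping cone -/

section ConeCochain

variable {X Y : SemiSimplicialObject.{u}} {φ : Map X Y} (oX : X.Ordering) (oY : Y.Ordering)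
  {p q m n r : ℕ}

/-- A simplex of `Y` as one of the mapping cone. -/
def yObj (φ : Map X Y) (τ : Y.obj n) : (cone φ).obj n := ConeObj.inY τ

/-- The join of a simplex of `X` with the cone vertex. -/
def xObj (φ : Map X Y) (σ : X.obj n) : (cone φ).obj (n + 1) := ConeObj.inX n.succ_pos σ

/-- The restriction of a cochain on the mapping cone to `Y`. -/
def yPart (z : (cone φ).Cochain n) : Y.Cochain n := fun τ => z (yObj φ τ)

/-- The restriction of a cochain on the mapping cone to the joins with the cone vertex. -/
def xPart (z : (cone φ).Cochain (n + 1)) : X.Cochain n := fun σ => z (xObj φ σ)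

/-- The extension by zero of a cochain on `Y` to the mapping cone. -/
def ofY (φ : Map X Y) (α : Y.Cochain n) : (cone φ).Cochain n
  | .inX _ _ => 0
  | .inY τ => α τ

theorem inX_ne_inY {h : 0 < n} {σ : X.obj (n - 1)} {τ : Y.obj n} :
    ConeObj.inX h σ ≠ (ConeObj.inY τ : ConeObj X Y n) := nofun

theorem sum_fiber_yObj (g : Fin m ↪o Fin n) (τ : Y.obj n)
    (F : ((cone φ).face g).carrier → ZMod 2) :
    ∑ s ∈ ((cone φ).face g).fiber (yObj φ τ), F s =
      ∑ s ∈ (Y.face g).fiber τ, F (yFace φ s) := by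
  symm
  refine Finset.sum_bij (fun s _ => yFace φ s) ?_ ?_ ?_ ?_
  · intro s hs
    rw [LFSpan.mem_fiber] at hs ⊢
    exact congrArg ConeObj.inY hs
  · intro s _ t _ hst
    exact ConeFace.yy.inj hst
  · rintro (⟨h, s⟩ | ⟨h, s, t, e⟩ | s) hs
    · exact absurd ((LFSpan.mem_fiber _ _ _).1 hs) inX_ne_inY
    · exact absurd ((LFSpan.mem_fiber _ _ _).1 hs) inX_ne_inY
    · exact ⟨s, (LFSpan.mem_fiber _ _ _).2 (ConeObj.inY.inj ((LFSpan.mem_fiber _ _ _).1 hs)), rfl⟩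
  · intros; rfl

theorem sum_fiber_xObj_of_hits {g : Fin (m + 1) ↪o Fin (n + 1)} (hg : Hits g) (σ : X.obj n)
    (F : ((cone φ).face g).carrier → ZMod 2) :
    ∑ s ∈ ((cone φ).face g).fiber (xObj φ σ), F s =
      ∑ s ∈ (X.face (restr g hg)).fiber σ, F (xFace φ hg s) := by
  symm
  refine Finset.sum_bij (fun s _ => xFace φ hg s) ?_ ?_ ?_ ?_
  · intro s hs
    rw [LFSpan.mem_fiber] at hs ⊢
    exact congrArg (ConeObj.inX _) hs
  · intro s _ t _ hst
    exact (xFace_inj hg).1 hst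
  · rintro (⟨h, s⟩ | ⟨h, s, t, e⟩ | s) hs
    · exact ⟨s, (LFSpan.mem_fiber _ _ _).2 (ConeObj.inX.inj ((LFSpan.mem_fiber _ _ _).1 hs)), rfl⟩
    · exact absurd h hg.not_avoids
    · exact absurd ((LFSpan.mem_fiber _ _ _).1 hs) inX_ne_inY.symm
  · intros; rfl

theorem sum_fiber_xObj_of_avoids {g : Fin m ↪o Fin (n + 1)} (hg : Avoids g) (σ : X.obj n)
    (F : ((cone φ).face g).carrier → ZMod 2) :
    ∑ s ∈ ((cone φ).face g).fiber (xObj φ σ), F s =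
      ∑ x ∈ ((X.face (corestr g hg)).comp (φ.span m)).fiber σ,
        F (ConeFace.xy (φ := φ) hg x.1.1 x.1.2 x.2) := by
  symm
  refine Finset.sum_bij (fun x _ => ConeFace.xy (φ := φ) hg x.1.1 x.1.2 x.2) ?_ ?_ ?_ ?_
  · intro s hs
    rw [LFSpan.mem_fiber] at hs
    exact (LFSpan.mem_fiber _ _ _).2 (congrArg (ConeObj.inX _) hs)
  · intro s _ t _ hst
    have := ConeFace.xy.inj hst
    exact Subtype.ext (Prod.ext this.1 this.2)
  · rintro (⟨h, s⟩ | ⟨h, s, t, e⟩ | s) hs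
    · exact absurd hg h.not_avoids
    · exact ⟨⟨(s, t), e⟩,
        (LFSpan.mem_fiber _ _ _).2 (ConeObj.inX.inj ((LFSpan.mem_fiber _ _ _).1 hs)), rfl⟩
    · exact absurd ((LFSpan.mem_fiber _ _ _).1 hs) inX_ne_inY.symm
  · intros; rfl

theorem apply_tgt_of_avoids {g : Fin m ↪o Fin n} (hg : Avoids g) {z : (cone φ).Cochain m}
    (hz : yPart z = 0) (s : ((cone φ).face g).carrier) : z (((cone φ).face g).tgt s) = 0 := by
  rcases s with ⟨h, s⟩ | ⟨h, s, t, e⟩ | s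
  · exact absurd hg h.not_avoids
  · exact congrFun hz _
  · exact congrFun hz _

theorem yPart_d (z : (cone φ).Cochain n) : yPart ((cone φ).d n z) = Y.d n (yPart z) := by
  funext τ
  show (cone φ).d n z (yObj φ τ) = _
  rw [d_apply, d_apply]
  exact Finset.sum_congr rfl fun g _ => sum_fiber_yObj g τ _

theorem yPart_cup (k : ℤ) (a : (cone φ).Cochain p) (b : (cone φ).Cochain q) :
    yPart (cup (coneOrdering φ oX oY) k a b r) = cup oY k (yPart a) (yPart b) r := by
  funext τ
  show cup (coneOrdering φ oX oY) k a b r (yObj φ τ) = _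
  rw [cup_apply, cup_apply]
  congr 1
  refine Finset.sum_congr rfl fun x _ => ?_
  rw [sum_fiber_yObj]
  refine Finset.sum_congr rfl fun s _ => ?_
  rw [sum_fiber_yObj]
  refine Finset.sum_congr rfl fun t _ => ?_
  rw [weight_yFace]
  rfl

/-! ### Restriction of products and coboundaries to the joins -/

theorem restr_injective {g h : Fin (m + 1) ↪o Fin (n + 1)} (hg : Hits g) (hh : Hits h)
    (e : restr g hg = restr h hh) : g = h :=
  missing_injective (by rw [missing_eq_map hg, missing_eq_map hh, e])

theorem exists_restr_eq (g' : Fin m ↪o Fin n) :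
    ∃ (g : Fin (m + 1) ↪o Fin (n + 1)) (hg : Hits g), restr g hg = g' := by
  have h1 := card_missing g'
  obtain ⟨g, hg⟩ := exists_missing_eq (m := m + 1)
    ((missing g').map (initEmb (n + 1)).toEmbedding) (by rw [Finset.card_map]; omega)
  have hh := hits_of_missing_eq_map n.succ_pos hg
  exact ⟨g, hh, missing_injective (missing_restr_eq hh hg)⟩

theorem sum_eq_sum_restr (G : (Fin (m + 1) ↪o Fin (n + 1)) → ZMod 2)
    (G' : (Fin m ↪o Fin n) → ZMod 2) (h₀ : ∀ g, Avoids g → G g = 0)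
    (h₁ : ∀ g (hg : Hits g), G g = G' (restr g hg)) : ∑ g, G g = ∑ g, G' g := by
  choose e he hr using (exists_restr_eq : ∀ g' : Fin m ↪o Fin n, _)
  symm
  refine Finset.sum_of_injOn e ?_ (fun _ _ => Finset.mem_coe.2 (Finset.mem_univ _)) ?_ ?_
  · intro g _ h _ hgh
    rw [← hr g, ← hr h]
    congr 1
  · intro g _ hg
    by_contra hne
    have hh : Hits g := by
      by_contra h
      exact hne (h₀ g (avoids_of_not_hits n.succ_pos h))
    exact hg ⟨restr g hh, Finset.mem_coe.2 (Finset.mem_univ _),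
      restr_injective (he _) hh (hr _)⟩
  · intro g _
    rw [h₁ _ (he g), hr]

/-- Faces that drop the cone vertex land in `Y`, where one of the cochains vanishes. Only faces of
joins remain, with the weights of `X`; all degrees and `k` rise by one. -/
theorem xPart_cup (k : ℤ) {a : (cone φ).Cochain (p + 1)} {b : (cone φ).Cochain (q + 1)}
    (ha : yPart a = 0) (hb : yPart b = 0) :
    xPart (cup (coneOrdering φ oX oY) (k + 1) a b (r + 1)) = cup oX k (xPart a) (xPart b) r := by
  funext σ
  show cup (coneOrdering φ oX oY) (k + 1) a b (r + 1) (xObj φ σ) = _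
  rw [cup_apply, cup_apply]
  congr 1
  · refine ind_congr ?_
    push_cast
    omega
  · rw [Fintype.sum_prod_type, Fintype.sum_prod_type]
    refine sum_eq_sum_restr _ _ (fun g hg => ?_) fun g hg => ?_
    · refine Finset.sum_eq_zero fun h _ => Finset.sum_eq_zero fun s _ =>
        Finset.sum_eq_zero fun t _ => ?_
      rw [apply_tgt_of_avoids hg ha, zero_mul, mul_zero]
    · refine sum_eq_sum_restr _ _ (fun h hh => ?_) fun h hh => ?_
      · refine Finset.sum_eq_zero fun s _ => Finset.sum_eq_zero fun t _ => ?_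
        rw [apply_tgt_of_avoids hh hb, mul_zero, mul_zero]
      · rw [sum_fiber_xObj_of_hits hg]
        refine Finset.sum_congr rfl fun s _ => ?_
        rw [sum_fiber_xObj_of_hits hh]
        refine Finset.sum_congr rfl fun t _ => ?_
        rw [weight_xFace]
        rfl

theorem pullback_face_idEmb (α : X.Cochain n) : (X.face (idEmb n)).pullback α = α := by
  funext σ
  obtain ⟨s, rfl⟩ := (X.face_id_bijective n).2 σ
  rw [LFSpan.pullback_apply, Finset.sum_eq_single s, X.face_id_tgt]
  · intro t ht hts
    exact absurd ((X.face_id_bijective n).1 ((LFSpan.mem_fiber _ _ _).1 ht)) hts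
  · exact fun h => absurd ((LFSpan.mem_fiber _ _ _).2 rfl) h

theorem avoids_castSucc (n : ℕ) : Avoids (Fin.castSuccOrderEmb : Fin n ↪o Fin (n + 1)) :=
  ⟨n.succ_pos, fun i => Nat.succ_lt_succ i.2⟩

theorem eq_castSucc_of_avoids {f : Fin n ↪o Fin (n + 1)} (h : Avoids f) :
    f = Fin.castSuccOrderEmb := by
  have hc : corestr f h = idEmb n := missing_injective (by
    have h1 := card_missing (corestr f h)
    have h2 := card_missing (idEmb n)
    rw [Finset.card_eq_zero.1 (show (missing (corestr f h)).card = 0 by omega),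
      Finset.card_eq_zero.1 (show (missing (idEmb n)).card = 0 by omega)])
  ext i
  exact congrArg (fun c : Fin n ↪o Fin n => (c i : ℕ)) hc

/-- Only the face opposite the cone vertex leads from a join to `Y`, and its span is that of `φ`
preceded by an identity face. -/
theorem xPart_d_ofY (α : Y.Cochain n) : xPart ((cone φ).d n (ofY φ α)) = φ.cochainMap n α := by
  funext σ
  show (cone φ).d n (ofY φ α) (xObj φ σ) = _
  rw [d_apply, Finset.sum_eq_single Fin.castSuccOrderEmb,
    sum_fiber_xObj_of_avoids (avoids_castSucc n)]
  · have h := LFSpan.pullback_comp (X.face (idEmb n)) (φ.span n) α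
    rw [pullback_face_idEmb] at h
    exact congrFun h σ
  · intro f _ hf
    have hh : Hits f := by
      by_contra h
      exact hf (eq_castSucc_of_avoids (avoids_of_not_hits n.succ_pos h))
    refine Finset.sum_eq_zero ?_
    rintro (⟨h, s⟩ | ⟨h, s, t, e⟩ | s) hs
    · rfl
    · exact absurd h hh.not_avoids
    · exact absurd ((LFSpan.mem_fiber _ _ _).1 hs) inX_ne_inY.symm
  · exact fun h => absurd (Finset.mem_univ _) h

/-- Cochains vanishing on `Y` form the cochain complex of `X` shifted by one degree, so the
restriction of the coboundary is that of `X`. In the lowest degree nothing remains. -/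
theorem xPart_d_mem_coboundaries {z : (cone φ).Cochain n} (hz : yPart z = 0) :
    xPart ((cone φ).d n z) ∈ X.coboundaries n := by
  cases n with
  | zero =>
    have : xPart ((cone φ).d 0 z) = 0 := by
      funext σ
      show (cone φ).d 0 z (xObj φ σ) = 0
      rw [d_apply]
      refine Finset.sum_eq_zero fun f _ => Finset.sum_eq_zero fun s _ => ?_
      exact apply_tgt_of_avoids (avoids_of_not_hits Nat.one_pos fun h => h.pos'.ne rfl) hz s
    rw [this]
    exact Submodule.zero_mem _
  | succ n =>
    refine ⟨xPart z, ?_⟩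
    funext σ
    show _ = (cone φ).d (n + 1) z (xObj φ σ)
    rw [d_apply, d_apply]
    symm
    refine sum_eq_sum_restr _ _ (fun f hf => ?_) fun f hf => ?_
    · exact Finset.sum_eq_zero fun s _ => apply_tgt_of_avoids hf hz s
    · rw [sum_fiber_xObj_of_hits hf]
      rfl

/-- Splitting `z` as a cochain vanishing on `Y` plus the extension by zero of its restriction
identifies the connecting map of the cone with `φ.cochainMap` up to coboundaries. -/
theorem xPart_d_add_mem_coboundaries (z : (cone φ).Cochain n) :
    xPart ((cone φ).d n z) + φ.cochainMap n (yPart z) ∈ X.coboundaries n := by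
  have h : yPart (z + ofY φ (yPart z)) = 0 := cochain_add_self (yPart z)
  have := xPart_d_mem_coboundaries h
  rw [map_add] at this
  rw [← xPart_d_ofY]
  exact this

variable {oX oY}

theorem cochainMap_cup_add_mem_coboundaries (φ : Map X Y) (k : ℤ) {α : Y.Cochain n}
    (hα : α ∈ Y.cocycles n) :
    cup oX k (φ.cochainMap n α) (φ.cochainMap n α) r + φ.cochainMap r (cup oY k α α r) ∈
      X.coboundaries r := by
  have hy : yPart (ofY φ α) = α := rfl
  have hd : yPart ((cone φ).d n (ofY φ α)) = 0 := by
    rw [yPart_d, hy]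
    exact hα
  -- This cochain restricts on `Y` to α ⌣_k α, since the second product vanishes there. By
  -- `d_cup_self` its coboundary restricts on the joins to the product of φ^*α with itself.
  have h := xPart_d_add_mem_coboundaries (cup (coneOrdering φ oX oY) k (ofY φ α) (ofY φ α) r +
    cup (coneOrdering φ oX oY) (k + 1) (ofY φ α) ((cone φ).d n (ofY φ α)) r)
  rw [d_cup_self, xPart_cup oX oY k hd hd, xPart_d_ofY] at h
  have e : yPart (cup (coneOrdering φ oX oY) k (ofY φ α) (ofY φ α) r +
      cup (coneOrdering φ oX oY) (k + 1) (ofY φ α) ((cone φ).d n (ofY φ α)) r) =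
      cup oY k α α r := by
    show yPart (cup (coneOrdering φ oX oY) k (ofY φ α) (ofY φ α) r) +
      yPart (cup (coneOrdering φ oX oY) (k + 1) (ofY φ α) ((cone φ).d n (ofY φ α)) r) = _
    rw [yPart_cup, yPart_cup, hd, cup_zero, add_zero, hy]
  rwa [e] at h

end ConeCochain

/-! ### Steenrod squares -/

/-- The identity map. -/
def Map.id (X : SemiSimplicialObject.{u}) : Map X X where
  span n :=
    { carrier := X.obj n
      src := fun σ => σ
      tgt := fun σ => σ
      finite_fiber := fun σ => Set.finite_singleton σ }
  square g :=
    { toFun := fun x => ⟨((X.face g).src x.1.1, x.1.1), rfl⟩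
      invFun := fun x => ⟨(x.1.2, (X.face g).tgt x.1.2), rfl⟩
      left_inv := fun x => Subtype.ext (Prod.ext rfl x.2)
      right_inv := fun x => Subtype.ext (Prod.ext x.2.symm rfl)
      src_eq := fun _ => rfl
      tgt_eq := fun x => x.2 }
  square_id n x := (X.face_id_tgt n x.1.1).symm.trans x.2
  square_comp f g h e x := ⟨((X.mu f g h e).src_eq x.1.1).symm, rfl, rfl⟩

theorem Map.cohomologyMap_id (X : SemiSimplicialObject.{u}) (n : ℕ) (a : X.Cohomology n) :
    (Map.id X).cohomologyMap n a = a := by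
  obtain ⟨α, rfl⟩ := Submodule.Quotient.mk_surjective _ a
  refine congrArg X.cls (Subtype.ext (funext fun σ => ?_))
  show ((Map.id X).span n).pullback α.1 σ = α.1 σ
  refine Finset.sum_eq_single (M := ZMod 2) (f := fun τ => α.1 τ) σ ?_ ?_
  · exact fun τ hτ h => absurd ((LFSpan.mem_fiber _ _ _).1 hτ) h
  · exact fun h => absurd ((LFSpan.mem_fiber _ _ _).2 rfl) h

theorem cls_eq_cls {X : SemiSimplicialObject.{u}} {n : ℕ} {α β : X.cocycles n} :
    X.cls α = X.cls β ↔ (α + β : X.Cochain n) ∈ X.coboundaries n := by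
  rw [← cochain_sub]
  exact Submodule.Quotient.eq _

/-- The operation `𝔰𝔮^i`. -/
def steenrodSquare {X : SemiSimplicialObject.{u}} (o : X.Ordering) (n i : ℕ) (a : X.Cohomology n) :
    X.Cohomology (n + i) :=
  X.cls ⟨cup o ((n : ℤ) - 1 - i) (Quotient.out a).1 (Quotient.out a).1 (n + i),
    cup_self_mem_cocycles (Quotient.out a).2⟩

theorem isSteenrodSquare_steenrodSquare {X : SemiSimplicialObject.{u}} (o : X.Ordering)
    (n i : ℕ) : IsSteenrodSquare o n i (steenrodSquare o n i) := by
  intro α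
  refine ⟨cup_self_mem_cocycles α.2, cls_eq_cls.2 ?_⟩
  have h : X.cls (Quotient.out (X.cls α)) = X.cls α := Quotient.out_eq _
  have := cup_self_add_cup_self_mem_coboundaries (o := o) (k := (n : ℤ) - 1 - i) α.2
    (cls_eq_cls.1 h) (Nat.le_add_right n i)
  rw [add_comm (Quotient.out (X.cls α)).1, ← add_assoc, cochain_add_self, zero_add] at this
  exact this

theorem cohomologyMap_steenrodSquare {X Y : SemiSimplicialObject.{u}} (oX : X.Ordering)
    (oY : Y.Ordering) (φ : Map X Y) (n i : ℕ) (a : Y.Cohomology n) :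
    φ.cohomologyMap (n + i) (steenrodSquare oY n i a) =
      steenrodSquare oX n i (φ.cohomologyMap n a) := by
  obtain ⟨α, rfl⟩ := Submodule.Quotient.mk_surjective _ a
  obtain ⟨h₁, e₁⟩ := isSteenrodSquare_steenrodSquare oY n i α
  obtain ⟨h₂, e₂⟩ := isSteenrodSquare_steenrodSquare oX n i
    ⟨φ.cochainMap n α, φ.cochainMap_mem_cocycles n α.2⟩
  refine (congrArg _ e₁).trans (Eq.trans ?_ e₂.symm)
  refine (cls_eq_cls (α := ⟨_, h₂⟩) (β := ⟨_, φ.cochainMap_mem_cocycles _ h₁⟩)).2 ?_ |>.symm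
  exact cochainMap_cup_add_mem_coboundaries φ _ α.2

end SemiSimplicialObject

end Burnside

end

theorem mainTheorem2 :
    ∃ sq : ∀ (X : Burnside.SemiSimplicialObject.{u}) (_ : X.Ordering) (n i : ℕ),
        X.Cohomology n → X.Cohomology (n + i),
      (∀ (X : Burnside.SemiSimplicialObject.{u}) (o : X.Ordering) (n i : ℕ),
        Burnside.SemiSimplicialObject.IsSteenrodSquare o n i (sq X o n i)) ∧
      (∀ (X Y : Burnside.SemiSimplicialObject.{u}) (oX : X.Ordering) (oY : Y.Ordering)
        (f : Burnside.SemiSimplicialObject.Map X Y) (n i : ℕ) (a : Y.Cohomology n),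
        f.cohomologyMap (n + i) (sq Y oY n i a) = sq X oX n i (f.cohomologyMap n a)) ∧
      (∀ (X : Burnside.SemiSimplicialObject.{u}) (o o' : X.Ordering) (n i : ℕ),
        sq X o n i = sq X o' n i) := by
  refine ⟨fun X o n i => Burnside.SemiSimplicialObject.steenrodSquare o n i,
    fun X o n i => Burnside.SemiSimplicialObject.isSteenrodSquare_steenrodSquare o n i,
    fun X Y oX oY f n i a =>
      Burnside.SemiSimplicialObject.cohomologyMap_steenrodSquare oX oY f n i a,
    fun X o o' n i => funext fun a => ?_⟩
  -- Naturality for the identity, whose source and target carry different orders.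
  have h := Burnside.SemiSimplicialObject.cohomologyMap_steenrodSquare o' o
    (Burnside.SemiSimplicialObject.Map.id X) n i a
  rwa [Burnside.SemiSimplicialObject.Map.cohomologyMap_id,
    Burnside.SemiSimplicialObject.Map.cohomologyMap_id] at h
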